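/- Let $n\ge 2$ and let $(M,Q,g)$ be a compact connected quaternionic-Kähler manifold of dimension $4n$. That is, $Q\subset\mathrm{End}(TM)$ is a rank three subbundle locally generated by smooth almost complex structures $J_1,J_2,J_3$ satisfying the quaternionic relations $J_i^2=-\mathrm{Id}$, $J_1J_2=J_3=-J_2J_1$ (an admissible basis of $Q$), and $g$ is a Riemannian metric whose Levi-Civita connection $D^g$ preserves $Q$ and for which all elements of $Q$ are skew-symmetric. A quaternionic connection is a torsion-free linear connection on $M$ that preserves $Q$. For a $1$-form $\alpha$ put $$S^\alpha_X=\alpha(X)\,\mathrm{Id}_{TM}+\alpha\otimes X-\sum_{i=1}^3\bigl[\alpha(J_iX)J_i+(\alpha\circ J_i)\otimes J_iX\bigr],\qquad X\in TM,$$ which does not depend on the admissible basis. Locally $TM\otimes\mathbb C\cong \mathbf E\otimes\mathbf H$ and $Q\otimes\mathbb C\cong S^2(\mathbf H)$, with $\mathbf E$, $\mathbf H$ of complex rank $2n$ and $2$, so that $T^*M\otimes Q\cong(\mathbf E^*\otimes S^3(\mathbf H))\oplus(\mathbf E^*\otimes\mathbf H)$. In real terms the first summand is the kernel of the contraction $T^*M\otimes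 Q\to T^*M$, $\beta\otimes A\mapsto\beta\circ A$, and the second consists of all $\sum_i(\beta\circ J_i)\otimes J_i$ with $\beta\in T^*M$. For a quaternionic connection $D$, the Penrose operator $P^D:\Gamma(Q)\to\Gamma(\mathbf E^*\otimes S^3(\mathbf H))$ is the composition of $D:\Gamma(Q)\to\Gamma(T^*M\otimes Q)$ with the projection onto the first summand. Let $D=D^g+S^\alpha$ be a quaternionic connection on $(M,Q)$, where $\alpha$ is a smooth co-closed $1$-form. Assume that either $\mathrm{Scal}^g<0$, or $\mathrm{Scal}^g=0$ and $\alpha\ne0$ at every point of a dense subset of $M$. Then the only smooth global section $A\in\Gamma(Q)$ with $P^DA=0$ is $A=0$. -/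

import Mathlib

open Bundle
open scoped Manifold ContDiff Topology

noncomputable section

namespace QuatGeom

section LinearAlgebra

variable {V : Type*} [AddCommGroup V] [Module ℝ V] [TopologicalSpace V]
  [IsTopologicalAddGroup V] [ContinuousSMul ℝ V]

/-- `J` is an *admissible basis* of the space `Q` of endomorphisms of `V`: three complex structures
that satisfy the quaternionic relations (the remaining ones, such as `J₁ J₀ = - J₂`, follow from
those listed) and span `Q`. -/
structure IsAdmissibleBasis (Q : Submodule ℝ (V →L[ℝ] V)) (J : Fin 3 → V →L[ℝ] V) : Prop where
  sq : ∀ i, J i * J i = -1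
  mul : J 0 * J 1 = J 2
  span : Q = Submodule.span ℝ (Set.range J)

/-- The natural Euclidean product `⟨A, B⟩ = - tr (A B) / dim V`, for which every admissible basis is
orthonormal. -/
def qInner (A B : V →L[ℝ] V) : ℝ :=
  -(LinearMap.trace ℝ V ((A * B : V →L[ℝ] V) : V →ₗ[ℝ] V)) / Module.finrank ℝ V

/-- The endomorphism `S^a_X = a(X) Id + a ⊗ X - ∑ᵢ [a(Jᵢ X) Jᵢ + (a ∘ Jᵢ) ⊗ Jᵢ X]` of `V`. -/
def sTensor (J : Fin 3 → V →L[ℝ] V) (a : V →L[ℝ] ℝ) (X : V) : V →L[ℝ] V :=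
  a X • 1 + a.smulRight X - ∑ i, (a (J i X) • J i + (a ∘L J i).smulRight (J i X))

/-- Evaluation at `X`, as a linear map on a space of endomorphisms. -/
def evalAt (Q : Submodule ℝ (V →L[ℝ] V)) (X : V) : Q →ₗ[ℝ] V where
  toFun A := A.1 X
  map_add' _ _ := rfl
  map_smul' _ _ := rfl

/-- The contraction `V* ⊗ Q → V*`, `α ⊗ A ↦ α ∘ A`; in terms of `γ : V → Q` it is
`X ↦ tr (Z ↦ γ(Z) X)`. Writing `V = E ⊗ H`, `Q = S²H`, it is the identity of `E*` tensored with the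
natural map `H ⊗ S²H → H`. -/
def contraction (Q : Submodule ℝ (V →L[ℝ] V)) : (V →ₗ[ℝ] Q) →ₗ[ℝ] Module.Dual ℝ V where
  toFun γ :=
    { toFun := fun X => LinearMap.trace ℝ V (evalAt Q X ∘ₗ γ)
      map_add' := fun X Y => by
        rw [← map_add]; congr 1; ext Z; simp [evalAt]
      map_smul' := fun c X => by
        rw [RingHom.id_apply, ← map_smul]; congr 1; ext Z; simp [evalAt] }
  map_add' γ γ' := by
    ext X
    simp only [LinearMap.coe_mk, AddHom.coe_mk, LinearMap.add_apply]
    rw [← map_add]; congr 1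
  map_smul' c γ := by
    ext X
    simp only [LinearMap.coe_mk, AddHom.coe_mk, LinearMap.smul_apply, RingHom.id_apply]
    rw [← map_smul]; congr 1

/-- The summand `E* ⊗ S³H` of `V* ⊗ Q = Hom(V, Q)`: the kernel of the contraction. -/
def partES3 (Q : Submodule ℝ (V →L[ℝ] V)) : Submodule ℝ (V →ₗ[ℝ] Q) :=
  LinearMap.ker (contraction Q)

/-- The summand `E* ⊗ H` of `V* ⊗ Q = Hom(V, Q)`: the image of `V*` under the transpose of the
contraction, that is, all `γ` for which there is a `β ∈ V*` with `⟨γ(X), A⟩ = β(A X)`; in terms of an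
admissible basis, `γ(X) = ∑ᵢ β(Jᵢ X) Jᵢ`. -/
def partEH (Q : Submodule ℝ (V →L[ℝ] V)) : Submodule ℝ (V →ₗ[ℝ] Q) where
  carrier := {γ | ∃ β : Module.Dual ℝ V, ∀ X, ∀ A ∈ Q, qInner (γ X : V →L[ℝ] V) A = β (A X)}
  zero_mem' := ⟨0, fun X A _ => by simp [qInner]⟩
  add_mem' := by
    rintro γ γ' ⟨β, h⟩ ⟨β', h'⟩
    refine ⟨β + β', fun X A hA => ?_⟩
    rw [LinearMap.add_apply, LinearMap.add_apply, ← h X A hA, ← h' X A hA]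
    simp only [qInner, Submodule.coe_add, add_mul, ContinuousLinearMap.toLinearMap_add, map_add]
    ring
  smul_mem' := by
    rintro c γ ⟨β, h⟩
    refine ⟨c • β, fun X A hA => ?_⟩
    rw [LinearMap.smul_apply, LinearMap.smul_apply, ← h X A hA]
    simp only [qInner, Submodule.coe_smul, smul_mul_assoc, ContinuousLinearMap.toLinearMap_smul,
      map_smul, smul_eq_mul]
    ring

variable {Q : Submodule ℝ (V →L[ℝ] V)} {J J' : Fin 3 → V →L[ℝ] V}

namespace IsAdmissibleBasis

lemma mem (h : IsAdmissibleBasis Q J) (i : Fin 3) : J i ∈ Q := by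
  rw [h.span]; exact Submodule.subset_span ⟨i, rfl⟩

lemma anticomm (h : IsAdmissibleBasis Q J) {i j : Fin 3} (hij : i ≠ j) :
    J i * J j = -(J j * J i) := by
  have h0 := h.sq 0
  have h1 := h.sq 1
  have h2 := h.sq 2
  have h01 := h.mul
  have h10 : J 1 * J 0 = -J 2 := by
    have e : J 0 * (J 2 * J 2) * J 1 = J 0 * J 0 * J 1 * J 0 * (J 1 * J 1) := by
      rw [← h01]; noncomm_ring
    rw [h2, h0, h1] at e
    have e' : -(J 0 * J 1) = J 1 * J 0 := by
      calc -(J 0 * J 1) = J 0 * -1 * J 1 := by noncomm_ring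
        _ = -1 * J 1 * J 0 * -1 := e
        _ = _ := by noncomm_ring
    rw [← e', h01]
  have h02 : J 0 * J 2 = -J 1 := by
    rw [← h01, ← mul_assoc, h0]; noncomm_ring
  have h20 : J 2 * J 0 = J 1 := by
    rw [← h01, mul_assoc, h10, mul_neg, h02, neg_neg]
  have h21 : J 2 * J 1 = -J 0 := by
    rw [← h01, mul_assoc, h1]; noncomm_ring
  have h12 : J 1 * J 2 = J 0 := by
    have : J 1 * J 2 = - (J 1 * (J 1 * J 0)) := by rw [h10]; noncomm_ring
    rw [this, ← mul_assoc, h1]; noncomm_ring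
  fin_cases i <;> fin_cases j <;> simp_all

lemma qInner_self [Nontrivial V] [FiniteDimensional ℝ V] (h : IsAdmissibleBasis Q J) (i : Fin 3) :
    qInner (J i) (J i) = 1 := by
  have : ((-1 : V →L[ℝ] V) : V →ₗ[ℝ] V) = -1 := rfl
  have hne : (Module.finrank ℝ V : ℝ) ≠ 0 := by
    exact_mod_cast (Module.finrank_pos (R := ℝ) (M := V)).ne'
  rw [qInner, h.sq, this, map_neg, LinearMap.trace_one, neg_neg, div_self hne]

lemma _root_.QuatGeom.qInner_comm [FiniteDimensional ℝ V] (A B : V →L[ℝ] V) :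
    qInner A B = qInner B A := by
  unfold qInner
  rw [show ((A * B : V →L[ℝ] V) : V →ₗ[ℝ] V) = (A : V →ₗ[ℝ] V) * (B : V →ₗ[ℝ] V) from rfl,
    LinearMap.trace_mul_comm]; rfl

lemma qInner_ne [FiniteDimensional ℝ V] (h : IsAdmissibleBasis Q J) {i j : Fin 3}
    (hij : i ≠ j) : qInner (J i) (J j) = 0 := by
  have h1 := qInner_comm (J i) (J j)
  have h2 : qInner (J i) (J j) = - qInner (J j) (J i) := by
    unfold qInner
    rw [h.anticomm hij]
    have : ((-(J j * J i) : V →L[ℝ] V) : V →ₗ[ℝ] V) = -((J j * J i : V →L[ℝ] V) : V →ₗ[ℝ] V) := rfl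
    rw [this, map_neg]; ring
  linarith

lemma qInner_eq [Nontrivial V] [FiniteDimensional ℝ V] (h : IsAdmissibleBasis Q J) (i j : Fin 3) :
    qInner (J i) (J j) = if i = j then 1 else 0 := by
  split_ifs with hij
  · subst hij; exact h.qInner_self i
  · exact h.qInner_ne hij

lemma _root_.QuatGeom.qInner_sum_left (c : Fin 3 → ℝ) (J : Fin 3 → V →L[ℝ] V) (B : V →L[ℝ] V) :
    qInner (∑ i, c i • J i) B = ∑ i, c i * qInner (J i) B := by
  simp only [qInner, Fin.sum_univ_three, add_mul, smul_mul_assoc,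
    ContinuousLinearMap.toLinearMap_add, ContinuousLinearMap.toLinearMap_smul, map_add, map_smul,
    smul_eq_mul]
  ring

lemma eq_sum [Nontrivial V] [FiniteDimensional ℝ V] (h : IsAdmissibleBasis Q J)
    {A : V →L[ℝ] V} (hA : A ∈ Q) : A = ∑ i, qInner A (J i) • J i := by
  rw [h.span, Submodule.mem_span_range_iff_exists_fun] at hA
  obtain ⟨c, rfl⟩ := hA
  refine Finset.sum_congr rfl fun i _ => ?_
  rw [qInner_sum_left]
  simp [h.qInner_eq]

/-- The canonical element `∑ᵢ Jᵢ ⊗ Jᵢ` does not depend on the admissible basis. -/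
lemma sum_eq [Nontrivial V] [FiniteDimensional ℝ V] {W : Type*} [AddCommGroup W] [Module ℝ W]
    (h : IsAdmissibleBasis Q J) (h' : IsAdmissibleBasis Q J')
    (b : (V →L[ℝ] V) →ₗ[ℝ] (V →L[ℝ] V) →ₗ[ℝ] W) : ∑ i, b (J i) (J i) = ∑ i, b (J' i) (J' i) := by
  calc ∑ i, b (J i) (J i) = ∑ i, ∑ j, b (J i) (qInner (J i) (J' j) • J' j) := by
        refine Finset.sum_congr rfl fun i _ => ?_
        rw [← map_sum, ← h'.eq_sum (h.mem i)]
    _ = ∑ j, ∑ i, b (qInner (J' j) (J i) • J i) (J' j) := by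
        rw [Finset.sum_comm]
        simp only [map_smul, LinearMap.smul_apply, qInner_comm]
    _ = _ := by
        refine Finset.sum_congr rfl fun j _ => ?_
        rw [← LinearMap.sum_apply, ← map_sum, ← h.eq_sum (h'.mem j)]

/-- `S^a_X` does not depend on the admissible basis. -/
lemma sTensor_eq [FiniteDimensional ℝ V] (h : IsAdmissibleBasis Q J) (h' : IsAdmissibleBasis Q J')
    (a : V →L[ℝ] ℝ) (X : V) : sTensor J a X = sTensor J' a X := by
  cases subsingleton_or_nontrivial V with
  | inl _ => ext Z; exact Subsingleton.elim _ _
  | inr _ =>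
    ext Z
    have key := h.sum_eq h' (LinearMap.mk₂ ℝ
      (fun A B : V →L[ℝ] V => a (A X) • B Z + a (A Z) • B X)
      (fun A A' B => by simp only [add_apply, map_add]; module)
      (fun c A B => by
        simp only [smul_apply, map_smul, smul_eq_mul]; module)
      (fun A B B' => by simp only [add_apply]; module)
      (fun c A B => by simp only [smul_apply]; module))
    simp only [LinearMap.mk₂_apply] at key
    simpa [sTensor] using key

/-- The element `X ↦ ∑ᵢ β(Jᵢ X) Jᵢ` of `V* ⊗ Q`. -/
def embed (h : IsAdmissibleBasis Q J) (β : Module.Dual ℝ V) : V →ₗ[ℝ] Q where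
  toFun X := ∑ i, β (J i X) • ⟨J i, h.mem i⟩
  map_add' X Y := by simp only [map_add, add_smul, Finset.sum_add_distrib]
  map_smul' c X := by
    simp only [map_smul, smul_eq_mul, mul_smul, Finset.smul_sum, RingHom.id_apply]

lemma coe_embed (h : IsAdmissibleBasis Q J) (β : Module.Dual ℝ V) (X : V) :
    (h.embed β X : V →L[ℝ] V) = ∑ i, β (J i X) • J i := by
  simp [embed]

lemma contraction_embed [FiniteDimensional ℝ V] (h : IsAdmissibleBasis Q J)
    (β : Module.Dual ℝ V) : contraction Q (h.embed β) = (-3 : ℝ) • β := by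
  ext X
  have e : evalAt Q X ∘ₗ h.embed β =
      ∑ i, (β ∘ₗ (J i : V →ₗ[ℝ] V)).smulRight (J i X) := by
    ext Z
    simp [evalAt, coe_embed]
  have hs : ∀ i, J i (J i X) = -X := fun i => by
    have := congrArg (fun T : V →L[ℝ] V => T X) (h.sq i)
    simpa using this
  change LinearMap.trace ℝ V (evalAt Q X ∘ₗ h.embed β) = _
  rw [e, map_sum]
  simp only [LinearMap.trace_smulRight, LinearMap.comp_apply, ContinuousLinearMap.coe_coe, hs,
    map_neg, Fin.sum_univ_three, LinearMap.smul_apply, smul_eq_mul]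
  ring

lemma mem_partEH_iff [Nontrivial V] [FiniteDimensional ℝ V] (h : IsAdmissibleBasis Q J)
    (γ : V →ₗ[ℝ] Q) : γ ∈ partEH Q ↔ ∃ β, γ = h.embed β := by
  constructor
  · rintro ⟨β, hβ⟩
    refine ⟨β, LinearMap.ext fun X => Subtype.ext ?_⟩
    rw [coe_embed, h.eq_sum (γ X).2]
    exact Finset.sum_congr rfl fun i _ => by rw [hβ X _ (h.mem i)]
  · rintro ⟨β, rfl⟩
    refine ⟨β, fun X A hA => ?_⟩
    rw [coe_embed, qInner_sum_left]
    conv_rhs => rw [h.eq_sum hA]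
    simp [qInner_comm A, mul_comm]

/-- The decomposition `V* ⊗ Q = (E* ⊗ S³H) ⊕ (E* ⊗ H)`. -/
lemma isCompl [FiniteDimensional ℝ V] (h : IsAdmissibleBasis Q J) :
    IsCompl (partES3 Q) (partEH Q) := by
  cases subsingleton_or_nontrivial V with
  | inl _ =>
    have : Subsingleton (V →ₗ[ℝ] Q) := ⟨fun a b => LinearMap.ext fun X => by
      rw [Subsingleton.elim X 0, map_zero, map_zero]⟩
    refine ⟨Submodule.disjoint_def.2 fun γ _ _ => Subsingleton.elim _ _,
      codisjoint_iff.2 (Subsingleton.elim _ _)⟩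
  | inr _ =>
    refine ⟨Submodule.disjoint_def.2 fun γ h1 h2 => ?_, codisjoint_iff.2 (eq_top_iff.2 ?_)⟩
    · obtain ⟨β, rfl⟩ := (h.mem_partEH_iff γ).1 h2
      have h3 : contraction Q (h.embed β) = 0 := h1
      rw [h.contraction_embed] at h3
      have hβ : β = 0 := by simpa using h3
      ext X : 1
      exact Subtype.ext (by rw [coe_embed]; simp [hβ])
    · intro γ _
      let β : Module.Dual ℝ V := (-(1 / 3) : ℝ) • contraction Q γ
      refine Submodule.mem_sup.2 ⟨γ + h.embed (-β), ?_, h.embed β,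
        (h.mem_partEH_iff _).2 ⟨β, rfl⟩, ?_⟩
      · change contraction Q (γ + h.embed (-β)) = 0
        rw [map_add, h.contraction_embed, smul_neg, smul_smul]
        norm_num
      · ext X : 1
        exact Subtype.ext (by simp [coe_embed])

end IsAdmissibleBasis

/-- The projection of `V* ⊗ Q` onto `E* ⊗ S³H` along `E* ⊗ H`. -/
def projES3 [FiniteDimensional ℝ V] (h : ∃ J, IsAdmissibleBasis Q J) :
    (V →ₗ[ℝ] Q) →ₗ[ℝ] partES3 Q :=
  Submodule.projectionOnto (E := V →ₗ[ℝ] Q) (partES3 Q) (partEH Q) h.choose_spec.isCompl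

end LinearAlgebra

section Manifold

variable {E : Type*} [NormedAddCommGroup E] [NormedSpace ℝ E] [FiniteDimensional ℝ E]
  {H : Type*} [TopologicalSpace H] {I : ModelWithCorners ℝ E H}
  {M : Type*} [TopologicalSpace M] [ChartedSpace H M]

instance (x : M) : FiniteDimensional ℝ (TangentSpace I x) :=
  inferInstanceAs (FiniteDimensional ℝ E)

variable [IsManifold I ∞ M]

variable (I M) in
/-- Smooth sections of `End(TM)`. -/
abbrev EndField : Type _ :=
  ContMDiffSection I (E →L[ℝ] E) ∞ (fun x : M => TangentSpace I x →L[ℝ] TangentSpace I x)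

variable (I M) in
/-- Smooth real-valued `1`-forms. -/
abbrev OneForm : Type _ :=
  ContMDiffSection I (E →L[ℝ] ℝ) ∞ (fun x : M => TangentSpace I x →L[ℝ] Bundle.Trivial M ℝ x)

variable (I M) in
/-- Linear connections on `M`; for a connection `D`, a vector field `Y` and `X ∈ T_x M`, the vector
`D_X Y` is `D Y x X`. -/
abbrev Connection : Type _ := CovariantDerivative I E (TangentSpace I : M → Type _)

variable (I M) in
/-- An almost quaternionic structure on `M`: a subbundle of `End(TM)` that is locally generated by
three smooth almost complex structures satisfying the quaternionic relations. -/
structure AlmostQuaternionicStructure where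
  fiber (x : M) : Submodule ℝ (TangentSpace I x →L[ℝ] TangentSpace I x)
  exists_frame (p : M) : ∃ U ∈ 𝓝 p,
    ∃ J : Fin 3 → (x : M) → (TangentSpace I x →L[ℝ] TangentSpace I x),
      (∀ i, ContMDiffOn I (I.prod 𝓘(ℝ, E →L[ℝ] E)) ∞
        (fun x => TotalSpace.mk' (E →L[ℝ] E)
          (E := fun x : M => TangentSpace I x →L[ℝ] TangentSpace I x) x (J i x)) U) ∧
      ∀ x ∈ U, IsAdmissibleBasis (fiber x) (fun i => J i x)

theorem EndField.mdifferentiableAt_apply (A : EndField I M) {x : M}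
    {σ : (x : M) → TangentSpace I x} (hσ : MDiffAt (T% σ) x) :
    MDiffAt (T% (fun y => A y (σ y))) x :=
  MDifferentiableAt.clm_bundle_apply (F₁ := E) (F₂ := E)
    (A.contMDiff.contMDiffAt.mdifferentiableAt (by simp)) hσ

theorem OneForm.mdifferentiableAt_apply (α : OneForm I M) {x : M}
    {σ : (x : M) → TangentSpace I x} (hσ : MDiffAt (T% σ) x) :
    MDifferentiableAt I 𝓘(ℝ, ℝ) (fun y => (α y (σ y) : ℝ)) x := by
  have h : MDifferentiableAt I (I.prod 𝓘(ℝ, ℝ))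
      (fun y => TotalSpace.mk' ℝ (E := Bundle.Trivial M ℝ) y (α y (σ y))) x :=
    MDifferentiableAt.clm_bundle_apply (F₁ := E) (F₂ := ℝ)
      (α.contMDiff.contMDiffAt.mdifferentiableAt (by simp)) hσ
  exact (mdifferentiableAt_totalSpace _ _).1 h |>.2

namespace Connection

variable (D : Connection I M)

theorem tensorial_end (A : EndField I M) (x : M) (X : TangentSpace I x) :
    TensorialAt I E (fun σ : (x : M) → TangentSpace I x =>
      D (fun y => A y (σ y)) x X - A x (D σ x X)) x where
  smul {f σ} hf hσ := by
    have e : (fun y => A y ((f • σ) y)) = f • fun y => A y (σ y) := by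
      funext y; simp
    rw [e, D.isCovariantDerivativeOn.leibniz (A.mdifferentiableAt_apply hσ) hf,
      D.isCovariantDerivativeOn.leibniz hσ hf]
    simp
    module
  add {σ σ'} hσ hσ' := by
    have e : (fun y => A y ((σ + σ') y)) = (fun y => A y (σ y)) + fun y => A y (σ' y) := by
      funext y; simp
    rw [e, D.isCovariantDerivativeOn.add (A.mdifferentiableAt_apply hσ)
      (A.mdifferentiableAt_apply hσ'), D.isCovariantDerivativeOn.add hσ hσ']
    simp
    module

/-- The induced connection on `End(TM)`: `(D_X A)(Y) = D_X (A Y) - A (D_X Y)`. -/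
def onEnd (A : EndField I M) (x : M) :
    TangentSpace I x →ₗ[ℝ] (TangentSpace I x →L[ℝ] TangentSpace I x) where
  toFun X := TensorialAt.mkHom _ x (D.tensorial_end A x X)
  map_add' X X' := by
    ext Y
    simp only [TensorialAt.mkHom_apply_eq_extend, map_add, add_apply]
    abel
  map_smul' c X := by
    ext Y
    simp only [TensorialAt.mkHom_apply_eq_extend, map_smul, smul_apply, RingHom.id_apply, smul_sub]

theorem tensorial_form (α : OneForm I M) (x : M) (X : TangentSpace I x) :
    TensorialAt I E (fun σ : (x : M) → TangentSpace I x =>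
      (mvfderiv I (fun y => (α y (σ y) : ℝ)) x X - α x (D σ x X) : ℝ)) x where
  smul {f σ} hf hσ := by
    have e : (fun y => (α y ((f • σ) y) : ℝ)) = fun y => f y * (α y (σ y) : ℝ) := by
      funext y; simp
    rw [e, D.isCovariantDerivativeOn.leibniz hσ hf,
      mvfderiv_fun_mul hf (α.mdifferentiableAt_apply hσ)]
    simp
    ring
  add {σ σ'} hσ hσ' := by
    have e : (fun y => (α y ((σ + σ') y) : ℝ)) = fun y => (α y (σ y) : ℝ) + (α y (σ' y) : ℝ) := by
      funext y; simp
    rw [e, D.isCovariantDerivativeOn.add hσ hσ', mvfderiv_fun_add (α.mdifferentiableAt_apply hσ)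
      (α.mdifferentiableAt_apply hσ')]
    simp
    ring

/-- The induced connection on `T*M`: `(D_X α)(Y) = X (α(Y)) - α (D_X Y)`. -/
def onForm (α : OneForm I M) (x : M) (X : TangentSpace I x) : TangentSpace I x →L[ℝ] ℝ :=
  TensorialAt.mkHom _ x (D.tensorial_form α x X)

/-- The curvature `R_{X,Y} Z = D_X D_Y Z - D_Y D_X Z - D_{[X,Y]} Z` on vector fields. -/
def curvatureField (X Y Z : (x : M) → TangentSpace I x) (x : M) : TangentSpace I x :=
  D (fun y => D Z y (Y y)) x (X x) - D (fun y => D Z y (X y)) x (Y x)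
    - D Z x (VectorField.mlieBracket I X Y x)

/-- The curvature tensor of a smooth connection at a point; it is evaluated on local smooth
extensions of the given tangent vectors, the choice of which is irrelevant by tensoriality. -/
def curvature (x : M) (X Y Z : TangentSpace I x) : TangentSpace I x :=
  D.curvatureField (FiberBundle.extend E X) (FiberBundle.extend E Y) (FiberBundle.extend E Z) x

end Connection

section Quaternionic

namespace AlmostQuaternionicStructure

variable (Q : AlmostQuaternionicStructure I M)

theorem exists_admissible (x : M) : ∃ J, IsAdmissibleBasis (Q.fiber x) J := by
  obtain ⟨U, hU, J, -, hJ⟩ := Q.exists_frame x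
  exact ⟨_, hJ x (mem_of_mem_nhds hU)⟩

/-- An admissible basis of `Q` at the point `x`. -/
def basisAt (x : M) : Fin 3 → TangentSpace I x →L[ℝ] TangentSpace I x :=
  (Q.exists_admissible x).choose

theorem basisAt_spec (x : M) : IsAdmissibleBasis (Q.fiber x) (Q.basisAt x) :=
  (Q.exists_admissible x).choose_spec

/-- The tensor `S^a_X` of the almost quaternionic structure at the point `x`. -/
def S (x : M) (a : TangentSpace I x →L[ℝ] ℝ) (X : TangentSpace I x) :
    TangentSpace I x →L[ℝ] TangentSpace I x :=
  sTensor (Q.basisAt x) a X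

theorem S_eq {x : M} {J : Fin 3 → TangentSpace I x →L[ℝ] TangentSpace I x}
    (hJ : IsAdmissibleBasis (Q.fiber x) J) (a : TangentSpace I x →L[ℝ] ℝ) (X : TangentSpace I x) :
    Q.S x a X = sTensor J a X :=
  (Q.basisAt_spec x).sTensor_eq hJ a X

/-- The space `Γ(Q)` of smooth sections of `Q`. -/
def Sections : Type _ := {A : EndField I M // ∀ x, A x ∈ Q.fiber x}

/-- `D` is a quaternionic connection: smooth, torsion-free and preserving `Q`. -/
structure IsQuaternionicConnection (D : Connection I M) : Prop where
  smooth : CovariantDerivative.ContMDiffCovariantDerivative D ∞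
  torsionFree : D.torsion = 0
  preserves : ∀ A : Q.Sections, ∀ x X, D.onEnd A.1 x X ∈ Q.fiber x

variable {Q} in
/-- The connection `D : Γ(Q) → Γ(T*M ⊗ Q)` induced by a quaternionic connection. -/
def IsQuaternionicConnection.onQ {D : Connection I M} (hD : Q.IsQuaternionicConnection D)
    (A : Q.Sections) (x : M) : TangentSpace I x →ₗ[ℝ] Q.fiber x :=
  (D.onEnd A.1 x).codRestrict (Q.fiber x) (hD.preserves A x)

variable {Q} in
/-- The Penrose operator `P^D : Γ(Q) → Γ(E* ⊗ S³H)`: the composition of `D : Γ(Q) → Γ(T*M ⊗ Q)` with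
the projection onto the first summand of `T*M ⊗ Q = (E* ⊗ S³H) ⊕ (E* ⊗ H)`. -/
def IsQuaternionicConnection.penrose {D : Connection I M} (hD : Q.IsQuaternionicConnection D)
    (A : Q.Sections) (x : M) : partES3 (Q.fiber x) :=
  projES3 (Q.exists_admissible x) (hD.onQ A x)

/-- The relation `D' = D + S^α`, that is `D'_X Y = D_X Y + S^α_X Y`. -/
def IsShift (D' D : Connection I M) (α : OneForm I M) : Prop :=
  ∀ (x : M) (Y : (x : M) → TangentSpace I x), MDiffAt (T% Y) x →
    ∀ X : TangentSpace I x, D' Y x X = D Y x X + Q.S x (α x) X (Y x)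

end AlmostQuaternionicStructure

end Quaternionic

section Riemannian

variable [RiemannianBundle (fun x : M => TangentSpace I x)]
  [IsContMDiffRiemannianBundle I ∞ E (fun x : M => TangentSpace I x)]

/-- `D` is the Levi-Civita connection of the Riemannian metric of `M`: it is torsion-free, and
`X ⟨Y, Z⟩ = ⟨D_X Y, Z⟩ + ⟨Y, D_X Z⟩` for all differentiable vector fields `Y`, `Z`. -/
structure Connection.IsLeviCivita (D : Connection I M) : Prop where
  torsionFree : D.torsion = 0
  metric : ∀ (x : M) (Y Z : (x : M) → TangentSpace I x), MDiffAt (T% Y) x → MDiffAt (T% Z) x →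
    ∀ X : TangentSpace I x, mvfderiv I (fun y => inner ℝ (Y y) (Z y)) x X =
      inner ℝ (D Y x X) (Z x) + inner ℝ (Y x) (D Z x X)

/-- The Ricci tensor `Ricci(X, Y) = tr (Z ↦ R_{Z,X} Y)` of a connection, the trace being computed in
an orthonormal basis. -/
def Connection.ricci (D : Connection I M) (x : M) (X Y : TangentSpace I x) : ℝ :=
  ∑ i, inner ℝ (D.curvature x (stdOrthonormalBasis ℝ (TangentSpace I x) i) X Y)
    (stdOrthonormalBasis ℝ (TangentSpace I x) i)

/-- The scalar curvature: the metric trace of the Ricci tensor. -/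
def Connection.scal (D : Connection I M) (x : M) : ℝ :=
  ∑ i, D.ricci x (stdOrthonormalBasis ℝ (TangentSpace I x) i)
    (stdOrthonormalBasis ℝ (TangentSpace I x) i)

/-- The codifferential `δα = - ∑ᵢ (D_{eᵢ} α)(eᵢ)` with respect to the Levi-Civita connection `D`. -/
def Connection.codifferential (D : Connection I M) (α : OneForm I M) (x : M) : ℝ :=
  -∑ i, D.onForm α x (stdOrthonormalBasis ℝ (TangentSpace I x) i)
    (stdOrthonormalBasis ℝ (TangentSpace I x) i)

/-- The Riemannian metric of `M`, with Levi-Civita connection `D`, is a quaternionic-Kähler metric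
compatible with `Q`: `D` is a quaternionic connection and the endomorphisms in `Q` are
skew-symmetric. -/
structure AlmostQuaternionicStructure.IsQuaternionicKahler (Q : AlmostQuaternionicStructure I M)
    (D : Connection I M) : Prop where
  leviCivita : D.IsLeviCivita
  quaternionic : Q.IsQuaternionicConnection D
  skew : ∀ x, ∀ A ∈ Q.fiber x, ∀ X Y : TangentSpace I x, inner ℝ (A X) Y = -inner ℝ X (A Y)

end Riemannian

end Manifold
end QuatGeom

end

open QuatGeom

/-!
Let `f = |A|²`. Writing `D = D^g + S^α`, the equation `P^D A = 0` becomes the twistor equation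
`∇^g A = 2 α ⊗ A + ∑ᵢ (β ∘ Jᵢ) ⊗ Jᵢ` for some `1`-form `β`. Differentiating it once more and
commuting derivatives gives a Bochner formula which expresses `Δf + 4⟨α, df⟩`, where `f > 0`, in
terms of `|α|² f`, `|df|² / f` and `-Scal f`; co-closedness of `α` removes the zeroth-order term
`δα`. If `Scal ≤ 0`, the right-hand side is nonnegative, so by the strong maximum principle the set
where `f` attains its maximum is open as well as closed, and `f` is constant. If the constant is not
zero, then the Bochner formula forces `Scal` to be a positive multiple of `|α|²`, whence both vanish
identically.
-/

noncomputable section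

namespace QuatGeom

section Chart

variable {E : Type*} [NormedAddCommGroup E] [NormedSpace ℝ E]
  {H : Type*} [TopologicalSpace H] {I : ModelWithCorners ℝ E H}
  {M : Type*} [TopologicalSpace M] [ChartedSpace H M] [IsManifold I ∞ M]

variable (I) in
/-- The coordinate expression `T_y M → E` of a tangent vector in the chart at `p`. -/
def toCoord (p y : M) : TangentSpace I y →L[ℝ] E :=
  (trivializationAt E (TangentSpace I) p).continuousLinearMapAt ℝ y

variable (I) in
/-- The tangent vector at `y` with given coordinates in the chart at `p`, the inverse of
`toCoord`. -/
def ofCoord (p y : M) : E →L[ℝ] TangentSpace I y :=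
  (trivializationAt E (TangentSpace I) p).symmL ℝ y

variable (I) in
/-- The vector field with constant coordinates `w` in the chart at `p`. -/
def coordField (p : M) (w : E) (y : M) : TangentSpace I y := ofCoord I p y w

variable (I) in
/-- The point with coordinates `x` in the chart at `p`. -/
def chartPt (p : M) (x : E) : M := (extChartAt I p).symm x

/-- The coordinate expression of a vector field in the chart at `p`. -/
def coordRep (p : M) (Y : (y : M) → TangentSpace I y) (x : E) : E :=
  toCoord I p (chartPt I p x) (Y (chartPt I p x))

/-- The constant vector field on a normed space. -/
def constField (w : E) (x : E) : TangentSpace 𝓘(ℝ, E) x := w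

variable {p y : M} {x : E}

lemma mem_baseSet_of_mem_source (hy : y ∈ (extChartAt I p).source) :
    y ∈ (trivializationAt E (TangentSpace I) p).baseSet := by
  simpa using hy

lemma toCoord_ofCoord (hy : y ∈ (extChartAt I p).source) (w : E) :
    toCoord I p y (ofCoord I p y w) = w :=
  (trivializationAt E (TangentSpace I) p).continuousLinearMapAt_symmL
    (mem_baseSet_of_mem_source hy) w

lemma ofCoord_toCoord (hy : y ∈ (extChartAt I p).source) (X : TangentSpace I y) :
    ofCoord I p y (toCoord I p y X) = X :=
  (trivializationAt E (TangentSpace I) p).symmL_continuousLinearMapAt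
    (mem_baseSet_of_mem_source hy) X

lemma toCoord_eq_snd_trivializationAt (hy : y ∈ (extChartAt I p).source)
    (Y : (y : M) → TangentSpace I y) :
    toCoord I p y (Y y) = (trivializationAt E (TangentSpace I) p ⟨y, Y y⟩).2 := by
  rw [toCoord, Trivialization.continuousLinearMapAt_apply, Trivialization.linearMapAt_apply,
    if_pos (mem_baseSet_of_mem_source hy)]

omit [IsManifold I ∞ M] in
lemma chartPt_mem_source (hx : x ∈ (extChartAt I p).target) :
    chartPt I p x ∈ (extChartAt I p).source :=
  (extChartAt I p).map_target hx

omit [IsManifold I ∞ M] in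
lemma eventually_chartPt (hx : x ∈ (extChartAt I p).target) {P : M → Prop}
    (h : ∀ᶠ y in 𝓝 (chartPt I p x), P y) : ∀ᶠ z in 𝓝 x, P (chartPt I p z) :=
  (continuousAt_extChartAt_symm'' hx).eventually h

lemma contMDiffAt_toCoord {Y : (y : M) → TangentSpace I y} {k : ℕ∞ω} (hk : k ≤ ∞)
    (hy : y ∈ (extChartAt I p).source) (hY : CMDiffAt k (T% Y) y) :
    ContMDiffAt I 𝓘(ℝ, E) k (fun y => toCoord I p y (Y y)) y := by
  have : ContMDiffVectorBundle k E (TangentSpace I : M → Type _) I := .of_le hk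
  rw [(trivializationAt E (TangentSpace I) p).contMDiffAt_section_iff
    (mem_baseSet_of_mem_source hy)] at hY
  refine hY.congr_of_eventuallyEq ?_
  filter_upwards [extChartAt_source_mem_nhds' hy] with z hz
  exact toCoord_eq_snd_trivializationAt hz Y

lemma mdifferentiableAt_toCoord {Y : (y : M) → TangentSpace I y}
    (hy : y ∈ (extChartAt I p).source) (hY : MDiffAt (T% Y) y) :
    MDifferentiableAt I 𝓘(ℝ, E) (fun y => toCoord I p y (Y y)) y := by
  have : ContMDiffVectorBundle 1 E (TangentSpace I : M → Type _) I := .of_le (n := ∞) (by simp)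
  rw [(trivializationAt E (TangentSpace I) p).mdifferentiableAt_section_iff I Y
    (mem_baseSet_of_mem_source hy)] at hY
  refine hY.congr_of_eventuallyEq ?_
  filter_upwards [extChartAt_source_mem_nhds' hy] with z hz
  exact toCoord_eq_snd_trivializationAt hz Y

lemma contMDiffAt_coordField (hy : y ∈ (extChartAt I p).source) (w : E) :
    CMDiffAt ∞ (T% (coordField I p w)) y := by
  rw [(trivializationAt E (TangentSpace I) p).contMDiffAt_section_iff
    (mem_baseSet_of_mem_source hy)]
  refine (contMDiffAt_const (c := w)).congr_of_eventuallyEq ?_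
  filter_upwards [extChartAt_source_mem_nhds' hy] with z hz
  rw [← toCoord_eq_snd_trivializationAt hz (coordField I p w)]
  exact toCoord_ofCoord hz w

lemma mdifferentiableAt_coordField (hy : y ∈ (extChartAt I p).source) (w : E) :
    MDiffAt (T% (coordField I p w)) y :=
  (contMDiffAt_coordField hy w).mdifferentiableAt (by simp)

lemma contMDiffOn_coordField (w : E) :
    CMDiff[(extChartAt I p).source] ∞ (T% (coordField I p w)) :=
  fun _ hy => (contMDiffAt_coordField hy w).contMDiffWithinAt

lemma eventuallyEq_sum_coordField {ι : Type*} [Fintype ι] (b : Module.Basis ι ℝ E)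
    (hy : y ∈ (extChartAt I p).source) (Y : (y : M) → TangentSpace I y) :
    Y =ᶠ[𝓝 y] fun z => ∑ j, b.coord j (toCoord I p z (Y z)) • coordField I p (b j) z := by
  filter_upwards [extChartAt_source_mem_nhds' hy] with z hz
  calc Y z = ofCoord I p z (∑ j, b.coord j (toCoord I p z (Y z)) • b j) := by
        simp only [Module.Basis.coord_apply, b.sum_repr, ofCoord_toCoord hz]
    _ = ∑ j, b.coord j (toCoord I p z (Y z)) • coordField I p (b j) z := by
        simp only [map_sum, map_smul, coordField]

lemma toCoord_eq_mfderiv (hy : y ∈ (extChartAt I p).source) :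
    toCoord I p y = mfderiv I 𝓘(ℝ, E) (extChartAt I p) y := by
  have : IsManifold I 1 M := .of_le (n := ∞) (by simp)
  exact TangentBundle.continuousLinearMapAt_trivializationAt (by simpa using hy)

lemma mdifferentiableAt_constField (w x : E) : MDiffAt (T% (constField w)) x :=
  ((contMDiffAt_vectorSpace_iff_contDiffAt (n := 1)).2
    (contDiffAt_const (c := w))).mdifferentiableAt (by simp)

lemma mlieBracket_constField (u v x : E) :
    VectorField.mlieBracket 𝓘(ℝ, E) (constField u) (constField v) x = 0 := by
  rw [← VectorField.mlieBracketWithin_univ, VectorField.mlieBracketWithin_eq_lieBracketWithin]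
  change VectorField.lieBracketWithin ℝ (fun _ : E => u) (fun _ => v) Set.univ x = 0
  simp [VectorField.lieBracketWithin]

lemma coordField_eventuallyEq_mpullback (hy : y ∈ (extChartAt I p).source) (w : E) :
    coordField I p w =ᶠ[𝓝 y]
      VectorField.mpullback I 𝓘(ℝ, E) (extChartAt I p) (constField w) := by
  filter_upwards [extChartAt_source_mem_nhds' hy] with z hz
  have h : (mfderiv I 𝓘(ℝ, E) (extChartAt I p) z).inverse = ofCoord I p z := by
    rw [← toCoord_eq_mfderiv hz]
    exact ContinuousLinearMap.inverse_eq
      (ContinuousLinearMap.ext (toCoord_ofCoord hz) :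
        toCoord I p z ∘L ofCoord I p z = ContinuousLinearMap.id ℝ E)
      (ContinuousLinearMap.ext (ofCoord_toCoord hz))
  rw [VectorField.mpullback_apply, h]
  rfl

lemma mlieBracket_coordField [CompleteSpace E] (hy : y ∈ (extChartAt I p).source) (u v : E) :
    VectorField.mlieBracket I (coordField I p u) (coordField I p v) y = 0 := by
  have : IsManifold I (minSmoothness ℝ 2) M := .of_le (n := ∞) (by simpa using ENat.LEInfty.out)
  have : IsManifold I (minSmoothness ℝ 3) M := .of_le (n := ∞) (by simpa using ENat.LEInfty.out)
  rw [(coordField_eventuallyEq_mpullback hy u).mlieBracket_vectorField_eq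
      (coordField_eventuallyEq_mpullback hy v),
    ← VectorField.mpullback_mlieBracket (n := ∞) (mdifferentiableAt_constField _ _)
      (mdifferentiableAt_constField _ _) (contMDiffAt_extChartAt' (by simpa using hy))
      (by simpa using ENat.LEInfty.out),
    VectorField.mpullback_apply, mlieBracket_constField, map_zero]

section Boundaryless

variable [I.Boundaryless] {F : Type*} [NormedAddCommGroup F] [NormedSpace ℝ F]

omit [IsManifold I ∞ M] in
lemma extChartAt_target_mem_nhds_of_mem (hx : x ∈ (extChartAt I p).target) :
    (extChartAt I p).target ∈ 𝓝 x :=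
  (isOpen_extChartAt_target p).mem_nhds hx

lemma contMDiffAt_chartPt (hx : x ∈ (extChartAt I p).target) :
    ContMDiffAt 𝓘(ℝ, E) I ∞ (chartPt I p) x :=
  (contMDiffOn_extChartAt_symm p).contMDiffAt (extChartAt_target_mem_nhds_of_mem hx)

lemma contDiffAt_comp_chartPt {f : M → F} {k : ℕ∞ω} (hk : k ≤ ∞)
    (hx : x ∈ (extChartAt I p).target) (hf : ContMDiffAt I 𝓘(ℝ, F) k f (chartPt I p x)) :
    ContDiffAt ℝ k (fun x => f (chartPt I p x)) x := by
  rw [← contMDiffAt_iff_contDiffAt]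
  exact ContMDiffAt.comp x (I' := I) hf ((contMDiffAt_chartPt hx).of_le hk)

lemma ofCoord_eq_mfderiv (hx : x ∈ (extChartAt I p).target) :
    ofCoord I p (chartPt I p x) = mfderiv 𝓘(ℝ, E) I (chartPt I p) x := by
  have : IsManifold I 1 M := .of_le (n := ∞) (by simp)
  have hright : (extChartAt I p) (chartPt I p x) = x := (extChartAt I p).right_inv hx
  have hsymmL := TangentBundle.symmL_trivializationAt (I := I) (x₀ := p) (x := chartPt I p x)
    (by simpa using chartPt_mem_source hx)
  rw [hright, I.range_eq_univ, mfderivWithin_univ] at hsymmL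
  exact hsymmL

lemma hasFDerivAt_comp_chartPt {f : M → F} (hx : x ∈ (extChartAt I p).target)
    (hf : MDifferentiableAt I 𝓘(ℝ, F) f (chartPt I p x)) :
    HasFDerivAt (fun x => f (chartPt I p x))
      (mvfderiv I f (chartPt I p x) ∘L ofCoord I p (chartPt I p x)) x := by
  rw [ofCoord_eq_mfderiv hx]
  exact (hf.hasMFDerivAt.comp _
    ((contMDiffAt_chartPt hx).mdifferentiableAt (by simp)).hasMFDerivAt).hasFDerivAt

lemma mvfderiv_eq_fderiv {f : M → F} (hx : x ∈ (extChartAt I p).target)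
    (hf : MDifferentiableAt I 𝓘(ℝ, F) f (chartPt I p x)) (X : TangentSpace I (chartPt I p x)) :
    mvfderiv I f (chartPt I p x) X =
      fderiv ℝ (fun x => f (chartPt I p x)) x (toCoord I p _ X) := by
  rw [(hasFDerivAt_comp_chartPt hx hf).fderiv, ContinuousLinearMap.comp_apply,
    ofCoord_toCoord (chartPt_mem_source hx)]

lemma mvfderiv_clm_toCoord (φ : E →L[ℝ] F) (hx : x ∈ (extChartAt I p).target)
    {Y : (y : M) → TangentSpace I y} (hY : MDiffAt (T% Y) (chartPt I p x))
    (X : TangentSpace I (chartPt I p x)) :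
    mvfderiv I (fun y => φ (toCoord I p y (Y y))) (chartPt I p x) X =
      φ (fderiv ℝ (coordRep p Y) x (toCoord I p _ X)) := by
  have hY' := mdifferentiableAt_toCoord (chartPt_mem_source hx) hY
  have hrep : DifferentiableAt ℝ (coordRep p Y) x :=
    (hasFDerivAt_comp_chartPt hx hY').differentiableAt
  rw [mvfderiv_eq_fderiv (f := fun y => φ (toCoord I p y (Y y))) hx
    (φ.mdifferentiableAt.comp _ hY')]
  exact DFunLike.congr_fun (φ.hasFDerivAt.comp x hrep.hasFDerivAt).fderiv _

lemma contDiffAt_coordRep {Y : (y : M) → TangentSpace I y} {k : ℕ∞ω} (hk : k ≤ ∞)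
    (hx : x ∈ (extChartAt I p).target) (hY : CMDiffAt k (T% Y) (chartPt I p x)) :
    ContDiffAt ℝ k (coordRep p Y) x :=
  contDiffAt_comp_chartPt hk hx (contMDiffAt_toCoord hk (chartPt_mem_source hx) hY)

lemma coordRep_coordField_eventuallyEq (hx : x ∈ (extChartAt I p).target) (w : E) :
    coordRep p (coordField I p w) =ᶠ[𝓝 x] fun _ => w := by
  filter_upwards [extChartAt_target_mem_nhds_of_mem hx] with z hz
  exact toCoord_ofCoord (chartPt_mem_source hz) w

end Boundaryless

end Chart

section Connection

variable {E : Type*} [NormedAddCommGroup E] [NormedSpace ℝ E]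
  {H : Type*} [TopologicalSpace H] {I : ModelWithCorners ℝ E H}
  {M : Type*} [TopologicalSpace M] [ChartedSpace H M] [IsManifold I ∞ M] {y : M}

lemma Connection.map_sum (D : Connection I M) {ι : Type*} {s : Finset ι}
    {Y : ι → (y : M) → TangentSpace I y} (hY : ∀ i ∈ s, MDiffAt (T% (Y i)) y) :
    D (fun z => ∑ i ∈ s, Y i z) y = ∑ i ∈ s, D (Y i) y := by
  classical
  induction s using Finset.induction_on with
  | empty => exact D.isCovariantDerivativeOn.zero (s := Set.univ) (x := y)
  | insert a s ha ih =>
    simp only [Finset.mem_insert, forall_eq_or_imp] at hY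
    simp only [Finset.sum_insert ha, ← ih hY.2]
    exact D.isCovariantDerivativeOn.add hY.1 (.sum_section hY.2)

lemma eventually_contMDiffOn_extend (X : TangentSpace I y) :
    ∀ᶠ s in (𝓝 y).smallSets, CMDiff[s] ∞ (T% (FiberBundle.extend E X)) := by
  obtain ⟨s, hs, h⟩ := FiberBundle.exists_contMDiffOn_extend (k := ∞) I E X
  exact Filter.eventually_smallSets.2 ⟨s, hs, fun t ht => h.mono ht⟩

lemma OneForm.contMDiffAt_apply (α : OneForm I M) {σ : (x : M) → TangentSpace I x}
    (hσ : CMDiffAt ∞ (T% σ) y) :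
    ContMDiffAt I 𝓘(ℝ, ℝ) ∞ (fun y => (α y (σ y) : ℝ)) y := by
  have h : ContMDiffAt I (I.prod 𝓘(ℝ, ℝ)) ∞
      (fun y => TotalSpace.mk' ℝ (E := Bundle.Trivial M ℝ) y (α y (σ y))) y :=
    α.contMDiff.contMDiffAt.clm_bundle_apply hσ
  exact (contMDiffAt_totalSpace.1 h).2

variable [FiniteDimensional ℝ E]

lemma Connection.onEnd_apply (D : Connection I M) (A : EndField I M) (X : TangentSpace I y)
    {σ : (x : M) → TangentSpace I x} (hσ : MDiffAt (T% σ) y) :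
    D.onEnd A y X (σ y) = D (fun z => A z (σ z)) y X - A y (D σ y X) :=
  TensorialAt.mkHom_apply (D.tensorial_end A y X) hσ

lemma Connection.onForm_apply (D : Connection I M) (α : OneForm I M) (X : TangentSpace I y)
    {σ : (x : M) → TangentSpace I x} (hσ : MDiffAt (T% σ) y) :
    D.onForm α y X (σ y) = mvfderiv I (fun z => (α z (σ z) : ℝ)) y X - α y (D σ y X) :=
  TensorialAt.mkHom_apply (D.tensorial_form α y X) hσ

section T2

variable [T2Space M]

lemma exists_contMDiff_smul {F : Type*} [NormedAddCommGroup F] [NormedSpace ℝ F]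
    {V : M → Type*} [TopologicalSpace (TotalSpace F V)]
    [∀ x, AddCommGroup (V x)] [∀ x, Module ℝ (V x)] [∀ x, TopologicalSpace (V x)]
    [FiberBundle F V] [VectorBundle ℝ F V]
    {u : Set M} (hu : u ∈ 𝓝 y) {s : (z : M) → V z} (hs : CMDiff[u] ∞ (T% s)) :
    ∃ ψ : M → ℝ, CMDiff ∞ (T% (ψ • s)) ∧ (∀ᶠ z in 𝓝 y, ψ z = 1) ∧ ∀ z ∉ u, ψ z = 0 := by
  obtain ⟨ψ, -, hψ⟩ := (SmoothBumpFunction.nhds_basis_tsupport (I := I) y).mem_iff.1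
    (interior_mem_nhds.2 hu)
  refine ⟨ψ, ContMDiffOn.smul_section_of_tsupport ψ.contMDiff.contMDiffOn isOpen_interior hψ
    (hs.mono interior_subset), ψ.eventuallyEq_one, fun z hz => ?_⟩
  by_contra h
  exact hz (interior_subset (hψ (subset_tsupport _ h)))

lemma Connection.contMDiffAt {D : Connection I M}
    (hD : CovariantDerivative.ContMDiffCovariantDerivative D ∞)
    {u : Set M} (hu : u ∈ 𝓝 y) {Y : (z : M) → TangentSpace I z} (hY : CMDiff[u] ∞ (T% Y)) :
    ContMDiffAt I (I.prod 𝓘(ℝ, E →L[ℝ] E)) ∞ (fun z => TotalSpace.mk' (E →L[ℝ] E)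
      (E := fun z : M => TangentSpace I z →L[ℝ] TangentSpace I z) z (D Y z)) y := by
  obtain ⟨ψ, hψY, hψ, -⟩ := exists_contMDiff_smul hu hY
  refine ((hD.contMDiff.contMDiff (σ := ψ • Y) (by simpa using hψY.contMDiffOn)).contMDiffAt
    (x := y) Filter.univ_mem).congr_of_eventuallyEq ?_
  filter_upwards [hψ.eventually_nhds, eventually_mem_nhds_iff.2 hu] with z hz hzu
  congr 1
  refine D.isCovariantDerivativeOn.congr_of_eventuallyEq (s := Set.univ)
    ((hY.contMDiffAt hzu).mdifferentiableAt (by simp))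
    (hψY.contMDiffAt.mdifferentiableAt (by simp)) Filter.univ_mem ?_
  filter_upwards [hz] with w hw
  simp [hw]

end T2

section Coordinates

variable [I.Boundaryless] {p : M} {x : E}

/-- The Christoffel symbols of a connection in the chart at `p`. -/
def christoffel (D : Connection I M) (p : M) (x : E) : E →L[ℝ] E →L[ℝ] E :=
  ∑ j, (ContinuousLinearMap.smulRightL ℝ E E
      ((Module.finBasis ℝ E).coord j).toContinuousLinearMap).comp
    (toCoord I p (chartPt I p x) ∘L
      D (coordField I p (Module.finBasis ℝ E j)) (chartPt I p x) ∘L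
      ofCoord I p (chartPt I p x))

/-- The curvature endomorphism of the connection on `E` with Christoffel symbols `Γ`. -/
def coordCurvature (Γ : E → E →L[ℝ] E →L[ℝ] E) (x u v : E) : E →L[ℝ] E :=
  fderiv ℝ Γ x u v - fderiv ℝ Γ x v u + (Γ x u * Γ x v - Γ x v * Γ x u)

lemma toCoord_connection (D : Connection I M) (hx : x ∈ (extChartAt I p).target)
    {Y : (y : M) → TangentSpace I y} (hY : MDiffAt (T% Y) (chartPt I p x))
    (X : TangentSpace I (chartPt I p x)) :
    toCoord I p _ (D Y _ X) =
      fderiv ℝ (coordRep p Y) x (toCoord I p _ X)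
        + christoffel D p x (toCoord I p _ X) (coordRep p Y x) := by
  have hy := chartPt_mem_source hx
  let b := Module.finBasis ℝ E
  let φ (j) : E →L[ℝ] ℝ := (b.coord j).toContinuousLinearMap
  let c (j : Fin (Module.finrank ℝ E)) (z : M) : ℝ := φ j (toCoord I p z (Y z))
  have hc (j) : MDifferentiableAt I 𝓘(ℝ, ℝ) (c j) (chartPt I p x) :=
    (φ j).mdifferentiableAt.comp _ (mdifferentiableAt_toCoord hy hY)
  have hcb (j) : MDiffAt (T% (c j • coordField I p (b j))) (chartPt I p x) :=
    (hc j).smul_section (mdifferentiableAt_coordField hy _)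
  have expand : D Y (chartPt I p x) = ∑ j, D (c j • coordField I p (b j)) (chartPt I p x) :=
    (D.isCovariantDerivativeOn.congr_of_eventuallyEq (s := Set.univ) hY
      (.sum_section fun j _ => hcb j) Filter.univ_mem (eventuallyEq_sum_coordField b hy Y)).trans
      (D.map_sum fun j _ => hcb j)
  have leibniz (j) : D (c j • coordField I p (b j)) (chartPt I p x) X =
      b.coord j (fderiv ℝ (coordRep p Y) x (toCoord I p _ X)) • coordField I p (b j) _ +
        c j (chartPt I p x) • D (coordField I p (b j)) (chartPt I p x) X := by
    have hdc : mvfderiv I (c j) (chartPt I p x) X = _ := mvfderiv_clm_toCoord (φ j) hx hY X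
    rw [D.isCovariantDerivativeOn.leibniz (mdifferentiableAt_coordField hy _) (hc j), add_comm]
    simp [hdc, φ]
  have happly : (∑ j, D (c j • coordField I p (b j)) (chartPt I p x)) X =
      ∑ j, D (c j • coordField I p (b j)) (chartPt I p x) X := sum_apply _ _ _
  rw [expand, happly, _root_.map_sum]
  simp only [leibniz, map_add, map_smul, Finset.sum_add_distrib]
  congr 1
  · simp only [coordField, toCoord_ofCoord hy, Module.Basis.coord_apply, b.sum_repr]
  · simp [christoffel, c, φ, coordRep, ofCoord_toCoord hy, b]

lemma christoffel_apply (D : Connection I M) (hx : x ∈ (extChartAt I p).target) (u v : E) :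
    christoffel D p x u v =
      toCoord I p _ (D (coordField I p v) (chartPt I p x) (ofCoord I p _ u)) := by
  have hconst := coordRep_coordField_eventuallyEq (I := I) hx v
  rw [toCoord_connection D hx (mdifferentiableAt_coordField (chartPt_mem_source hx) v),
    hconst.fderiv_eq, hconst.eq_of_nhds, toCoord_ofCoord (chartPt_mem_source hx)]
  simp

lemma christoffel_symm {D : Connection I M} (hD : D.torsion = 0)
    (hx : x ∈ (extChartAt I p).target) (u v : E) :
    christoffel D p x u v = christoffel D p x v u := by
  have : CompleteSpace E := FiniteDimensional.complete ℝ E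
  have hy := chartPt_mem_source hx
  have h := (CovariantDerivative.torsion_eq_zero_iff D).1 hD
    (mdifferentiableAt_coordField hy u) (mdifferentiableAt_coordField hy v)
  rw [mlieBracket_coordField hy, sub_eq_zero] at h
  rw [christoffel_apply D hx, christoffel_apply D hx]
  exact congrArg _ h

lemma contDiffAt_clm_of_apply {E' F G : Type*} [NormedAddCommGroup E'] [NormedSpace ℝ E']
    [NormedAddCommGroup F] [NormedSpace ℝ F] [FiniteDimensional ℝ F] [NormedAddCommGroup G]
    [NormedSpace ℝ G] {k : ℕ∞ω} {f : E' → F →L[ℝ] G} {x : E'}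
    (h : ∀ v, ContDiffAt ℝ k (fun x => f x v) x) : ContDiffAt ℝ k f x := by
  let b := Module.finBasis ℝ F
  have expand : f = fun x => ∑ j, ContinuousLinearMap.smulRightL ℝ F G
      (b.coord j).toContinuousLinearMap (f x (b j)) := by
    ext x v
    conv_lhs => rw [← b.sum_repr v, map_sum]
    simp
  rw [expand]
  exact ContDiffAt.sum fun j _ => (ContinuousLinearMap.contDiff _).contDiffAt.comp x (h (b j))

lemma contDiffAt_christoffel [T2Space M] {D : Connection I M}
    (hD : CovariantDerivative.ContMDiffCovariantDerivative D ∞)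
    (hx : x ∈ (extChartAt I p).target) : ContDiffAt ℝ ∞ (christoffel D p) x := by
  refine contDiffAt_clm_of_apply fun u => contDiffAt_clm_of_apply fun v => ?_
  have hy := chartPt_mem_source hx
  have hDv := Connection.contMDiffAt hD (extChartAt_source_mem_nhds' hy)
    (contMDiffOn_coordField (I := I) (p := p) v)
  refine (contDiffAt_coordRep le_rfl hx
    (hDv.clm_bundle_apply (contMDiffAt_coordField hy u))).congr_of_eventuallyEq ?_
  filter_upwards [extChartAt_target_mem_nhds_of_mem hx] with z hz
  exact christoffel_apply D hz u v

lemma coordRep_connection_eventuallyEq (D : Connection I M) (hx : x ∈ (extChartAt I p).target)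
    {Y Z : (y : M) → TangentSpace I y} {s : Set M} (hs : s ∈ 𝓝 (chartPt I p x))
    (hZ : CMDiff[s] ∞ (T% Z)) :
    coordRep p (fun y => D Z y (Y y)) =ᶠ[𝓝 x] fun z =>
      fderiv ℝ (coordRep p Z) z (coordRep p Y z)
        + christoffel D p z (coordRep p Y z) (coordRep p Z z) := by
  filter_upwards [extChartAt_target_mem_nhds_of_mem hx,
    eventually_chartPt hx (eventually_mem_nhds_iff.2 hs)] with z hz hzs
  exact toCoord_connection D hz ((hZ.contMDiffAt hzs).mdifferentiableAt (by simp)) _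

lemma toCoord_connection_connection [T2Space M] {D : Connection I M}
    (hD : CovariantDerivative.ContMDiffCovariantDerivative D ∞)
    (hx : x ∈ (extChartAt I p).target) {X Y Z : (y : M) → TangentSpace I y} {s : Set M}
    (hs : s ∈ 𝓝 (chartPt I p x)) (hY : CMDiff[s] ∞ (T% Y)) (hZ : CMDiff[s] ∞ (T% Z)) :
    toCoord I p _ (D (fun y => D Z y (Y y)) (chartPt I p x) (X _)) =
      fderiv ℝ (fderiv ℝ (coordRep p Z)) x (coordRep p X x) (coordRep p Y x) +
      fderiv ℝ (coordRep p Z) x (fderiv ℝ (coordRep p Y) x (coordRep p X x)) +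
      fderiv ℝ (christoffel D p) x (coordRep p X x) (coordRep p Y x) (coordRep p Z x) +
      christoffel D p x (fderiv ℝ (coordRep p Y) x (coordRep p X x)) (coordRep p Z x) +
      christoffel D p x (coordRep p Y x) (fderiv ℝ (coordRep p Z) x (coordRep p X x)) +
      christoffel D p x (coordRep p X x) (fderiv ℝ (coordRep p Z) x (coordRep p Y x) +
        christoffel D p x (coordRep p Y x) (coordRep p Z x)) := by
  have hDZ : CMDiffAt ∞ (T% fun y => D Z y (Y y)) (chartPt I p x) :=
    (Connection.contMDiffAt hD hs hZ).clm_bundle_apply (hY.contMDiffAt hs)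
  have hrep := coordRep_connection_eventuallyEq D hx (Y := Y) hs hZ
  have hY' := contDiffAt_coordRep le_rfl hx (hY.contMDiffAt hs)
  have hZ' := contDiffAt_coordRep le_rfl hx (hZ.contMDiffAt hs)
  have dY := (hY'.differentiableAt (by simp)).hasFDerivAt
  have dZ := (hZ'.differentiableAt (by simp)).hasFDerivAt
  have ddZ := ((hZ'.fderiv_right (m := ∞) le_rfl).differentiableAt (by simp)).hasFDerivAt
  have dΓ := ((contDiffAt_christoffel hD hx).differentiableAt (by simp)).hasFDerivAt
  rw [toCoord_connection D hx (hDZ.mdifferentiableAt (by simp)), hrep.fderiv_eq, hrep.eq_of_nhds,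
    ((ddZ.clm_apply dY).fun_add ((dΓ.clm_apply dY).clm_apply dZ)).fderiv]
  simp only [add_apply, ContinuousLinearMap.comp_apply, ContinuousLinearMap.flip_apply]
  change _ + christoffel D p x (coordRep p X x) _ = _
  rw [show toCoord I p (chartPt I p x) (X (chartPt I p x)) = coordRep p X x from rfl]
  abel

lemma toCoord_curvatureField [T2Space M] {D : Connection I M}
    (hD : CovariantDerivative.ContMDiffCovariantDerivative D ∞) (hD' : D.torsion = 0)
    (hx : x ∈ (extChartAt I p).target) {X Y Z : (y : M) → TangentSpace I y} {s : Set M}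
    (hs : s ∈ 𝓝 (chartPt I p x)) (hX : CMDiff[s] ∞ (T% X)) (hY : CMDiff[s] ∞ (T% Y))
    (hZ : CMDiff[s] ∞ (T% Z)) :
    toCoord I p _ (D.curvatureField X Y Z (chartPt I p x)) =
      coordCurvature (christoffel D p) x (coordRep p X x) (coordRep p Y x) (coordRep p Z x) := by
  have dX := (hX.contMDiffAt hs).mdifferentiableAt (n := ∞) (by simp)
  have dY := (hY.contMDiffAt hs).mdifferentiableAt (n := ∞) (by simp)
  have dZ := (hZ.contMDiffAt hs).mdifferentiableAt (n := ∞) (by simp)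
  have hsymm : fderiv ℝ (fderiv ℝ (coordRep p Z)) x (coordRep p X x) (coordRep p Y x) =
      fderiv ℝ (fderiv ℝ (coordRep p Z)) x (coordRep p Y x) (coordRep p X x) :=
    (contDiffAt_coordRep le_rfl hx (hZ.contMDiffAt hs)).isSymmSndFDerivAt
      (by simpa using ENat.LEInfty.out) _ _
  have hrep (W : (y : M) → TangentSpace I y) : toCoord I p _ (W (chartPt I p x)) = coordRep p W x :=
    rfl
  rw [Connection.curvatureField, ← (CovariantDerivative.torsion_eq_zero_iff D).1 hD' dX dY, map_sub,
    map_sub, toCoord_connection_connection hD hx hs hY hZ,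
    toCoord_connection_connection hD hx hs hX hZ, toCoord_connection D hx dZ, map_sub,
    toCoord_connection D hx dY, toCoord_connection D hx dX, hrep, hrep, hsymm,
    christoffel_symm hD' hx (coordRep p X x) (coordRep p Y x)]
  simp only [coordCurvature, add_apply, sub_apply, map_add, map_sub, mul_apply_eq_comp]
  abel

lemma toCoord_curvature [T2Space M] {D : Connection I M}
    (hD : CovariantDerivative.ContMDiffCovariantDerivative D ∞) (hD' : D.torsion = 0)
    (hx : x ∈ (extChartAt I p).target) (X Y Z : TangentSpace I (chartPt I p x)) :
    toCoord I p _ (D.curvature (chartPt I p x) X Y Z) =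
      coordCurvature (christoffel D p) x (toCoord I p _ X) (toCoord I p _ Y) (toCoord I p _ Z) := by
  obtain ⟨s, hs, hX, hY, hZ⟩ :=
    ((eventually_contMDiffOn_extend X).and ((eventually_contMDiffOn_extend Y).and
      (eventually_contMDiffOn_extend Z))).exists_mem_of_smallSets
  rw [Connection.curvature, toCoord_curvatureField hD hD' hx hs hX hY hZ]
  simp [coordRep]

/-- The coordinate expression of a field of endomorphisms in the chart at `p`. -/
def endRep (p : M) (A : (y : M) → TangentSpace I y →L[ℝ] TangentSpace I y) (x : E) : E →L[ℝ] E :=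
  toCoord I p (chartPt I p x) ∘L A (chartPt I p x) ∘L ofCoord I p (chartPt I p x)

/-- The coordinate expression of a `1`-form in the chart at `p`. -/
def formRep (p : M) (α : (y : M) → TangentSpace I y →L[ℝ] ℝ) (x : E) : E →L[ℝ] ℝ :=
  α (chartPt I p x) ∘L ofCoord I p (chartPt I p x)

omit [FiniteDimensional ℝ E] [I.Boundaryless] in
lemma endRep_apply_toCoord (hx : x ∈ (extChartAt I p).target)
    (A : (y : M) → TangentSpace I y →L[ℝ] TangentSpace I y) (W : TangentSpace I (chartPt I p x)) :
    endRep p A x (toCoord I p _ W) = toCoord I p _ (A _ W) := by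
  simp only [endRep, ContinuousLinearMap.comp_apply, ofCoord_toCoord (chartPt_mem_source hx)]

omit [FiniteDimensional ℝ E] [I.Boundaryless] in
lemma formRep_apply_toCoord (hx : x ∈ (extChartAt I p).target)
    (α : (y : M) → TangentSpace I y →L[ℝ] ℝ) (W : TangentSpace I (chartPt I p x)) :
    formRep p α x (toCoord I p _ W) = α _ W := by
  simp only [formRep, ContinuousLinearMap.comp_apply, ofCoord_toCoord (chartPt_mem_source hx)]

omit [FiniteDimensional ℝ E] [I.Boundaryless] in
lemma eq_zero_of_formRep_eq_zero {α : OneForm I M} (hx : x ∈ (extChartAt I p).target)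
    (h : formRep p (fun y => α y) x = 0) : α (chartPt I p x) = 0 := by
  ext X
  rw [← formRep_apply_toCoord hx (fun y => α y) X, h]
  rfl

lemma contDiffAt_endRep {A : (y : M) → TangentSpace I y →L[ℝ] TangentSpace I y}
    (hx : x ∈ (extChartAt I p).target)
    (hA : ContMDiffAt I (I.prod 𝓘(ℝ, E →L[ℝ] E)) ∞ (fun y => TotalSpace.mk' (E →L[ℝ] E)
      (E := fun y : M => TangentSpace I y →L[ℝ] TangentSpace I y) y (A y)) (chartPt I p x)) :
    ContDiffAt ℝ ∞ (endRep p A) x :=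
  contDiffAt_clm_of_apply fun v => contDiffAt_coordRep le_rfl hx
    (hA.clm_bundle_apply (contMDiffAt_coordField (chartPt_mem_source hx) v))

lemma contDiffAt_formRep (hx : x ∈ (extChartAt I p).target) (α : OneForm I M) :
    ContDiffAt ℝ ∞ (formRep p (fun y => α y)) x :=
  contDiffAt_clm_of_apply fun v => contDiffAt_comp_chartPt le_rfl hx
    (α.contMDiffAt_apply (contMDiffAt_coordField (chartPt_mem_source hx) v))

lemma toCoord_onEnd (D : Connection I M) (hx : x ∈ (extChartAt I p).target)
    (A : EndField I M) (X W : TangentSpace I (chartPt I p x)) :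
    toCoord I p _ (D.onEnd A _ X W) =
      (fderiv ℝ (endRep p A) x (toCoord I p _ X)
        + (christoffel D p x (toCoord I p _ X) * endRep p A x
          - endRep p A x * christoffel D p x (toCoord I p _ X))) (toCoord I p _ W) := by
  have hy := chartPt_mem_source hx
  set w := toCoord I p _ W
  have hW : coordField I p w (chartPt I p x) = W := ofCoord_toCoord hy W
  have hm := mdifferentiableAt_coordField (I := I) hy w
  have hA := (contDiffAt_endRep (A := A) hx A.contMDiff.contMDiffAt).differentiableAt (by simp)
  have hrep : coordRep p (fun y => A y (coordField I p w y)) = fun z => endRep p A z w := rfl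
  have hconst := coordRep_coordField_eventuallyEq (I := I) hx w
  conv_lhs => rw [← hW]
  rw [D.onEnd_apply A X hm, map_sub, toCoord_connection D hx (A.mdifferentiableAt_apply hm), hrep,
    (hA.hasFDerivAt.clm_apply (hasFDerivAt_const w x)).fderiv, ← endRep_apply_toCoord hx,
    toCoord_connection D hx hm, hconst.fderiv_eq, hconst.eq_of_nhds]
  simp only [ContinuousLinearMap.comp_zero, zero_add, ContinuousLinearMap.flip_apply, add_apply,
    sub_apply, zero_apply, mul_apply_eq_comp, fderiv_fun_const, Pi.zero_apply]
  abel

lemma onForm_eq_fderiv_formRep (D : Connection I M) (hx : x ∈ (extChartAt I p).target)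
    (α : OneForm I M) (X W : TangentSpace I (chartPt I p x)) :
    D.onForm α _ X W =
      fderiv ℝ (formRep p (fun y => α y)) x (toCoord I p _ X) (toCoord I p _ W)
        - formRep p (fun y => α y) x (christoffel D p x (toCoord I p _ X) (toCoord I p _ W)) := by
  have hy := chartPt_mem_source hx
  set w := toCoord I p _ W
  have hW : coordField I p w (chartPt I p x) = W := ofCoord_toCoord hy W
  have hm := mdifferentiableAt_coordField (I := I) hy w
  have hα := (contDiffAt_formRep hx α).differentiableAt (by simp)
  have hrep : (fun z => (α (chartPt I p z) (coordField I p w (chartPt I p z)) : ℝ)) =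
      fun z => formRep p (fun y => α y) z w := rfl
  have hΓ : α _ (D (coordField I p w) _ X) =
      formRep p (fun y => α y) x (christoffel D p x (toCoord I p _ X) w) := by
    rw [christoffel_apply D hx, ofCoord_toCoord hy]
    exact (formRep_apply_toCoord hx (fun y => α y) _).symm
  conv_lhs => rw [← hW]
  rw [D.onForm_apply α X hm, hΓ, mvfderiv_eq_fderiv hx (α.mdifferentiableAt_apply hm), hrep,
    (hα.hasFDerivAt.clm_apply (hasFDerivAt_const w x)).fderiv]
  simp

end Coordinates

section Metric

variable [RiemannianBundle (fun x : M => TangentSpace I x)]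

variable (I) in
/-- The coordinate expression of the metric in the chart at `p`. -/
def metricRep (p : M) (x : E) : E →L[ℝ] E →L[ℝ] ℝ :=
  (innerSL ℝ (E := TangentSpace I (chartPt I p x))).bilinearComp (ofCoord I p (chartPt I p x))
    (ofCoord I p (chartPt I p x))

variable {p : M} {x : E}

omit [FiniteDimensional ℝ E] in
lemma metricRep_apply (u v : E) : metricRep I p x u v =
    inner ℝ (coordField I p u (chartPt I p x)) (coordField I p v (chartPt I p x)) := rfl

omit [FiniteDimensional ℝ E] in
lemma metricRep_toCoord (hx : x ∈ (extChartAt I p).target)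
    (X Y : TangentSpace I (chartPt I p x)) :
    metricRep I p x (toCoord I p _ X) (toCoord I p _ Y) = inner ℝ X Y := by
  rw [metricRep_apply, coordField, coordField, ofCoord_toCoord (chartPt_mem_source hx),
    ofCoord_toCoord (chartPt_mem_source hx)]

variable [IsContMDiffRiemannianBundle I ∞ E (fun x : M => TangentSpace I x)]

omit [FiniteDimensional ℝ E] in
lemma contMDiffAt_inner_coordField (hy : y ∈ (extChartAt I p).source) (u v : E) :
    ContMDiffAt I 𝓘(ℝ, ℝ) ∞ (fun y => inner ℝ (coordField I p u y) (coordField I p v y)) y :=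
  ContMDiffAt.inner_bundle (IB := I) (F := E) (E := fun y : M => TangentSpace I y)
    (b := fun y : M => y) (contMDiffAt_coordField hy u) (contMDiffAt_coordField hy v)

variable [I.Boundaryless]

lemma contDiffAt_metricRep (hx : x ∈ (extChartAt I p).target) :
    ContDiffAt ℝ ∞ (metricRep I p) x :=
  contDiffAt_clm_of_apply fun u => contDiffAt_clm_of_apply fun v =>
    contDiffAt_comp_chartPt le_rfl hx (contMDiffAt_inner_coordField (chartPt_mem_source hx) u v)

lemma fderiv_metricRep {D : Connection I M} (hD : D.IsLeviCivita)
    (hx : x ∈ (extChartAt I p).target) (u v w : E) :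
    fderiv ℝ (metricRep I p) x u v w = metricRep I p x (christoffel D p x u v) w
      + metricRep I p x v (christoffel D p x u w) := by
  have hy := chartPt_mem_source hx
  have hinner : MDifferentiableAt I 𝓘(ℝ, ℝ) (fun y => inner ℝ (coordField I p v y)
      (coordField I p w y)) (chartPt I p x) :=
    (contMDiffAt_inner_coordField hy v w).mdifferentiableAt (by simp)
  have hrep : (fun z => inner ℝ (coordField I p v (chartPt I p z))
    (coordField I p w (chartPt I p z))) = fun z => metricRep I p z v w := rfl
  have dg := ((contDiffAt_metricRep (I := I) hx).differentiableAt (by simp)).hasFDerivAt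
  have h := hD.metric _ _ _ (mdifferentiableAt_coordField (I := I) hy v)
    (mdifferentiableAt_coordField (I := I) hy w) (ofCoord I p _ u)
  rw [mvfderiv_eq_fderiv hx hinner, toCoord_ofCoord hy, hrep,
    ((dg.clm_apply (hasFDerivAt_const v x)).clm_apply (hasFDerivAt_const w x)).fderiv,
    ← metricRep_toCoord hx, ← metricRep_toCoord hx, ← christoffel_apply D hx,
    ← christoffel_apply D hx, coordField, coordField, toCoord_ofCoord hy, toCoord_ofCoord hy] at h
  simpa using h

end Metric

end Connection

section QuaternionicCurvature

variable {V : Type*} [AddCommGroup V] [Module ℝ V] [TopologicalSpace V]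
  {ι : Type*} [Fintype ι] [DecidableEq ι]

/-- `b` is an orthonormal basis of `V` for the symmetric bilinear form `g`. The form is not assumed
to be the one of an inner product space, since it varies with the point in a chart. -/
structure IsOrthonormalBasis (g : V →L[ℝ] V →L[ℝ] ℝ) (b : Module.Basis ι ℝ V) : Prop where
  symm : ∀ u v, g u v = g v u
  apply : ∀ i j, g (b i) (b j) = if i = j then 1 else 0

namespace IsOrthonormalBasis

variable {g : V →L[ℝ] V →L[ℝ] ℝ} {b : Module.Basis ι ℝ V}

omit [Fintype ι] in
lemma repr_eq (h : IsOrthonormalBasis g b) (v : V) (i : ι) : b.repr v i = g v (b i) := by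
  have hcoord : b.coord i = (g (b i) : V →ₗ[ℝ] ℝ) :=
    b.ext fun j => by simp [h.apply, Finsupp.single_apply, eq_comm]
  rw [h.symm]
  exact LinearMap.congr_fun hcoord v

lemma sum_smul (h : IsOrthonormalBasis g b) (v : V) : ∑ i, g v (b i) • b i = v := by
  simp_rw [← h.repr_eq]
  exact b.sum_repr v

lemma trace_eq (h : IsOrthonormalBasis g b) (T : V →ₗ[ℝ] V) :
    LinearMap.trace ℝ V T = ∑ i, g (T (b i)) (b i) := by
  rw [LinearMap.trace_eq_matrix_trace ℝ b, Matrix.trace]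
  simp [LinearMap.toMatrix_apply, h.repr_eq]

lemma sum_apply_mul (h : IsOrthonormalBasis g b) (φ : V →ₗ[ℝ] ℝ) (v : V) :
    ∑ i, φ (b i) * g v (b i) = φ v := by
  conv_rhs => rw [← h.sum_smul v]
  simp [mul_comm]

lemma sum_skew (h : IsOrthonormalBasis g b) {C : V →L[ℝ] V}
    (hC : ∀ u v, g (C u) v = -g u (C v)) (T : V →ₗ[ℝ] V →ₗ[ℝ] ℝ) :
    ∑ i, T (C (b i)) (b i) = -∑ i, T (b i) (C (b i)) := by
  have hleft (i) : T (C (b i)) (b i) = ∑ j, g (C (b i)) (b j) * T (b j) (b i) :=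
    (h.sum_apply_mul (T.flip (b i)) (C (b i))).symm.trans
      (Finset.sum_congr rfl fun j _ => mul_comm _ _)
  have hright (j) : T (b j) (C (b j)) = ∑ i, g (C (b j)) (b i) * T (b j) (b i) :=
    (h.sum_apply_mul (T (b j)) (C (b j))).symm.trans (Finset.sum_congr rfl fun i _ => mul_comm _ _)
  simp_rw [hleft, hright, ← Finset.sum_neg_distrib]
  rw [Finset.sum_comm]
  refine Finset.sum_congr rfl fun j _ => Finset.sum_congr rfl fun i _ => ?_
  rw [hC, h.symm, neg_mul]

end IsOrthonormalBasis

variable [IsTopologicalAddGroup V] [ContinuousSMul ℝ V]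

omit [ContinuousSMul ℝ V] in
lemma qInner_add_left (A B C : V →L[ℝ] V) : qInner (A + B) C = qInner A C + qInner B C := by
  simp only [qInner, add_mul, ContinuousLinearMap.toLinearMap_add, map_add]; ring

lemma qInner_smul_left (c : ℝ) (A B : V →L[ℝ] V) : qInner (c • A) B = c * qInner A B := by
  simp only [qInner, smul_mul_assoc, ContinuousLinearMap.toLinearMap_smul, map_smul, smul_eq_mul]
  ring

lemma qInner_neg_left (A B : V →L[ℝ] V) : qInner (-A) B = -qInner A B := by
  simpa using qInner_smul_left (-1) A B

lemma qInner_sub_left (A B C : V →L[ℝ] V) : qInner (A - B) C = qInner A C - qInner B C := by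
  rw [sub_eq_add_neg, qInner_add_left, qInner_neg_left, sub_eq_add_neg]

variable {Q : Submodule ℝ (V →L[ℝ] V)} {J : Fin 3 → V →L[ℝ] V}

lemma sum_fin_three_eq {G : Type*} [AddCommMonoid G] (f : Fin 3 → G) (k : Fin 3) :
    ∑ i, f i = f k + f (k + 1) + f (k + 2) := by
  rw [← Equiv.sum_comp (Equiv.addLeft k), Fin.sum_univ_three]
  simp only [Equiv.coe_addLeft, add_zero]

namespace IsAdmissibleBasis

lemma mul_add_one (h : IsAdmissibleBasis Q J) (k : Fin 3) : J k * J (k + 1) = J (k + 2) := by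
  have h02 : J 0 * J 2 = -J 1 := by rw [← h.mul, ← mul_assoc, h.sq, neg_one_mul]
  have h21 : J 2 * J 1 = -J 0 := by rw [← h.mul, mul_assoc, h.sq, mul_neg_one]
  have h12 : J 1 * J 2 = J 0 := by rw [h.anticomm (by decide), h21, neg_neg]
  have h20 : J 2 * J 0 = J 1 := by rw [h.anticomm (by decide), h02, neg_neg]
  fin_cases k
  exacts [h.mul, h12, h20]

lemma add_one_mul (h : IsAdmissibleBasis Q J) (k : Fin 3) : J (k + 1) * J k = -J (k + 2) := by
  rw [h.anticomm (by simp), h.mul_add_one]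

lemma add_two_mul (h : IsAdmissibleBasis Q J) (k : Fin 3) : J (k + 2) * J k = J (k + 1) := by
  have := h.mul_add_one (k + 2)
  rwa [add_assoc, add_assoc, show (2 + 1 : Fin 3) = 0 by decide, show (2 + 2 : Fin 3) = 1 by decide,
    add_zero] at this

lemma mul_add_two (h : IsAdmissibleBasis Q J) (k : Fin 3) : J k * J (k + 2) = -J (k + 1) := by
  rw [h.anticomm (by simp), h.add_two_mul]

lemma apply_apply_self (h : IsAdmissibleBasis Q J) (i : Fin 3) (X : V) : J i (J i X) = -X := by
  simpa using congrArg (fun T : V →L[ℝ] V => T X) (h.sq i)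

lemma commutator_mem (h : IsAdmissibleBasis Q J) {A B : V →L[ℝ] V} (hA : A ∈ Q) (hB : B ∈ Q) :
    A * B - B * A ∈ Q := by
  have hJ (i j : Fin 3) : J i * J j - J j * J i ∈ Q := by
    obtain rfl | rfl | rfl : j = i ∨ j = i + 1 ∨ j = i + 2 := by decide +revert
    · simp
    · rw [h.mul_add_one, h.add_one_mul]
      exact Q.sub_mem (h.mem _) (Q.neg_mem (h.mem _))
    · rw [h.mul_add_two, h.add_two_mul]
      exact Q.sub_mem (Q.neg_mem (h.mem _)) (h.mem _)
  rw [h.span, Submodule.mem_span_range_iff_exists_fun] at hA hB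
  obtain ⟨c, rfl⟩ := hA
  obtain ⟨d, rfl⟩ := hB
  rw [Finset.sum_mul_sum, Finset.sum_mul_sum, Finset.sum_comm, ← Finset.sum_sub_distrib]
  refine Q.sum_mem fun j _ => ?_
  rw [← Finset.sum_sub_distrib]
  refine Q.sum_mem fun i _ => ?_
  rw [smul_mul_smul_comm, smul_mul_smul_comm, mul_comm (d j), ← smul_sub]
  exact Q.smul_mem _ (hJ i j)

lemma commutator_add_one (h : IsAdmissibleBasis Q J) (k : Fin 3) :
    J k * J (k + 1) - J (k + 1) * J k = (2 : ℝ) • J (k + 2) := by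
  rw [h.mul_add_one, h.add_one_mul, two_smul, sub_neg_eq_add]

lemma commutator_add_two (h : IsAdmissibleBasis Q J) (k : Fin 3) :
    J k * J (k + 2) - J (k + 2) * J k = (-2 : ℝ) • J (k + 1) := by
  rw [h.mul_add_two, h.add_two_mul, neg_smul, two_smul, neg_add']

end IsAdmissibleBasis

/-- The algebraic symmetries of the curvature tensor of a quaternionic-Kähler metric. -/
structure IsQuaternionicCurvature (g : V →L[ℝ] V →L[ℝ] ℝ) (Q : Submodule ℝ (V →L[ℝ] V))
    (R : V →ₗ[ℝ] V →ₗ[ℝ] (V →L[ℝ] V)) : Prop where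
  antisymm : ∀ X Y, R X Y = -R Y X
  skew : ∀ X Y Z W, g (R X Y Z) W = -g Z (R X Y W)
  bianchi : ∀ X Y Z, R X Y Z + R Y Z X + R Z X Y = 0
  commutator_mem : ∀ X Y, ∀ A ∈ Q, R X Y * A - A * R X Y ∈ Q

/-- The Ricci form `Ric(X, Y) = tr (Z ↦ R_{Z,X} Y)`, the trace being computed in the basis `b`,
which is meant to be orthonormal for `g`. -/
def ricciForm (g : V →L[ℝ] V →L[ℝ] ℝ) (b : Module.Basis ι ℝ V)
    (R : V →ₗ[ℝ] V →ₗ[ℝ] (V →L[ℝ] V)) : V →ₗ[ℝ] V →ₗ[ℝ] ℝ :=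
  LinearMap.mk₂ ℝ (fun X Y => ∑ i, g (R (b i) X Y) (b i))
    (fun X X' Y => by simp [Finset.sum_add_distrib])
    (fun c X Y => by simp [Finset.mul_sum])
    (fun X Y Y' => by simp [Finset.sum_add_distrib])
    (fun c X Y => by simp [Finset.mul_sum])

omit [DecidableEq ι] in
lemma ricciForm_apply (g : V →L[ℝ] V →L[ℝ] ℝ) (b : Module.Basis ι ℝ V)
    (R : V →ₗ[ℝ] V →ₗ[ℝ] (V →L[ℝ] V)) (X Y : V) :
    ricciForm g b R X Y = ∑ i, g (R (b i) X Y) (b i) := rfl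

namespace IsQuaternionicCurvature

variable {g : V →L[ℝ] V →L[ℝ] ℝ} {b : Module.Basis ι ℝ V}
  {R : V →ₗ[ℝ] V →ₗ[ℝ] (V →L[ℝ] V)}

lemma pair_symm (hR : IsQuaternionicCurvature g Q R) (hg : ∀ u v, g u v = g v u) (X Y Z W : V) :
    g (R X Y Z) W = g (R Z W X) Y := by
  have hcyclic (X Y Z W : V) : g (R X Y Z) W + g (R Y Z X) W + g (R Z X Y) W = 0 := by
    rw [← add_apply, ← add_apply, ← map_add, ← map_add, hR.bianchi, map_zero, zero_apply]
  have hfirst (X Y Z W : V) : g (R X Y Z) W = -g (R Y X Z) W := by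
    rw [hR.antisymm X Y, neg_apply, map_neg, neg_apply]
  have hlast (X Y Z W : V) : g (R X Y Z) W = -g (R X Y W) Z := by rw [hR.skew, hg Z]
  linarith [hcyclic X Y Z W, hcyclic Y Z W X, hcyclic Z W X Y, hcyclic W X Y Z,
    hlast X Y Z W, hlast Y Z W X, hlast Z W X Y, hlast W X Y Z, hfirst X Z Y W, hfirst X Z W Y,
    hfirst Y W Z X, hfirst Y W X Z, hlast X Z Y W, hlast Y W Z X, hlast Z X Y W, hlast W Y Z X]

lemma ricciForm_symm (hR : IsQuaternionicCurvature g Q R) (hb : IsOrthonormalBasis g b) (X Y : V) :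
    ricciForm g b R X Y = ricciForm g b R Y X := by
  rw [ricciForm_apply, ricciForm_apply]
  refine Finset.sum_congr rfl fun i _ => ?_
  rw [hR.pair_symm hb.symm, hR.antisymm Y, neg_apply, map_neg, neg_apply, hR.skew, hb.symm, neg_neg]

end IsQuaternionicCurvature

variable [FiniteDimensional ℝ V]

lemma qInner_add_right (A B C : V →L[ℝ] V) : qInner A (B + C) = qInner A B + qInner A C := by
  rw [qInner_comm, qInner_add_left, qInner_comm B, qInner_comm C]

lemma qInner_smul_right (c : ℝ) (A B : V →L[ℝ] V) : qInner A (c • B) = c * qInner A B := by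
  rw [qInner_comm, qInner_smul_left, qInner_comm B]

lemma qInner_sub_right (A B C : V →L[ℝ] V) : qInner A (B - C) = qInner A B - qInner A C := by
  rw [qInner_comm, qInner_sub_left, qInner_comm B, qInner_comm C]

lemma qInner_zero_right (A : V →L[ℝ] V) : qInner A 0 = 0 := by
  simpa using qInner_smul_right 0 A 0

lemma qInner_commutator (T A B : V →L[ℝ] V) :
    qInner (T * A - A * T) B = qInner T (A * B - B * A) := by
  have htrace : LinearMap.trace ℝ V ((A * T * B : V →L[ℝ] V) : V →ₗ[ℝ] V) =
      LinearMap.trace ℝ V ((T * (B * A) : V →L[ℝ] V) : V →ₗ[ℝ] V) := by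
    rw [← mul_assoc T, mul_assoc]
    exact LinearMap.trace_mul_comm ℝ (A : V →ₗ[ℝ] V) ((T * B : V →L[ℝ] V) : V →ₗ[ℝ] V)
  rw [qInner_sub_left, qInner_sub_right]
  unfold qInner
  rw [htrace, mul_assoc]

namespace IsAdmissibleBasis

lemma mul_add_mul [Nontrivial V] (h : IsAdmissibleBasis Q J) {A B : V →L[ℝ] V} (hA : A ∈ Q)
    (hB : B ∈ Q) : A * B + B * A = (-2 * qInner A B) • 1 := by
  have hJ (i j : Fin 3) : J i * J j + J j * J i = (-2 * qInner (J i) (J j)) • 1 := by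
    rw [h.qInner_eq]
    split_ifs with hij
    · rw [hij, h.sq]; module
    · rw [h.anticomm hij]; simp
  rw [h.span, Submodule.mem_span_range_iff_exists_fun] at hA hB
  obtain ⟨c, rfl⟩ := hA
  obtain ⟨d, rfl⟩ := hB
  rw [Finset.sum_mul_sum, Finset.sum_mul_sum, Finset.sum_comm, ← Finset.sum_add_distrib,
    qInner_comm, qInner_sum_left, Finset.mul_sum, Finset.sum_smul]
  refine Finset.sum_congr rfl fun j _ => ?_
  rw [qInner_comm, qInner_sum_left, ← Finset.sum_add_distrib, Finset.mul_sum, Finset.mul_sum,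
    Finset.sum_smul]
  refine Finset.sum_congr rfl fun i _ => ?_
  rw [smul_mul_smul_comm, smul_mul_smul_comm, mul_comm (d j), ← smul_add, hJ, smul_smul]
  congr 1
  ring

lemma sum_mul_mul [Nontrivial V] (h : IsAdmissibleBasis Q J) {A : V →L[ℝ] V} (hA : A ∈ Q) :
    ∑ i, J i * A * J i = A := by
  have hJ (i : Fin 3) : J i * A * J i = A - (2 * qInner A (J i)) • J i := by
    rw [eq_sub_of_add_eq (h.mul_add_mul (h.mem i) hA), sub_mul, mul_assoc, h.sq, qInner_comm,
      smul_mul_assoc, one_mul, mul_neg_one, neg_mul, neg_smul]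
    abel
  simp_rw [hJ, Finset.sum_sub_distrib, mul_smul, ← Finset.smul_sum, ← h.eq_sum hA]
  rw [Finset.sum_const, Finset.card_univ, Fintype.card_fin]
  module

lemma sum_commutator_commutator [Nontrivial V] (h : IsAdmissibleBasis Q J) {A : V →L[ℝ] V}
    (hA : A ∈ Q) :
    ∑ i, (J i * (A * J i - J i * A) - (A * J i - J i * A) * J i) = (8 : ℝ) • A := by
  have hJ (i : Fin 3) : J i * (A * J i - J i * A) - (A * J i - J i * A) * J i =
      (2 : ℝ) • (J i * A * J i) + (2 : ℝ) • A := by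
    calc _ = (2 : ℝ) • (J i * A * J i) - (J i * J i) * A - A * (J i * J i) := by
          rw [two_smul]; noncomm_ring
      _ = _ := by rw [h.sq, neg_one_mul, mul_neg_one, two_smul ℝ A]; abel
  simp_rw [hJ, Finset.sum_add_distrib, ← Finset.smul_sum, h.sum_mul_mul hA]
  rw [Finset.sum_const, Finset.card_univ, Fintype.card_fin]
  module

end IsAdmissibleBasis

namespace IsQuaternionicCurvature

variable {g : V →L[ℝ] V →L[ℝ] ℝ} {b : Module.Basis ι ℝ V}
  {R : V →ₗ[ℝ] V →ₗ[ℝ] (V →L[ℝ] V)}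

variable (hR : IsQuaternionicCurvature g Q R) (hb : IsOrthonormalBasis g b)
  (hJ : IsAdmissibleBasis Q J) (hskew : ∀ A ∈ Q, ∀ u v, g (A u) v = -g u (A v))

include hR hJ in
lemma commutator_eq_sum [Nontrivial V] {A : V →L[ℝ] V} (hA : A ∈ Q) (X Y : V) :
    R X Y * A - A * R X Y = ∑ j, qInner (R X Y) (A * J j - J j * A) • J j := by
  simp_rw [← qInner_commutator]
  exact hJ.eq_sum (hR.commutator_mem X Y A hA)

include hR hb hskew in
lemma finrank_mul_qInner_eq_two_mul_sum [Nontrivial V] {A : V →L[ℝ] V} (hA : A ∈ Q) (X Y : V) :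
    Module.finrank ℝ V * qInner (R X Y) A = 2 * ∑ i, g (R (b i) X (A (b i))) Y := by
  have hne : (Module.finrank ℝ V : ℝ) ≠ 0 := by
    exact_mod_cast (Module.finrank_pos (R := ℝ) (M := V)).ne'
  have htrace : Module.finrank ℝ V * qInner (R X Y) A = -∑ i, g (R X Y (A (b i))) (b i) := by
    rw [qInner, mul_div_cancel₀ _ hne, hb.trace_eq]; rfl
  let T : V →ₗ[ℝ] V →ₗ[ℝ] ℝ := LinearMap.mk₂ ℝ (fun u v => g (R u X v) Y)
    (fun u u' v => by simp) (fun c u v => by simp) (fun u v v' => by simp) (fun c u v => by simp)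
  have hT (u v : V) : T u v = g (R u X v) Y := rfl
  have hbianchi (i) : g (R X Y (A (b i))) (b i) = -T (b i) (A (b i)) + T (A (b i)) (b i) := by
    have hcyclic := congrArg (fun v => g v Y) (hR.bianchi (A (b i)) (b i) X)
    simp only [map_add, add_apply, map_zero, zero_apply, hR.antisymm X (A (b i)), neg_apply,
      map_neg] at hcyclic
    rw [hR.pair_symm hb.symm, hT, hT]
    linarith
  rw [htrace, Finset.sum_congr rfl fun i _ => hbianchi i, Finset.sum_add_distrib,
    Finset.sum_neg_distrib, hb.sum_skew (hskew A hA)]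
  simp_rw [hT]
  ring

include hR hb hskew in
omit [FiniteDimensional ℝ V] in
lemma sum_qInner_mul {A : V →L[ℝ] V} (hA : A ∈ Q) (B : V →L[ℝ] V) (X Y : V) :
    ∑ i, qInner (R (b i) X) B * g (A (b i)) Y = qInner (R X (A Y)) B := by
  let φ : V →ₗ[ℝ] ℝ :=
    { toFun := fun u => qInner (R X u) B
      map_add' := fun u v => by rw [map_add, qInner_add_left]
      map_smul' := fun c u => by rw [map_smul, qInner_smul_left, RingHom.id_apply, smul_eq_mul] }
  refine (Finset.sum_congr rfl fun i _ => ?_).trans (hb.sum_apply_mul φ (A Y))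
  change _ = qInner (R X (b i)) B * _
  rw [hR.antisymm, qInner_neg_left, hskew A hA, hb.symm, neg_mul_neg]

include hR hb hJ hskew in
lemma finrank_mul_qInner_eq [Nontrivial V] {A : V →L[ℝ] V} (hA : A ∈ Q) (X Y : V) :
    Module.finrank ℝ V * qInner (R X Y) A = 2 * ricciForm g b R X (A Y)
      + 2 * ∑ j, qInner (R X (J j Y)) (A * J j - J j * A) := by
  have hswap (i) : g (R (b i) X (A (b i))) Y = g (R (b i) X (A Y)) (b i)
      + ∑ j, qInner (R (b i) X) (A * J j - J j * A) * g (J j (b i)) Y := by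
    have hcomm : R (b i) X (A (b i)) = A (R (b i) X (b i))
        + ∑ j, qInner (R (b i) X) (A * J j - J j * A) • J j (b i) := by
      have := congrArg (fun S : V →L[ℝ] V => S (b i)) (hR.commutator_eq_sum hJ hA (b i) X)
      simp only [sub_apply, mul_apply_eq_comp, sum_apply, smul_apply] at this
      rw [← this, add_sub_cancel]
    have hAR : g (A (R (b i) X (b i))) Y = g (R (b i) X (A Y)) (b i) := by
      rw [hskew A hA, hR.skew, hb.symm, neg_neg]
    rw [hcomm, map_add, add_apply, hAR]
    simp
  rw [hR.finrank_mul_qInner_eq_two_mul_sum hb hskew hA, ricciForm_apply,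
    Finset.sum_congr rfl fun i _ => hswap i, Finset.sum_add_distrib, Finset.sum_comm]
  simp_rw [hR.sum_qInner_mul hb hskew (hJ.mem _)]
  ring

include hR hb hJ hskew in
lemma finrank_sub_mul_qInner_apply [Nontrivial V] (k : Fin 3) (X Y : V) :
    (Module.finrank ℝ V - 4) * qInner (R X (J k Y)) (J k) =
      -2 * ricciForm g b R X Y - 4 * ∑ j, qInner (R X (J j Y)) (J j) := by
  have hsucc : J (k + 1) (J k Y) = -J (k + 2) Y := congrArg (fun S => S Y) (hJ.add_one_mul k)
  have hpred : J (k + 2) (J k Y) = J (k + 1) Y := congrArg (fun S => S Y) (hJ.add_two_mul k)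
  have h := hR.finrank_mul_qInner_eq hb hJ hskew (hJ.mem k) X (J k Y)
  rw [sum_fin_three_eq _ k, sub_self, qInner_zero_right, hsucc, hpred, hJ.apply_apply_self,
    hJ.commutator_add_one, hJ.commutator_add_two, qInner_smul_right, qInner_smul_right, map_neg,
    map_neg, qInner_neg_left] at h
  rw [sum_fin_three_eq _ k]
  linarith

include hR hb hJ hskew in
lemma qInner_eq_ricciForm (hV : 4 < Module.finrank ℝ V) {A : V →L[ℝ] V} (hA : A ∈ Q) (X Y : V) :
    (Module.finrank ℝ V + 8) * qInner (R X Y) A = 2 * ricciForm g b R X (A Y) := by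
  have : Nontrivial V := Module.nontrivial_of_finrank_pos (R := ℝ) (by lia)
  have hV' : (Module.finrank ℝ V - 4 : ℝ) ≠ 0 := sub_ne_zero_of_ne (by exact_mod_cast hV.ne')
  have hk (k : Fin 3) (Y : V) : (Module.finrank ℝ V + 8) * qInner (R X (J k Y)) (J k) =
      -2 * ricciForm g b R X Y := by
    have h (k : Fin 3) := hR.finrank_sub_mul_qInner_apply hb hJ hskew k X Y
    have heq (j : Fin 3) : qInner (R X (J j Y)) (J j) = qInner (R X (J k Y)) (J k) :=
      mul_left_cancel₀ hV' ((h j).trans (h k).symm)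
    have hk := h k
    simp only [heq, Finset.sum_const, Finset.card_univ, Fintype.card_fin, nsmul_eq_mul,
      Nat.cast_ofNat] at hk
    linarith
  have hk' (k : Fin 3) : (Module.finrank ℝ V + 8) * qInner (R X Y) (J k) =
      2 * ricciForm g b R X (J k Y) := by
    have h := hk k (J k Y)
    rw [hJ.apply_apply_self, map_neg, qInner_neg_left] at h
    linarith
  conv_lhs => rw [hJ.eq_sum hA, qInner_comm, qInner_sum_left]
  conv_rhs => rw [hJ.eq_sum hA]
  simp only [sum_apply, smul_apply, map_sum, map_smul, smul_eq_mul, Finset.mul_sum]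
  exact Finset.sum_congr rfl fun k _ => by
    rw [qInner_comm (J k)]; linear_combination qInner A (J k) * hk' k

include hR hb hJ hskew in
lemma sum_ricciForm_apply_apply [Nontrivial V] {A B : V →L[ℝ] V} (hA : A ∈ Q) (hB : B ∈ Q) :
    ∑ i, ricciForm g b R (b i) (A (B (b i))) =
      -qInner A B * ∑ i, ricciForm g b R (b i) (b i) := by
  have hmove {A B : V →L[ℝ] V} (hB : B ∈ Q) : ∑ i, ricciForm g b R (b i) (A (B (b i))) =
      -∑ i, ricciForm g b R (B (b i)) (A (b i)) := by
    rw [← neg_eq_iff_eq_neg]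
    exact (hb.sum_skew (hskew B hB) ((ricciForm g b R).compl₂ (A : V →ₗ[ℝ] V))).symm
  have hcomm : ∑ i, ricciForm g b R (b i) (A (B (b i))) =
      ∑ i, ricciForm g b R (b i) (B (A (b i))) := by
    rw [hmove hB, hmove hA]
    simp_rw [hR.ricciForm_symm hb (B _)]
  have hanti (i) : ricciForm g b R (b i) (A (B (b i))) + ricciForm g b R (b i) (B (A (b i))) =
      -2 * qInner A B * ricciForm g b R (b i) (b i) := by
    have := congrArg (fun S : V →L[ℝ] V => S (b i)) (hJ.mul_add_mul hA hB)
    simp only [add_apply, mul_apply_eq_comp, smul_apply, one_apply_eq_self] at this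
    rw [← map_add, this, map_smul, smul_eq_mul]
  have hsum := Finset.sum_congr rfl fun i (_ : i ∈ Finset.univ) => hanti i
  rw [Finset.sum_add_distrib, ← hcomm, ← Finset.mul_sum] at hsum
  linarith

include hR hb hJ hskew in
lemma sum_qInner_apply (hV : 4 < Module.finrank ℝ V) {A B : V →L[ℝ] V} (hA : A ∈ Q)
    (hB : B ∈ Q) :
    (Module.finrank ℝ V + 8) * ∑ i, qInner (R (b i) (B (b i))) A =
      -2 * qInner A B * ∑ i, ricciForm g b R (b i) (b i) := by
  have : Nontrivial V := Module.nontrivial_of_finrank_pos (R := ℝ) (by lia)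
  rw [Finset.mul_sum]
  simp_rw [hR.qInner_eq_ricciForm hb hJ hskew hV hA]
  rw [← Finset.mul_sum, hR.sum_ricciForm_apply_apply hb hJ hskew hA hB]
  ring

variable {A : V →L[ℝ] V} (hA : A ∈ Q) {β η : V →ₗ[ℝ] V →ₗ[ℝ] ℝ}
  (hβ : ∀ B ∈ Q, ∀ X Y, β X (B Y) - β Y (B X) =
    qInner (R X Y * A - A * R X Y) B + qInner A B * η X Y)

include hR hb hJ hskew hA hβ in
lemma sum_comp_apply (hV : 4 < Module.finrank ℝ V) {B C : V →L[ℝ] V} (hB : B ∈ Q)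
    (hC : C ∈ Q) :
    (Module.finrank ℝ V + 8) * (2 * ∑ i, β (b i) (B (C (b i)))) =
      -2 * qInner (A * B - B * A) C * ∑ i, ricciForm g b R (b i) (b i)
        + (Module.finrank ℝ V + 8) * (qInner A B * ∑ i, η (b i) (C (b i))) := by
  have hskew' : ∑ i, β (C (b i)) (B (b i)) = -∑ i, β (b i) (B (C (b i))) :=
    hb.sum_skew (hskew C hC) (β.compl₂ (B : V →ₗ[ℝ] V))
  have hsum := Finset.sum_congr rfl fun i (_ : i ∈ Finset.univ) => hβ B hB (b i) (C (b i))
  simp only [Finset.sum_sub_distrib, hskew', qInner_commutator, Finset.sum_add_distrib,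
    ← Finset.mul_sum] at hsum
  rw [← hR.sum_qInner_apply hb hJ hskew hV (hJ.commutator_mem hA hB) hC]
  linear_combination (Module.finrank ℝ V + 8) * hsum

include hR hb hJ hskew hA hβ in
lemma sum_apply_commutator (hV : 4 < Module.finrank ℝ V) {B C : V →L[ℝ] V} (hB : B ∈ Q)
    (hC : C ∈ Q) :
    2 * (Module.finrank ℝ V + 8) * ∑ i, β (b i) ((B * C - C * B) (b i)) =
      -4 * qInner A (B * C - C * B) * ∑ i, ricciForm g b R (b i) (b i)
        + (Module.finrank ℝ V + 8) *
          (qInner A B * ∑ i, η (b i) (C (b i)) - qInner A C * ∑ i, η (b i) (B (b i))) := by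
  have hBC := hR.sum_comp_apply hb hJ hskew hA hβ hV hB hC
  have hCB := hR.sum_comp_apply hb hJ hskew hA hβ hV hC hB
  rw [qInner_commutator, qInner_sub_right] at hBC hCB
  simp only [sub_apply, mul_apply_eq_comp, map_sub, Finset.sum_sub_distrib, qInner_sub_right]
  linear_combination hBC - hCB

include hR hb hJ hskew hA hβ in
lemma sum_apply_of_mem (hV : 4 < Module.finrank ℝ V) :
    (Module.finrank ℝ V + 8) * ∑ i, β (b i) (A (b i)) =
      -2 * (∑ i, ricciForm g b R (b i) (b i)) * qInner A A := by
  have : Nontrivial V := Module.nontrivial_of_finrank_pos (R := ℝ) (by lia)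
  let K (j : Fin 3) := A * J j - J j * A
  have hK (j) : K j ∈ Q := hJ.commutator_mem hA (hJ.mem j)
  have hcasimir : ∑ j, (J j * K j - K j * J j) = (8 : ℝ) • A := hJ.sum_commutator_commutator hA
  have hAK (j) : qInner A (K j) = 0 := by
    rw [← qInner_commutator, sub_self, qInner_comm, qInner_zero_right]
  have hAA : ∑ j, qInner A (J j) • K j = 0 := by
    have hl := congrArg (A * ·) (hJ.eq_sum hA)
    have hr := congrArg (· * A) (hJ.eq_sum hA)
    simp only [Finset.mul_sum, mul_smul_comm, Finset.sum_mul, smul_mul_assoc] at hl hr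
    simp_rw [K, smul_sub, Finset.sum_sub_distrib, ← hl, ← hr, sub_self]
  have hη : ∑ j, qInner A (J j) * ∑ i, η (b i) (K j (b i)) = 0 := by
    have hi (i) : ∑ j, qInner A (J j) * η (b i) (K j (b i)) = 0 := by
      have := congrArg (fun S : V →L[ℝ] V => η (b i) (S (b i))) hAA
      simpa using this
    simp_rw [Finset.mul_sum]
    rw [Finset.sum_comm]
    simp_rw [hi, Finset.sum_const_zero]
  have hβ8 : ∑ j, ∑ i, β (b i) ((J j * K j - K j * J j) (b i)) = 8 * ∑ i, β (b i) (A (b i)) := by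
    rw [Finset.sum_comm, Finset.mul_sum]
    refine Finset.sum_congr rfl fun i _ => ?_
    rw [← map_sum, ← sum_apply, hcasimir, smul_apply, map_smul, smul_eq_mul]
  have hq8 : ∑ j, qInner A (J j * K j - K j * J j) = 8 * qInner A A := by
    simp_rw [qInner_comm A, ← qInner_smul_left, ← hcasimir]
    simp only [Fin.sum_univ_three, qInner_add_left]
  have hsum := Finset.sum_congr rfl fun j (_ : j ∈ Finset.univ) =>
    hR.sum_apply_commutator hb hJ hskew hA hβ hV (hJ.mem j) (hK j)
  simp_rw [hAK, zero_mul, sub_zero, Finset.sum_add_distrib, ← Finset.mul_sum, ← Finset.sum_mul,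
    ← Finset.mul_sum, hη, hβ8, hq8] at hsum
  linarith

end IsQuaternionicCurvature

end QuaternionicCurvature

section CovariantDerivative

variable {E : Type*} [NormedAddCommGroup E] [NormedSpace ℝ E]
  {Γ : E → E →L[ℝ] E →L[ℝ] E} {A B : E → E →L[ℝ] E} {x : E}

lemma hasFDerivAt_apply_const {F : Type*} [NormedAddCommGroup F] [NormedSpace ℝ F]
    {T : E → E →L[ℝ] F} (hT : DifferentiableAt ℝ T x) (v : E) :
    HasFDerivAt (fun z => T z v) ((fderiv ℝ T x).flip v) x := by
  simpa using hT.hasFDerivAt.clm_apply (hasFDerivAt_const v x)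

lemma fderiv_fderiv_comm {F : Type*} [NormedAddCommGroup F] [NormedSpace ℝ F] {T : E → F}
    (hT : ContDiffAt ℝ ∞ T x) (u v : E) :
    fderiv ℝ (fderiv ℝ T) x u v = fderiv ℝ (fderiv ℝ T) x v u :=
  hT.isSymmSndFDerivAt (by simpa using ENat.LEInfty.out) u v

lemma differentiableAt_fderiv {F : Type*} [NormedAddCommGroup F] [NormedSpace ℝ F] {T : E → F}
    (hT : ContDiffAt ℝ ∞ T x) : DifferentiableAt ℝ (fderiv ℝ T) x :=
  (hT.fderiv_right (m := ∞) le_rfl).differentiableAt (by simp)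

/-- The covariant derivative `u ↦ dA(u) + [Γ(u), A]`, in a chart with Christoffel symbols `Γ`, of a
field `A` of endomorphisms. -/
def covEnd (Γ : E → E →L[ℝ] E →L[ℝ] E) (A : E → E →L[ℝ] E) (x : E) : E →L[ℝ] E →L[ℝ] E :=
  fderiv ℝ A x + ((ContinuousLinearMap.mul ℝ (E →L[ℝ] E)).flip (A x)
    - ContinuousLinearMap.mul ℝ (E →L[ℝ] E) (A x)) ∘L Γ x

lemma covEnd_apply (u : E) :
    covEnd Γ A x u = fderiv ℝ A x u + (Γ x u * A x - A x * Γ x u) := by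
  simp [covEnd]

lemma fderiv_apply_eq (u v : E) :
    fderiv ℝ A x u v = covEnd Γ A x u v - Γ x u (A x v) + A x (Γ x u v) := by
  rw [covEnd_apply]
  simp only [add_apply, sub_apply, mul_apply_eq_comp]
  abel

lemma covEnd_congr (h : A =ᶠ[𝓝 x] B) : covEnd Γ A x = covEnd Γ B x := by
  rw [covEnd, covEnd, h.fderiv_eq, h.self_of_nhds]

lemma covEnd_add (hA : DifferentiableAt ℝ A x) (hB : DifferentiableAt ℝ B x) (u : E) :
    covEnd Γ (fun z => A z + B z) x u = covEnd Γ A x u + covEnd Γ B x u := by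
  rw [covEnd_apply, covEnd_apply, covEnd_apply, fderiv_fun_add hA hB]
  simp only [add_apply, mul_add, add_mul]
  abel

lemma covEnd_smul {φ : E → ℝ} (hφ : DifferentiableAt ℝ φ x) (hA : DifferentiableAt ℝ A x) (u : E) :
    covEnd Γ (fun z => φ z • A z) x u = fderiv ℝ φ x u • A x + φ x • covEnd Γ A x u := by
  rw [covEnd_apply, covEnd_apply, fderiv_fun_smul hφ hA]
  simp only [add_apply, smul_apply, ContinuousLinearMap.smulRight_apply, smul_mul_assoc,
    mul_smul_comm, smul_add, smul_sub]
  abel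

lemma covEnd_sum_smul {ι : Type*} {s : Finset ι} {φ : ι → E → ℝ} {J : ι → E → E →L[ℝ] E}
    (hφ : ∀ i, DifferentiableAt ℝ (φ i) x) (hJ : ∀ i, DifferentiableAt ℝ (J i) x) (u : E) :
    covEnd Γ (fun z => ∑ i ∈ s, φ i z • J i z) x u =
      ∑ i ∈ s, (fderiv ℝ (φ i) x u • J i x + φ i x • covEnd Γ (J i) x u) := by
  classical
  induction s using Finset.induction_on with
  | empty => simp [covEnd_apply]
  | insert i s hi ih =>
    simp_rw [Finset.sum_insert hi]
    rw [covEnd_add ((hφ i).fun_smul (hJ i))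
      (DifferentiableAt.fun_sum fun j _ => (hφ j).fun_smul (hJ j)), covEnd_smul (hφ i) (hJ i), ih]

lemma contDiffAt_covEnd (hΓ : ContDiffAt ℝ ∞ Γ x) (hA : ContDiffAt ℝ ∞ A x) :
    ContDiffAt ℝ ∞ (covEnd Γ A) x := by
  refine (hA.fderiv_right le_rfl).add (ContDiffAt.clm_comp (ContDiffAt.sub ?_ ?_) hΓ) <;>
  exact (ContinuousLinearMap.contDiff _).contDiffAt.comp x hA

lemma fderiv_covEnd_apply (hΓ : ContDiffAt ℝ ∞ Γ x) (hA : ContDiffAt ℝ ∞ A x) (u v : E) :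
    fderiv ℝ (fun z => covEnd Γ A z v) x u = fderiv ℝ (fderiv ℝ A) x u v +
      (fderiv ℝ Γ x u v * A x - A x * fderiv ℝ Γ x u v) +
      (Γ x v * fderiv ℝ A x u - fderiv ℝ A x u * Γ x v) := by
  have hdA := (hA.differentiableAt (by simp)).hasFDerivAt
  have hdΓ := hasFDerivAt_apply_const (hΓ.differentiableAt (by simp)) v
  have hd := (hasFDerivAt_apply_const (differentiableAt_fderiv hA) v).fun_add
    ((hdΓ.fun_mul' hdA).fun_sub (hdA.fun_mul' hdΓ))
  simp_rw [covEnd_apply]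
  rw [hd.fderiv]
  simp only [add_apply, sub_apply, smul_apply, ContinuousLinearMap.flip_apply, smul_eq_mul,
    MulOpposite.smul_eq_mul_unop, MulOpposite.unop_op]
  abel

lemma ricci_identity (hΓ : ContDiffAt ℝ ∞ Γ x) (hA : ContDiffAt ℝ ∞ A x) (u v : E) :
    covEnd Γ (fun z => covEnd Γ A z v) x u - covEnd Γ (fun z => covEnd Γ A z u) x v =
      coordCurvature Γ x u v * A x - A x * coordCurvature Γ x u v := by
  rw [covEnd_apply (A := fun z => covEnd Γ A z v) u, covEnd_apply (A := fun z => covEnd Γ A z u) v,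
    fderiv_covEnd_apply hΓ hA, fderiv_covEnd_apply hΓ hA, fderiv_fderiv_comm hA u v, covEnd_apply,
    covEnd_apply, coordCurvature]
  noncomm_ring

/-- `coordCurvature` as a bilinear map. -/
def coordCurvatureL (Γ : E → E →L[ℝ] E →L[ℝ] E) (x : E) : E →ₗ[ℝ] E →ₗ[ℝ] (E →L[ℝ] E) :=
  let dΓ := (fderiv ℝ Γ x).toLinearMap₁₂
  let ΓΓ := (LinearMap.mul ℝ (E →L[ℝ] E)).compl₁₂ (Γ x).toLinearMap (Γ x).toLinearMap
  dΓ - dΓ.flip + (ΓΓ - ΓΓ.flip)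

lemma coordCurvatureL_apply (u v : E) : coordCurvatureL Γ x u v = coordCurvature Γ x u v := by
  simp [coordCurvatureL, coordCurvature]

lemma fderiv_christoffel_symm (hΓ : DifferentiableAt ℝ Γ x)
    (hsymm : ∀ᶠ z in 𝓝 x, ∀ u v, Γ z u v = Γ z v u) (u v w : E) :
    fderiv ℝ Γ x u v w = fderiv ℝ Γ x u w v := by
  have hd (v w : E) := (hasFDerivAt_apply_const hΓ v).clm_apply (hasFDerivAt_const w x)
  have heq : (fun z => Γ z v w) =ᶠ[𝓝 x] fun z => Γ z w v := hsymm.mono fun z hz => hz v w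
  have hfd := congrArg (fun T : E →L[ℝ] E => T u)
    (((hd v w).fderiv.symm.trans heq.fderiv_eq).trans (hd w v).fderiv)
  simpa using hfd

lemma coordCurvature_bianchi (hΓ : DifferentiableAt ℝ Γ x)
    (hsymm : ∀ᶠ z in 𝓝 x, ∀ u v, Γ z u v = Γ z v u) (u v w : E) :
    coordCurvature Γ x u v w + coordCurvature Γ x v w u + coordCurvature Γ x w u v = 0 := by
  have hd := fderiv_christoffel_symm hΓ hsymm
  have hs := hsymm.self_of_nhds
  simp only [coordCurvature, add_apply, sub_apply, mul_apply_eq_comp]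
  rw [hd v u w, hd w v u, hd u w v, hs v w, hs w u, hs u v]
  abel

lemma fderiv_fderiv_metric {g : E → E →L[ℝ] E →L[ℝ] ℝ} (hΓ : DifferentiableAt ℝ Γ x)
    (hg : ContDiffAt ℝ ∞ g x) (hmetric : ∀ᶠ z in 𝓝 x, ∀ u v w,
      fderiv ℝ g z u v w = g z (Γ z u v) w + g z v (Γ z u w)) (u v w w' : E) :
    fderiv ℝ (fderiv ℝ fun z => g z w w') x u v =
      fderiv ℝ g x u (Γ x v w) w' + g x (fderiv ℝ Γ x u v w) w'
        + (fderiv ℝ g x u w (Γ x v w') + g x w (fderiv ℝ Γ x u v w')) := by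
  have hdg := (hg.differentiableAt (by simp)).hasFDerivAt
  have hgw : ContDiffAt ℝ ∞ (fun z => g z w w') x :=
    (hg.clm_apply contDiffAt_const).clm_apply contDiffAt_const
  have hg_near : ∀ᶠ z in 𝓝 x, DifferentiableAt ℝ g z :=
    ((hg.of_le (m := 1) (by simp)).eventually (by simp)).mono
      fun z hz => hz.differentiableAt (by simp)
  have heq : (fun z => fderiv ℝ (fun z => g z w w') z v) =ᶠ[𝓝 x]
      fun z => g z (Γ z v w) w' + g z w (Γ z v w') := by
    filter_upwards [hmetric, hg_near] with z hz hgz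
    have hd := (hgz.hasFDerivAt.clm_apply (hasFDerivAt_const w z)).clm_apply
      (hasFDerivAt_const w' z)
    rw [← hz v w w', hd.fderiv]
    simp
  have hdΓ (w : E) := (hasFDerivAt_apply_const hΓ v).clm_apply (hasFDerivAt_const w x)
  have hd := ((hdg.clm_apply (hdΓ w)).clm_apply (hasFDerivAt_const w' x)).fun_add
    ((hdg.clm_apply (hasFDerivAt_const w x)).clm_apply (hdΓ w'))
  have hfd := congrArg (fun T : E →L[ℝ] ℝ => T u)
    (((hasFDerivAt_apply_const (differentiableAt_fderiv hgw) v).fderiv.symm.trans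
      heq.fderiv_eq).trans hd.fderiv)
  simp only [ContinuousLinearMap.flip_apply, ContinuousLinearMap.comp_zero, zero_add,
    ContinuousLinearMap.flip_add, add_apply, ContinuousLinearMap.comp_apply] at hfd
  linarith

lemma coordCurvature_skew {g : E → E →L[ℝ] E →L[ℝ] ℝ} (hΓ : DifferentiableAt ℝ Γ x)
    (hg : ContDiffAt ℝ ∞ g x) (hmetric : ∀ᶠ z in 𝓝 x, ∀ u v w,
      fderiv ℝ g z u v w = g z (Γ z u v) w + g z v (Γ z u w)) (u v w w' : E) :
    g x (coordCurvature Γ x u v w) w' = -g x w (coordCurvature Γ x u v w') := by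
  have hcomm := fderiv_fderiv_comm (T := fun z => g z w w')
    ((hg.clm_apply contDiffAt_const).clm_apply contDiffAt_const) u v
  rw [fderiv_fderiv_metric hΓ hg hmetric, fderiv_fderiv_metric hΓ hg hmetric] at hcomm
  simp only [hmetric.self_of_nhds] at hcomm
  simp only [coordCurvature, add_apply, sub_apply, mul_apply_eq_comp, map_add, map_sub]
  linarith

variable [FiniteDimensional ℝ E]

variable (E) in
/-- The linear form `A ↦ -tr A / dim E`, for which `qInner A B` is the value at `A * B`. -/
def qTrace : (E →L[ℝ] E) →L[ℝ] ℝ :=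
  LinearMap.toContinuousLinearMap
    (-(Module.finrank ℝ E : ℝ)⁻¹ • LinearMap.trace ℝ E ∘ₗ ContinuousLinearMap.coeLM ℝ)

lemma qTrace_mul (A B : E →L[ℝ] E) : qTrace E (A * B) = qInner A B := by
  simp [qTrace, qInner, div_eq_inv_mul]

lemma contDiffAt_qInner {k : ℕ∞ω} (hA : ContDiffAt ℝ k A x) (hB : ContDiffAt ℝ k B x) :
    ContDiffAt ℝ k (fun z => qInner (A z) (B z)) x := by
  simp_rw [← qTrace_mul]
  exact (qTrace E).contDiff.contDiffAt.comp x (hA.mul hB)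

lemma fderiv_qInner (hA : DifferentiableAt ℝ A x) (hB : DifferentiableAt ℝ B x) (u : E) :
    fderiv ℝ (fun z => qInner (A z) (B z)) x u =
      qInner (covEnd Γ A x u) (B x) + qInner (A x) (covEnd Γ B x u) := by
  have hd := (qTrace E).hasFDerivAt.comp x (hA.hasFDerivAt.fun_mul' hB.hasFDerivAt)
  have hfd : fderiv ℝ (fun z => qInner (A z) (B z)) x u =
      qInner (fderiv ℝ A x u) (B x) + qInner (A x) (fderiv ℝ B x u) := by
    simp_rw [← qTrace_mul]
    rw [add_comm, ← map_add]
    exact congrArg (fun T : E →L[ℝ] ℝ => T u) hd.fderiv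
  rw [hfd, covEnd_apply, covEnd_apply, qInner_add_left, qInner_add_right, qInner_commutator,
    qInner_comm (A x) (_ - _), qInner_commutator, ← neg_sub (A x * B x), qInner_comm _ (-_),
    qInner_neg_left, qInner_comm (_ - _)]
  ring

end CovariantDerivative

section QuaternionicKahlerChart

variable {E : Type*} [NormedAddCommGroup E] [NormedSpace ℝ E]
  {Γ : E → E →L[ℝ] E →L[ℝ] E} {A : E → E →L[ℝ] E} {x : E}

/-- A quaternionic-Kähler metric on an open subset `U` of `E`: the Christoffel symbols `Γ`, the
metric `g`, the quaternionic structure `Q` and an admissible frame `J`. -/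
structure IsQuaternionicKahlerOn (U : Set E) (Γ : E → E →L[ℝ] E →L[ℝ] E)
    (g : E → E →L[ℝ] E →L[ℝ] ℝ) (Q : E → Submodule ℝ (E →L[ℝ] E))
    (J : Fin 3 → E → E →L[ℝ] E) : Prop where
  isOpen : IsOpen U
  christoffel_smooth : ∀ z ∈ U, ContDiffAt ℝ ∞ Γ z
  metric_smooth : ∀ z ∈ U, ContDiffAt ℝ ∞ g z
  frame_smooth : ∀ i, ∀ z ∈ U, ContDiffAt ℝ ∞ (J i) z
  symm : ∀ z ∈ U, ∀ u v, Γ z u v = Γ z v u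
  metric : ∀ z ∈ U, ∀ u v w, fderiv ℝ g z u v w = g z (Γ z u v) w + g z v (Γ z u w)
  admissible : ∀ z ∈ U, IsAdmissibleBasis (Q z) (fun i => J i z)
  covEnd_frame_mem : ∀ z ∈ U, ∀ i u, covEnd Γ (J i) z u ∈ Q z
  skew : ∀ z ∈ U, ∀ C ∈ Q z, ∀ u v, g z (C u) v = -g z u (C v)

namespace IsQuaternionicKahlerOn

variable {U : Set E} {g : E → E →L[ℝ] E →L[ℝ] ℝ} {Q : E → Submodule ℝ (E →L[ℝ] E)}
  {J : Fin 3 → E → E →L[ℝ] E}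

lemma mem_nhds (hU : IsQuaternionicKahlerOn U Γ g Q J) (hx : x ∈ U) : U ∈ 𝓝 x :=
  hU.isOpen.mem_nhds hx

lemma differentiableAt_frame (hU : IsQuaternionicKahlerOn U Γ g Q J) (hx : x ∈ U) (i : Fin 3) :
    DifferentiableAt ℝ (J i) x :=
  (hU.frame_smooth i x hx).differentiableAt (by simp)

variable [FiniteDimensional ℝ E] [Nontrivial E]

lemma covEnd_mem (hU : IsQuaternionicKahlerOn U Γ g Q J) (hA : ∀ z ∈ U, A z ∈ Q z)
    (hAx : ContDiffAt ℝ ∞ A x) (hx : x ∈ U) (u : E) : covEnd Γ A x u ∈ Q x := by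
  have heq : A =ᶠ[𝓝 x] fun z => ∑ i, qInner (A z) (J i z) • J i z := by
    filter_upwards [hU.mem_nhds hx] with z hz using (hU.admissible z hz).eq_sum (hA z hz)
  rw [covEnd_congr heq, covEnd_sum_smul (fun i =>
    (contDiffAt_qInner hAx (hU.frame_smooth i x hx)).differentiableAt (by simp))
    (hU.differentiableAt_frame hx)]
  exact Submodule.sum_mem _ fun i _ => Submodule.add_mem _
    (Submodule.smul_mem _ _ ((hU.admissible x hx).mem i))
    (Submodule.smul_mem _ _ (hU.covEnd_frame_mem x hx i u))

lemma exists_section_eq (hU : IsQuaternionicKahlerOn U Γ g Q J) (hx : x ∈ U) {C : E →L[ℝ] E}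
    (hC : C ∈ Q x) : ∃ B : E → E →L[ℝ] E, B x = C ∧ (∀ z ∈ U, B z ∈ Q z) ∧
      ∀ z ∈ U, ContDiffAt ℝ ∞ B z :=
  ⟨fun z => ∑ i, qInner C (J i x) • J i z, ((hU.admissible x hx).eq_sum hC).symm,
    fun z hz => Submodule.sum_mem _ fun i _ => Submodule.smul_mem _ _ ((hU.admissible z hz).mem i),
    fun z hz => ContDiffAt.sum fun i _ => (hU.frame_smooth i z hz).const_smul _⟩

lemma commutator_coordCurvature_mem (hU : IsQuaternionicKahlerOn U Γ g Q J) (hx : x ∈ U)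
    (u v : E) {C : E →L[ℝ] E} (hC : C ∈ Q x) :
    coordCurvature Γ x u v * C - C * coordCurvature Γ x u v ∈ Q x := by
  obtain ⟨B, rfl, hB, hB_smooth⟩ := hU.exists_section_eq hx hC
  have hmem (u v : E) : covEnd Γ (fun z => covEnd Γ B z v) x u ∈ Q x :=
    hU.covEnd_mem (fun z hz => hU.covEnd_mem hB (hB_smooth z hz) hz v)
      ((contDiffAt_covEnd (hU.christoffel_smooth x hx) (hB_smooth x hx)).clm_apply
        contDiffAt_const) hx u
  rw [← ricci_identity (hU.christoffel_smooth x hx) (hB_smooth x hx)]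
  exact Submodule.sub_mem _ (hmem u v) (hmem v u)

lemma isQuaternionicCurvature (hU : IsQuaternionicKahlerOn U Γ g Q J) (hx : x ∈ U) :
    IsQuaternionicCurvature (g x) (Q x) (coordCurvatureL Γ x) where
  antisymm u v := by
    simp only [coordCurvatureL_apply, coordCurvature]; abel
  skew := coordCurvature_skew ((hU.christoffel_smooth x hx).differentiableAt (by simp))
    (hU.metric_smooth x hx) (Filter.mem_of_superset (hU.mem_nhds hx) hU.metric)
  bianchi := coordCurvature_bianchi ((hU.christoffel_smooth x hx).differentiableAt (by simp))
    (Filter.mem_of_superset (hU.mem_nhds hx) hU.symm)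
  commutator_mem u v _ := hU.commutator_coordCurvature_mem hx u v

end IsQuaternionicKahlerOn

end QuaternionicKahlerChart

section Twistor

variable {E : Type*} [NormedAddCommGroup E] [NormedSpace ℝ E]
  {Γ : E → E →L[ℝ] E →L[ℝ] E} {A : E → E →L[ℝ] E} {x : E}
  {U : Set E} {g : E → E →L[ℝ] E →L[ℝ] ℝ} {Q : E → Submodule ℝ (E →L[ℝ] E)}
  {J : Fin 3 → E → E →L[ℝ] E} {α β : E → E →L[ℝ] ℝ}

/-- The covariant derivative `(u, v) ↦ dα(u)(v) - α(Γ(u)v)`, in a chart with Christoffel symbols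
`Γ`, of a `1`-form `α`. -/
def covForm (Γ : E → E →L[ℝ] E →L[ℝ] E) (α : E → E →L[ℝ] ℝ) (x : E) : E →L[ℝ] E →L[ℝ] ℝ :=
  fderiv ℝ α x - ContinuousLinearMap.compL ℝ E E ℝ (α x) ∘L Γ x

lemma covForm_apply (u v : E) : covForm Γ α x u v = fderiv ℝ α x u v - α x (Γ x u v) := by
  simp [covForm]

/-- The squared norm of a field of endomorphisms, for `qInner`. -/
def qNormSq (A : E → E →L[ℝ] E) (x : E) : ℝ := qInner (A x) (A x)

lemma IsAdmissibleBasis.apply_eq_sum [FiniteDimensional ℝ E] [Nontrivial E]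
    {Q : Submodule ℝ (E →L[ℝ] E)} {J : Fin 3 → E →L[ℝ] E} (h : IsAdmissibleBasis Q J)
    {A : E →L[ℝ] E} (hA : A ∈ Q) (u : E) : A u = ∑ i, qInner A (J i) • J i u := by
  conv_lhs => rw [h.eq_sum hA]
  simp only [sum_apply, smul_apply]

lemma IsOrthonormalBasis.sum_sq_comp {ι : Type*} [Fintype ι] [DecidableEq ι]
    {g : E →L[ℝ] E →L[ℝ] ℝ} {b : Module.Basis ι ℝ E} (h : IsOrthonormalBasis g b)
    {C : E →L[ℝ] E} (hC : ∀ u v, g (C u) v = -g u (C v)) {c : ℝ} (hCC : C * C = (-c) • 1)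
    (φ : E →L[ℝ] ℝ) : ∑ i, φ (C (b i)) ^ 2 = c * ∑ i, φ (b i) ^ 2 := by
  have hCC_apply (u : E) : C (C u) = (-c) • u := congrArg (fun T : E →L[ℝ] E => T u) hCC
  have hskew := h.sum_skew hC (LinearMap.smulRight φ.toLinearMap (φ ∘L C).toLinearMap)
  simp only [LinearMap.smulRight_apply, LinearMap.smul_apply, ContinuousLinearMap.coe_coe,
    ContinuousLinearMap.comp_apply, hCC_apply, map_smul, smul_eq_mul] at hskew
  simp_rw [sq, hskew, Finset.mul_sum, ← Finset.sum_neg_distrib]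
  exact Finset.sum_congr rfl fun i _ => by ring

/-- `A` is a section of `Q` over `U` with `∇A = 2 α ⊗ A + ∑ᵢ (β ∘ Jᵢ) ⊗ Jᵢ`. This is the equation
satisfied, for the Levi-Civita connection `∇`, by a section of `Q` in the kernel of the Penrose
operator of `∇ + S^α`. -/
structure IsTwistorOn (U : Set E) (Γ : E → E →L[ℝ] E →L[ℝ] E) (Q : E → Submodule ℝ (E →L[ℝ] E))
    (J : Fin 3 → E → E →L[ℝ] E) (α : E → E →L[ℝ] ℝ) (A : E → E →L[ℝ] E)
    (β : E → E →L[ℝ] ℝ) : Prop where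
  form_smooth : ∀ z ∈ U, ContDiffAt ℝ ∞ α z
  smooth : ∀ z ∈ U, ContDiffAt ℝ ∞ A z
  beta_smooth : ∀ z ∈ U, ContDiffAt ℝ ∞ β z
  mem : ∀ z ∈ U, A z ∈ Q z
  eq : ∀ z ∈ U, ∀ u, covEnd Γ A z u = (2 * α z u) • A z + ∑ i, β z (J i z u) • J i z

variable [FiniteDimensional ℝ E]

lemma contDiffAt_qNormSq (hA : ContDiffAt ℝ ∞ A x) : ContDiffAt ℝ ∞ (qNormSq A) x :=
  contDiffAt_qInner hA hA

lemma exists_isTwistorOn [Nontrivial E] (hU : IsQuaternionicKahlerOn U Γ g Q J)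
    (hα : ∀ z ∈ U, ContDiffAt ℝ ∞ α z) (hA : ∀ z ∈ U, ContDiffAt ℝ ∞ A z)
    (hQ : ∀ z ∈ U, A z ∈ Q z)
    (h : ∀ z ∈ U, ∃ β : E →L[ℝ] ℝ, ∀ u, covEnd Γ A z u = (2 * α z u) • A z +
      ∑ i, β (J i z u) • J i z) : ∃ β, IsTwistorOn U Γ Q J α A β := by
  choose! β hβ using h
  -- Pairing the equation with `J 0` recovers `β`, hence its smoothness.
  have hβ_apply (z) (hz : z ∈ U) (u : E) : β z u = -(qInner (covEnd Γ A z (J 0 z u)) (J 0 z)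
      - (2 * α z (J 0 z u)) * qInner (A z) (J 0 z)) := by
    rw [hβ z hz, qInner_add_left, qInner_smul_left, qInner_sum_left]
    simp [(hU.admissible z hz).qInner_eq, (hU.admissible z hz).apply_apply_self 0]
  refine ⟨β, hα, hA, fun z hz => contDiffAt_clm_of_apply fun u => ?_, hQ, hβ⟩
  have hJ := hU.frame_smooth 0 z hz
  have hJu : ContDiffAt ℝ ∞ (fun z => J 0 z u) z := hJ.clm_apply contDiffAt_const
  have hF := (contDiffAt_covEnd (hU.christoffel_smooth z hz) (hA z hz)).clm_apply hJu
  have hαJ : ContDiffAt ℝ ∞ (fun z => 2 * α z (J 0 z u)) z :=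
    contDiffAt_const.mul ((hα z hz).clm_apply hJu)
  refine ((contDiffAt_qInner hF hJ).sub
    (hαJ.mul (contDiffAt_qInner (hA z hz) hJ))).neg.congr_of_eventuallyEq ?_
  filter_upwards [hU.mem_nhds hz] with y hy using hβ_apply y hy u

namespace IsTwistorOn

variable [Nontrivial E] (hU : IsQuaternionicKahlerOn U Γ g Q J) (hA : IsTwistorOn U Γ Q J α A β)

include hU hA

lemma qInner_covEnd (hx : x ∈ U) (u : E) {B : E →L[ℝ] E} (hB : B ∈ Q x) :
    qInner (covEnd Γ A x u) B = 2 * α x u * qInner (A x) B + β x (B u) := by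
  rw [hA.eq x hx, qInner_add_left, qInner_smul_left, qInner_sum_left,
    (hU.admissible x hx).apply_eq_sum hB, map_sum]
  simp only [map_smul, smul_eq_mul, qInner_comm B, mul_comm]

lemma qInner_covEnd_covEnd (hx : x ∈ U) (u v : E) {B : E →L[ℝ] E} (hB : B ∈ Q x) :
    qInner (covEnd Γ (fun z => covEnd Γ A z v) x u) B =
      2 * fderiv ℝ α x u v * qInner (A x) B + 2 * α x v * (2 * α x u * qInner (A x) B + β x (B u)) +
      covForm Γ β x u (B v) + β x (B (Γ x u v)) := by
  obtain ⟨B, rfl, hBQ, hB_smooth⟩ := hU.exists_section_eq hx hB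
  have hdα := hasFDerivAt_apply_const ((hA.form_smooth x hx).differentiableAt (by simp)) v
  have hdβ := ((hA.beta_smooth x hx).differentiableAt (by simp)).hasFDerivAt
  have hdA := (hA.smooth x hx).differentiableAt (by simp)
  have hdB := (hB_smooth x hx).differentiableAt (by simp)
  have hdF := ((contDiffAt_covEnd (hU.christoffel_smooth x hx) (hA.smooth x hx)).clm_apply
    (contDiffAt_const (c := v))).differentiableAt (by simp)
  have hdAB := ((contDiffAt_qInner (hA.smooth x hx) (hB_smooth x hx)).differentiableAt
    (by simp)).hasFDerivAt
  have heq : (fun z => qInner (covEnd Γ A z v) (B z)) =ᶠ[𝓝 x]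
      fun z => 2 * α z v * qInner (A z) (B z) + β z (B z v) := by
    filter_upwards [hU.mem_nhds hx] with z hz using hA.qInner_covEnd hU hz v (hBQ z hz)
  have hfd := congrArg (fun T : E →L[ℝ] ℝ => T u) (heq.fderiv_eq.trans
    (((hdα.const_mul 2).fun_mul hdAB).fun_add
      (hdβ.clm_apply (hasFDerivAt_apply_const hdB v))).fderiv)
  simp only [add_apply, smul_apply, ContinuousLinearMap.flip_apply, smul_eq_mul,
    ContinuousLinearMap.comp_apply, fderiv_qInner (Γ := Γ) hdF hdB, fderiv_qInner (Γ := Γ) hdA hdB,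
    fderiv_apply_eq (Γ := Γ) (A := B) (x := x) u v, map_add, map_sub,
    hA.qInner_covEnd hU hx _ (hBQ x hx),
    hA.qInner_covEnd hU hx _ (hU.covEnd_mem hBQ (hB_smooth x hx) hx u)] at hfd
  rw [covForm_apply]
  linear_combination hfd

lemma covForm_sub_covForm (hx : x ∈ U) (u v : E) {B : E →L[ℝ] E} (hB : B ∈ Q x) :
    (covForm Γ β x u (B v) - 2 * α x u * β x (B v)) -
    (covForm Γ β x v (B u) - 2 * α x v * β x (B u)) =
    qInner (coordCurvature Γ x u v * A x - A x * coordCurvature Γ x u v) B +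
      qInner (A x) B * (-2 * (fderiv ℝ α x u v - fderiv ℝ α x v u)) := by
  rw [← ricci_identity (hU.christoffel_smooth x hx) (hA.smooth x hx), qInner_sub_left,
    hA.qInner_covEnd_covEnd hU hx u v hB, hA.qInner_covEnd_covEnd hU hx v u hB, hU.symm x hx v u]
  ring

lemma fderiv_qNormSq (hx : x ∈ U) (u : E) :
    fderiv ℝ (qNormSq A) x u = 4 * α x u * qNormSq A x + 2 * β x (A x u) := by
  have hdA := (hA.smooth x hx).differentiableAt (by simp)
  rw [show qNormSq A = fun z => qInner (A z) (A z) from rfl, fderiv_qInner (Γ := Γ) hdA hdA,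
    qInner_comm (A x) (covEnd _ _ _ _), hA.qInner_covEnd hU hx u (hA.mem x hx)]
  ring

lemma hessian_qNormSq (hx : x ∈ U) (u v : E) :
    covForm Γ (fderiv ℝ (qNormSq A)) x u v =
    4 * covForm Γ α x u v * qNormSq A x + 4 * α x v * fderiv ℝ (qNormSq A) x u
      + 2 * covForm Γ β x u (A x v) + 2 * β x (covEnd Γ A x u v) := by
  have hdα := hasFDerivAt_apply_const ((hA.form_smooth x hx).differentiableAt (by simp)) v
  have hdβ := ((hA.beta_smooth x hx).differentiableAt (by simp)).hasFDerivAt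
  have hdA := hasFDerivAt_apply_const ((hA.smooth x hx).differentiableAt (by simp)) v
  have hf := contDiffAt_qNormSq (hA.smooth x hx)
  have hdf := (hf.differentiableAt (by simp)).hasFDerivAt
  have heq : (fun z => fderiv ℝ (qNormSq A) z v) =ᶠ[𝓝 x]
      fun z => 4 * α z v * qNormSq A z + 2 * β z (A z v) := by
    filter_upwards [hU.mem_nhds hx] with z hz using hA.fderiv_qNormSq hU hz v
  have hfd := congrArg (fun T : E →L[ℝ] ℝ => T u)
    (((hasFDerivAt_apply_const (differentiableAt_fderiv hf) v).fderiv.symm.trans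
      heq.fderiv_eq).trans
      (((hdα.const_mul 4).fun_mul hdf).fun_add ((hdβ.clm_apply hdA).const_mul 2)).fderiv)
  simp only [add_apply, smul_apply, ContinuousLinearMap.flip_apply, smul_eq_mul,
    ContinuousLinearMap.comp_apply, fderiv_apply_eq (Γ := Γ) (A := A) (x := x) u v, map_add,
    map_sub] at hfd
  rw [covForm_apply, covForm_apply, covForm_apply, hfd, hA.fderiv_qNormSq hU hx (Γ x u v)]
  ring

variable {ι : Type*} [Fintype ι] [DecidableEq ι] {b : Module.Basis ι ℝ E}

lemma sum_covForm (hx : x ∈ U) (hb : IsOrthonormalBasis (g x) b) (hE : 4 < Module.finrank ℝ E) :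
    (Module.finrank ℝ E + 8) * ∑ i, (covForm Γ β x (b i) (A x (b i))
      - 2 * α x (b i) * β x (A x (b i))) =
    -2 * (∑ k, ricciForm (g x) b (coordCurvatureL Γ x) (b k) (b k)) * qNormSq A x := by
  let dα := (fderiv ℝ α x).toLinearMap₁₂
  have htrace := (hU.isQuaternionicCurvature hx).sum_apply_of_mem hb (hU.admissible x hx)
    (hU.skew x hx) (hA.mem x hx)
    (β := (covForm Γ β x).toLinearMap₁₂
      - (2 : ℝ) • LinearMap.smulRight (α x).toLinearMap (β x).toLinearMap)
    (η := (-2 : ℝ) • (dα - dα.flip)) (fun B hB u v => by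
      simpa [mul_assoc, dα, coordCurvatureL_apply] using hA.covForm_sub_covForm hU hx u v hB) hE
  simpa [mul_assoc, qNormSq] using htrace

lemma sum_sq_fderiv_qNormSq (hx : x ∈ U) (hb : IsOrthonormalBasis (g x) b) :
    ∑ i, fderiv ℝ (qNormSq A) x (b i) ^ 2 =
      8 * qNormSq A x * ∑ i, α x (b i) * fderiv ℝ (qNormSq A) x (b i)
      - 16 * qNormSq A x ^ 2 * ∑ i, α x (b i) ^ 2 + 4 * qNormSq A x * ∑ i, β x (b i) ^ 2 := by
  have hAA : A x * A x = (-qNormSq A x) • 1 := by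
    have := (hU.admissible x hx).mul_add_mul (hA.mem x hx) (hA.mem x hx)
    rw [← two_smul ℝ, neg_mul, ← mul_neg, mul_smul] at this
    exact smul_right_injective _ two_ne_zero this
  rw [mul_assoc 4, ← hb.sum_sq_comp (hU.skew x hx _ (hA.mem x hx)) hAA (β x)]
  simp only [Finset.mul_sum, ← Finset.sum_add_distrib, ← Finset.sum_sub_distrib]
  refine Finset.sum_congr rfl fun i _ => ?_
  rw [hA.fderiv_qNormSq hU hx]
  ring

lemma laplacian_qNormSq (hx : x ∈ U) (hb : IsOrthonormalBasis (g x) b) :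
    ∑ i, covForm Γ (fderiv ℝ (qNormSq A)) x (b i) (b i) =
      4 * qNormSq A x * ∑ i, covForm Γ α x (b i) (b i)
      + 8 * ∑ i, α x (b i) * fderiv ℝ (qNormSq A) x (b i)
      - 16 * qNormSq A x * ∑ i, α x (b i) ^ 2
      + 2 * ∑ i, (covForm Γ β x (b i) (A x (b i)) - 2 * α x (b i) * β x (A x (b i)))
      + 6 * ∑ i, β x (b i) ^ 2 := by
  have hβJ (k : Fin 3) : ∑ i, β x (J k x (b i)) ^ 2 = ∑ i, β x (b i) ^ 2 := by
    have hJ := hU.admissible x hx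
    rw [hb.sum_sq_comp (hU.skew x hx _ (hJ.mem k)) (c := 1) (by rw [hJ.sq, neg_one_smul]), one_mul]
  have hsum : 6 * ∑ i, β x (b i) ^ 2 = ∑ i, 2 * ∑ k, β x (J k x (b i)) ^ 2 := by
    rw [← Finset.mul_sum, Finset.sum_comm]
    simp only [hβJ, Fin.sum_univ_three]
    ring
  rw [hsum]
  simp only [Finset.mul_sum, ← Finset.sum_add_distrib, ← Finset.sum_sub_distrib]
  refine Finset.sum_congr rfl fun i _ => ?_
  rw [hA.hessian_qNormSq hU hx, hA.eq x hx, hA.fderiv_qNormSq hU hx]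
  simp only [add_apply, smul_apply, map_add, map_smul, smul_eq_mul, Fin.sum_univ_three]
  ring

lemma bochner (hx : x ∈ U) (hb : IsOrthonormalBasis (g x) b) (hE : 4 < Module.finrank ℝ E)
    (hdiv : ∑ i, covForm Γ α x (b i) (b i) = 0) :
    (Module.finrank ℝ E + 8) * (qNormSq A x *
        (∑ i, covForm Γ (fderiv ℝ (qNormSq A)) x (b i) (b i)
          + 4 * ∑ i, α x (b i) * fderiv ℝ (qNormSq A) x (b i))
      - 8 * (∑ i, α x (b i) ^ 2) * qNormSq A x ^ 2
      - 3 / 2 * ∑ i, fderiv ℝ (qNormSq A) x (b i) ^ 2) =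
    -4 * (∑ k, ricciForm (g x) b (coordCurvatureL Γ x) (b k) (b k)) * qNormSq A x ^ 2 := by
  have htrace := hA.sum_covForm hU hx hb hE
  rw [hA.laplacian_qNormSq hU hx hb, hdiv, hA.sum_sq_fderiv_qNormSq hU hx hb]
  linear_combination 2 * qNormSq A x * htrace

end IsTwistorOn

end Twistor

section MaximumPrinciple

section LocalMax

variable {E : Type*} [NormedAddCommGroup E] [NormedSpace ℝ E] {f g : E → ℝ} {x : E}

lemma deriv_deriv_nonpos_of_isLocalMax {φ : ℝ → ℝ} {t : ℝ} (hφ : ContinuousAt φ t)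
    (hmax : IsLocalMax φ t) : deriv (deriv φ) t ≤ 0 := by
  by_contra! hpos
  -- Otherwise `t` is also a local minimum, so `φ` is constant near `t`.
  have hmin : IsLocalMin φ t := isLocalMin_of_deriv_deriv_pos hpos hmax.deriv_eq_zero hφ
  have hconst : φ =ᶠ[𝓝 t] fun _ => φ t := by
    filter_upwards [hmax, hmin] with s h h' using le_antisymm h h'
  have hderiv : deriv φ =ᶠ[𝓝 t] fun _ => 0 := by
    filter_upwards [hconst.eventuallyEq_nhds] with s hs
    rw [hs.deriv_eq, deriv_const]
  rw [hderiv.deriv_eq, deriv_const] at hpos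
  exact hpos.false

lemma fderiv_fderiv_nonpos_of_isLocalMax (hf : ContDiffAt ℝ 2 f x) (hmax : IsLocalMax f x) (v : E) :
    fderiv ℝ (fderiv ℝ f) x v v ≤ 0 := by
  let line : ℝ → E := fun t => x + t • v
  have hline_zero : line 0 = x := by simp [line]
  have hline (t : ℝ) : HasDerivAt line v t := by
    simpa [line] using ((hasDerivAt_id t).smul_const v).const_add x
  have hline_tendsto : Filter.Tendsto line (𝓝 0) (𝓝 x) := by
    simpa only [hline_zero] using (hline 0).continuousAt.tendsto
  have hf_near : ∀ᶠ y in 𝓝 x, DifferentiableAt ℝ f y :=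
    (hf.eventually (by simp)).mono fun y hy => hy.differentiableAt (by simp)
  have hderiv : deriv (f ∘ line) =ᶠ[𝓝 0] fun t => fderiv ℝ f (line t) v := by
    filter_upwards [hline_tendsto.eventually hf_near] with t ht
    exact (ht.hasFDerivAt.comp_hasDerivAt t (hline t)).deriv
  have hderiv₂ : deriv (deriv (f ∘ line)) 0 = fderiv ℝ (fderiv ℝ f) x v v := by
    have hf' : HasFDerivAt (fderiv ℝ f) (fderiv ℝ (fderiv ℝ f) x) (line 0) := by
      rw [hline_zero]
      exact ((hf.fderiv_right (m := 1) (by norm_num)).differentiableAt (by simp)).hasFDerivAt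
    rw [hderiv.deriv_eq]
    simpa using ((hf'.comp_hasDerivAt 0 (hline 0)).clm_apply (hasDerivAt_const 0 v)).deriv
  rw [← hderiv₂]
  refine deriv_deriv_nonpos_of_isLocalMax
    (ContinuousAt.comp (by rw [hline_zero]; exact hf.continuousAt) (hline 0).continuousAt) ?_
  filter_upwards [hline_tendsto.eventually hmax] with t ht
  simpa only [Function.comp_apply, hline_zero] using ht

variable {ι : Type*} [Fintype ι] {e : ι → E} {b : E}

/-- The second order operator `f ↦ ∑ᵢ f''(eᵢ, eᵢ) + f'(b)` at the point `x`. -/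
def secondOrderOp (e : ι → E) (b : E) (f : E → ℝ) (x : E) : ℝ :=
  ∑ i, fderiv ℝ (fderiv ℝ f) x (e i) (e i) + fderiv ℝ f x b

lemma secondOrderOp_nonpos_of_isLocalMax (hf : ContDiffAt ℝ 2 f x) (hmax : IsLocalMax f x) :
    secondOrderOp e b f x ≤ 0 := by
  rw [secondOrderOp, hmax.fderiv_eq_zero, zero_apply, add_zero]
  exact Finset.sum_nonpos fun i _ => fderiv_fderiv_nonpos_of_isLocalMax hf hmax (e i)

lemma secondOrderOp_add_const_smul (hf : ContDiffAt ℝ 2 f x) (hg : ContDiffAt ℝ 2 g x) (ε : ℝ) :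
    secondOrderOp e b (fun z => f z + ε • g z) x =
      secondOrderOp e b f x + ε * secondOrderOp e b g x := by
  have hdiff {k : E → ℝ} (hk : ContDiffAt ℝ 2 k x) :
      (∀ᶠ z in 𝓝 x, DifferentiableAt ℝ k z) ∧ DifferentiableAt ℝ (fderiv ℝ k) x :=
    ⟨(hk.eventually (by simp)).mono fun z hz => hz.differentiableAt (by simp),
      (hk.fderiv_right (m := 1) (by norm_num)).differentiableAt (by simp)⟩
  obtain ⟨hf_near, hf'⟩ := hdiff hf
  obtain ⟨hg_near, hg'⟩ := hdiff hg
  have hfderiv : fderiv ℝ (fun z => f z + ε • g z) =ᶠ[𝓝 x]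
      fun z => fderiv ℝ f z + ε • fderiv ℝ g z := by
    filter_upwards [hf_near, hg_near] with z hfz hgz
    rw [fderiv_fun_add hfz (hgz.fun_const_smul ε), fderiv_fun_const_smul hgz]
  rw [secondOrderOp, hfderiv.fderiv_eq, hfderiv.self_of_nhds,
    fderiv_fun_add hf' (hg'.fun_const_smul ε), fderiv_fun_const_smul hg']
  simp only [add_apply, smul_apply, smul_eq_mul, Finset.sum_add_distrib, ← Finset.mul_sum,
    secondOrderOp]
  ring

end LocalMax

section Barrier

variable {E : Type*} [NormedAddCommGroup E]

/-- The barrier function `exp (-l ‖x - q‖²)` of the strong maximum principle. -/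
def barrier (l : ℝ) (q x : E) : ℝ := Real.exp (-(l * ‖x - q‖ ^ 2))

lemma barrier_pos (l : ℝ) (q x : E) : 0 < barrier l q x := Real.exp_pos _

lemma barrier_le_one {l : ℝ} (hl : 0 ≤ l) (q x : E) : barrier l q x ≤ 1 := by
  rw [barrier, Real.exp_le_one_iff, neg_nonpos]
  positivity

lemma barrier_lt_barrier {l : ℝ} (hl : 0 < l) {q x y : E} (h : ‖x - q‖ < ‖y - q‖) :
    barrier l q y < barrier l q x := by
  unfold barrier
  gcongr

end Barrier

variable {E : Type*} [NormedAddCommGroup E] [InnerProductSpace ℝ E]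

lemma contDiff_barrier (l : ℝ) (q : E) {k : ℕ∞ω} : ContDiff ℝ k (barrier l q) :=
  Real.contDiff_exp.comp (contDiff_const.mul ((contDiff_id.sub contDiff_const).norm_sq ℝ)).neg

lemma hasFDerivAt_barrier (l : ℝ) (q x : E) :
    HasFDerivAt (barrier l q) ((-2 * l * barrier l q x) • innerSL ℝ (x - q)) x := by
  have hnorm : HasFDerivAt (fun x : E => ‖x - q‖ ^ 2) (2 • innerSL ℝ (x - q)) x :=
    ((hasFDerivAt_id x).sub_const q).norm_sq
  refine (hnorm.const_mul l).fun_neg.exp.congr_fderiv ?_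
  rw [barrier, two_nsmul]
  module

lemma fderiv_barrier (l : ℝ) (q x v : E) :
    fderiv ℝ (barrier l q) x v = -2 * l * barrier l q x * inner ℝ (x - q) v := by
  rw [(hasFDerivAt_barrier l q x).fderiv, smul_apply, innerSL_apply_apply, smul_eq_mul]

lemma fderiv_fderiv_barrier (l : ℝ) (q x u v : E) :
    fderiv ℝ (fderiv ℝ (barrier l q)) x u v = barrier l q x *
      (4 * l ^ 2 * inner ℝ (x - q) u * inner ℝ (x - q) v - 2 * l * inner ℝ u v) := by
  have hsecond := (hasFDerivAt_apply_const
    (differentiableAt_fderiv (contDiff_barrier l q).contDiffAt) v).fderiv (𝕜 := ℝ) (x := x)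
  have hproduct := (((hasFDerivAt_barrier l q x).const_mul (-2 * l)).fun_mul
    (((hasFDerivAt_id x).sub_const q).inner ℝ (hasFDerivAt_const v x))).fderiv
  simp_rw [fderiv_barrier] at hsecond
  have hfd := congrArg (fun T : E →L[ℝ] ℝ => T u) (hsecond.symm.trans hproduct)
  simp only [ContinuousLinearMap.flip_apply, neg_mul, id_eq, neg_smul, map_sub, smul_neg, neg_neg,
    add_apply, neg_apply, smul_apply, ContinuousLinearMap.comp_apply,
    ContinuousLinearMap.prod_apply, ContinuousLinearMap.id_apply, zero_apply,
    fderivInnerCLM_apply, inner_zero_right, zero_add, smul_eq_mul, sub_apply,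
    coe_innerSL_apply] at hfd
  rw [hfd, inner_sub_left x q u]
  ring

variable {ι : Type*} [Fintype ι]

lemma secondOrderOp_barrier (e : ι → E) (b : E) (l : ℝ) (q x : E) :
    secondOrderOp e b (barrier l q) x = barrier l q x * (l * (4 * l *
      ∑ i, inner ℝ (x - q) (e i) ^ 2 - 2 * ∑ i, ‖e i‖ ^ 2 - 2 * inner ℝ (x - q) b)) := by
  simp_rw [secondOrderOp, fderiv_fderiv_barrier, fderiv_barrier, ← Finset.mul_sum,
    Finset.sum_sub_distrib, mul_assoc, ← Finset.mul_sum, ← sq, real_inner_self_eq_norm_sq]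
  ring

/-- The operator `secondOrderOp e b` has ellipticity constant `c` and coefficients bounded by
`C`. -/
structure IsEllipticWith (c C : ℝ) (e : ι → E) (b : E) : Prop where
  norm_le : ∀ i, ‖e i‖ ≤ C
  norm_drift_le : ‖b‖ ≤ C
  le_sum : ∀ v, c * ‖v‖ ^ 2 ≤ ∑ i, inner ℝ v (e i) ^ 2

lemma exists_secondOrderOp_barrier_pos {c C δ R : ℝ} (hc : 0 < c) (hC : 0 ≤ C) (hδ : 0 < δ)
    (hR : 0 ≤ R) : ∃ l > 0, ∀ (q x : E) (e : ι → E) (b : E), IsEllipticWith c C e b →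
      δ ≤ ‖x - q‖ → ‖x - q‖ ≤ R → 0 < secondOrderOp e b (barrier l q) x := by
  refine ⟨(Fintype.card ι * C ^ 2 + R * C + 1) / (c * δ ^ 2), by positivity,
    fun q x e b h hδx hxR => ?_⟩
  set l := (Fintype.card ι * C ^ 2 + R * C + 1) / (c * δ ^ 2)
  have hl : 0 < l := by positivity
  have hleading : Fintype.card ι * C ^ 2 + R * C + 1 ≤ l * ∑ i, inner ℝ (x - q) (e i) ^ 2 :=
    calc Fintype.card ι * C ^ 2 + R * C + 1 = l * (c * δ ^ 2) := by simp only [l]; field_simp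
      _ ≤ l * (c * ‖x - q‖ ^ 2) := by gcongr
      _ ≤ _ := by gcongr; exact h.le_sum _
  have hdiag : ∑ i, ‖e i‖ ^ 2 ≤ Fintype.card ι * C ^ 2 := by
    calc ∑ i, ‖e i‖ ^ 2 ≤ ∑ _i : ι, C ^ 2 := by
          gcongr with i
          exact h.norm_le i
      _ = _ := by simp
  have hdrift : inner ℝ (x - q) b ≤ R * C :=
    (real_inner_le_norm _ _).trans (by gcongr; exact h.norm_drift_le)
  have hcard : 0 ≤ Fintype.card ι * C ^ 2 := by positivity
  have hRC : 0 ≤ R * C := by positivity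
  rw [secondOrderOp_barrier]
  exact mul_pos (barrier_pos _ _ _) (mul_pos hl (by linarith))

variable [FiniteDimensional ℝ E] {f : E → ℝ} {U : Set E} {p q : E} {m c C δ R : ℝ}

/-- Hopf's comparison on an annulus: adding a small multiple of a barrier centred at `q` to `f`
would produce an interior maximum. -/
lemma lt_of_secondOrderOp_nonneg_annulus (hc : 0 < c) (hC : 0 ≤ C) (hδ : 0 < δ)
    (hRU : Metric.closedBall q R ⊆ U) (hf : ∀ x ∈ U, ContDiffAt ℝ 2 f x) (hle : ∀ x ∈ U, f x ≤ m)
    (h : ∀ x ∈ U, ∃ (e : ι → E) (b : E), IsEllipticWith c C e b ∧ 0 ≤ secondOrderOp e b f x)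
    (hlt : ∀ x ∈ Metric.closedBall q δ, f x < m) (hp : ‖p - q‖ < R) : f p < m := by
  by_contra! hfp
  have hR : 0 < R := (norm_nonneg _).trans_lt hp
  have hδp : δ < ‖p - q‖ := by
    by_contra! hpδ
    exact (hlt p (mem_closedBall_iff_norm.2 hpδ)).not_ge hfp
  obtain ⟨l, hl, hbarrier⟩ := exists_secondOrderOp_barrier_pos (E := E) (ι := ι) hc hC hδ hR.le
  have hf_cont : ContinuousOn f U := fun x hx => (hf x hx).continuousAt.continuousWithinAt
  obtain ⟨ε, hε, hgap⟩ : ∃ ε > 0, ∀ x ∈ Metric.closedBall q δ, f x + ε ≤ m := by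
    have hsub : Metric.closedBall q δ ⊆ U :=
      (Metric.closedBall_subset_closedBall (hδp.trans hp).le).trans hRU
    obtain ⟨y, hy, hmax⟩ := (isCompact_closedBall q δ).exists_isMaxOn
      ⟨q, Metric.mem_closedBall_self hδ.le⟩ (hf_cont.mono hsub)
    exact ⟨m - f y, sub_pos.2 (hlt y hy), fun x hx => by linarith [isMaxOn_iff.1 hmax x hx]⟩
  let F : E → ℝ := fun x => f x + ε • barrier l q x
  obtain ⟨z, hz, hzmax⟩ := (isCompact_closedBall q R).exists_isMaxOn
    ⟨p, mem_closedBall_iff_norm.2 hp.le⟩ ((hf_cont.mono hRU).add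
      ((contDiff_barrier l q (k := 0)).continuous.continuousOn.const_smul ε) : ContinuousOn F _)
  have hzU := hRU hz
  have hpz : m + ε * barrier l q p ≤ F z :=
    (add_le_add_left hfp _).trans (isMaxOn_iff.1 hzmax p (mem_closedBall_iff_norm.2 hp.le))
  have hδz : δ < ‖z - q‖ := by
    by_contra! hzδ
    have hfz := hgap z (mem_closedBall_iff_norm.2 hzδ)
    nlinarith [barrier_le_one hl.le q z, mul_pos hε (barrier_pos l q p),
      smul_eq_mul ε (barrier l q z)]
  have hzR : ‖z - q‖ < R := by
    refine (mem_closedBall_iff_norm.1 hz).lt_of_ne fun hzR => hpz.not_gt ?_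
    have := mul_lt_mul_of_pos_left (barrier_lt_barrier hl (hzR ▸ hp)) hε
    exact add_lt_add_of_le_of_lt (hle z hzU) this
  have hlocal : IsLocalMax F z := hzmax.isLocalMax (Filter.mem_of_superset
    (Metric.isOpen_ball.mem_nhds (mem_ball_iff_norm.2 hzR)) Metric.ball_subset_closedBall)
  obtain ⟨e, b, helliptic, hsub⟩ := h z hzU
  have hbs : ContDiffAt ℝ 2 (barrier l q) z := (contDiff_barrier l q).contDiffAt
  have hnonpos := secondOrderOp_nonpos_of_isLocalMax (e := e) (b := b)
    ((hf z hzU).add (hbs.const_smul ε)) hlocal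
  rw [secondOrderOp_add_const_smul (hf z hzU) hbs] at hnonpos
  linarith [mul_pos hε (hbarrier q z e b helliptic hδz.le hzR.le)]

/-- The strong maximum principle of Hopf. -/
theorem eventually_eq_of_secondOrderOp_nonneg (hU : U ∈ 𝓝 p) (hc : 0 < c) (hC : 0 ≤ C)
    (hf : ∀ x ∈ U, ContDiffAt ℝ 2 f x) (hle : ∀ x ∈ U, f x ≤ f p)
    (h : ∀ x ∈ U, ∃ (e : ι → E) (b : E), IsEllipticWith c C e b ∧ 0 ≤ secondOrderOp e b f x) :
    ∀ᶠ x in 𝓝 p, f x = f p := by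
  obtain ⟨R, hR, hRU⟩ := Metric.nhds_basis_closedBall.mem_iff.1 hU
  filter_upwards [Metric.ball_mem_nhds p (half_pos hR)] with q hq
  have hqU : Metric.closedBall q (R / 2) ⊆ U :=
    (Metric.closedBall_subset_closedBall' (by linarith [Metric.mem_ball.1 hq])).trans hRU
  have hq_mem := hqU (Metric.mem_closedBall_self (half_pos hR).le)
  refine (hle q hq_mem).antisymm (not_lt.1 fun hlt => ?_)
  obtain ⟨δ, hδ, hδlt⟩ := Metric.nhds_basis_closedBall.mem_iff.1
    ((hf q hq_mem).continuousAt.eventually_lt_const hlt)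
  exact (lt_of_secondOrderOp_nonneg_annulus hc hC hδ hqU hf hle h hδlt
    (by rwa [← mem_ball_iff_norm, Metric.mem_ball_comm])).false

end MaximumPrinciple

section PenroseAlgebra

variable {V : Type*} [AddCommGroup V] [Module ℝ V] [TopologicalSpace V]
  [IsTopologicalAddGroup V] [ContinuousSMul ℝ V]
  {Q : Submodule ℝ (V →L[ℝ] V)} {J : Fin 3 → V →L[ℝ] V}

namespace IsAdmissibleBasis

lemma commute_smulRight_sub_sum (h : IsAdmissibleBasis Q J) {A : V →L[ℝ] V} (hA : A ∈ Q)
    (a : V →L[ℝ] ℝ) (X : V) :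
    Commute (a.smulRight X - ∑ i, (a ∘L J i).smulRight (J i X)) A := by
  have hmul {i j l : Fin 3} (e : J i * J j = J l) (Z : V) : J i (J j Z) = J l Z :=
    congrArg (fun T : V →L[ℝ] V => T Z) e
  have hmul_neg {i j l : Fin 3} (e : J i * J j = -J l) (Z : V) : J i (J j Z) = -J l Z :=
    congrArg (fun T : V →L[ℝ] V => T Z) e
  have hJ (k : Fin 3) : Commute (a.smulRight X - ∑ i, (a ∘L J i).smulRight (J i X)) (J k) := by
    ext Z
    simp only [sum_fin_three_eq _ k, mul_apply_eq_comp, sub_apply, add_apply,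
      ContinuousLinearMap.smulRight_apply, ContinuousLinearMap.comp_apply, map_sub, map_add,
      map_smul, map_neg, h.apply_apply_self, hmul_neg (h.add_one_mul k), hmul (h.add_two_mul k),
      hmul (h.mul_add_one k), hmul_neg (h.mul_add_two k)]
    module
  rw [h.span, Submodule.mem_span_range_iff_exists_fun] at hA
  obtain ⟨c, rfl⟩ := hA
  exact Commute.sum_right _ _ _ fun k _ => (hJ k).smul_right (c k)

lemma sum_smul_commutator (h : IsAdmissibleBasis Q J) {A : V →L[ℝ] V} (hA : A ∈ Q)
    (a : V →L[ℝ] ℝ) (X : V) :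
    ∑ i, a (J i X) • (J i * A - A * J i) = (2 * a X) • A + ∑ i, (2 * a (A (J i X))) • J i := by
  rw [h.span] at hA
  induction hA using Submodule.span_induction with
  | mem A hA =>
    obtain ⟨k, rfl⟩ := hA
    have hpred (Z : V) : J k (J (k + 1) Z) = J (k + 2) Z :=
      congrArg (fun T : V →L[ℝ] V => T Z) (h.mul_add_one k)
    have hsucc (Z : V) : J k (J (k + 2) Z) = -J (k + 1) Z :=
      congrArg (fun T : V →L[ℝ] V => T Z) (h.mul_add_two k)
    rw [sum_fin_three_eq _ k, sum_fin_three_eq _ k, h.mul_add_one, h.mul_add_two, h.add_one_mul,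
      h.add_two_mul, h.apply_apply_self, hpred, hsucc, map_neg, map_neg]
    module
  | zero => simp
  | add A B _ _ hA hB =>
    simp only [mul_add, add_mul, add_sub_add_comm, smul_add, Finset.sum_add_distrib, hA, hB,
      add_apply, map_add, add_smul]
    abel
  | smul c A _ hA =>
    simp only [mul_smul_comm, smul_mul_assoc, ← smul_sub, smul_comm _ c, ← Finset.smul_sum, hA,
      smul_apply, map_smul, smul_eq_mul, mul_left_comm _ c, smul_add, mul_smul]

lemma sTensor_commutator (h : IsAdmissibleBasis Q J) {A : V →L[ℝ] V} (hA : A ∈ Q)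
    (a : V →L[ℝ] ℝ) (X : V) :
    sTensor J a X * A - A * sTensor J a X =
      -((2 * a X) • A + ∑ i, (2 * a (A (J i X))) • J i) := by
  have hS : sTensor J a X = a X • 1 - ∑ i, a (J i X) • J i +
      (a.smulRight X - ∑ i, (a ∘L J i).smulRight (J i X)) := by
    rw [sTensor, Finset.sum_add_distrib]
    abel
  rw [hS, add_mul, mul_add, (h.commute_smulRight_sub_sum hA a X).eq, add_sub_add_right_eq_sub,
    ← h.sum_smul_commutator hA, sub_mul, mul_sub, smul_one_mul, mul_smul_one,
    sub_sub_sub_cancel_left, Finset.sum_mul, Finset.mul_sum, ← Finset.sum_sub_distrib,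
    ← Finset.sum_neg_distrib]
  refine Finset.sum_congr rfl fun i _ => ?_
  rw [smul_mul_assoc, mul_smul_comm, ← smul_sub, ← smul_neg, neg_sub]

variable [FiniteDimensional ℝ V] [Nontrivial V]

lemma qInner_self_eq_sum_sq (h : IsAdmissibleBasis Q J) {A : V →L[ℝ] V} (hA : A ∈ Q) :
    qInner A A = ∑ i, qInner A (J i) ^ 2 := by
  conv_lhs => enter [1]; rw [h.eq_sum hA]
  rw [qInner_sum_left]
  exact Finset.sum_congr rfl fun i _ => by rw [qInner_comm (J i), pow_two]

lemma qInner_self_nonneg (h : IsAdmissibleBasis Q J) {A : V →L[ℝ] V} (hA : A ∈ Q) :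
    0 ≤ qInner A A := by
  rw [h.qInner_self_eq_sum_sq hA]; positivity

lemma eq_zero_of_qInner_self (h : IsAdmissibleBasis Q J) {A : V →L[ℝ] V} (hA : A ∈ Q)
    (h0 : qInner A A = 0) : A = 0 := by
  rw [h.qInner_self_eq_sum_sq hA, Finset.sum_eq_zero_iff_of_nonneg fun i _ => sq_nonneg _] at h0
  rw [h.eq_sum hA]
  exact Finset.sum_eq_zero fun i hi => by rw [pow_eq_zero_iff two_ne_zero |>.1 (h0 i hi), zero_smul]

end IsAdmissibleBasis

end PenroseAlgebra

section Conjugation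

variable {V : Type*} [AddCommGroup V] [Module ℝ V] [TopologicalSpace V]
  [IsTopologicalAddGroup V] [ContinuousSMul ℝ V]
  {Q : Submodule ℝ (V →L[ℝ] V)} {J : Fin 3 → V →L[ℝ] V}
  {W : Type*} [AddCommGroup W] [Module ℝ W] [TopologicalSpace W]
  [IsTopologicalAddGroup W] [ContinuousSMul ℝ W]

/-- The map `T ↦ a ∘ T ∘ b` on endomorphisms: conjugation by `a` when `b` is the inverse of `a`. -/
def conjL (a : V →L[ℝ] W) (b : W →L[ℝ] V) : (V →L[ℝ] V) →ₗ[ℝ] (W →L[ℝ] W) where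
  toFun T := a ∘L T ∘L b
  map_add' T T' := by ext; simp
  map_smul' c T := by ext; simp

variable {a : V →L[ℝ] W} {b : W →L[ℝ] V}

lemma conjL_apply (T : V →L[ℝ] V) (w : W) : conjL a b T w = a (T (b w)) := rfl

lemma conjL_mul (hba : Function.LeftInverse b a) (S T : V →L[ℝ] V) :
    conjL a b (S * T) = conjL a b S * conjL a b T := by
  ext w
  simp only [conjL_apply, mul_apply_eq_comp, hba (T (b w))]

lemma qInner_conjL (hba : Function.LeftInverse b a) (hab : Function.RightInverse b a)
    (S T : V →L[ℝ] V) : qInner (conjL a b S) (conjL a b T) = qInner S T := by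
  let e : V ≃ₗ[ℝ] W := { (a : V →ₗ[ℝ] W) with invFun := b, left_inv := hba, right_inv := hab }
  have h : ((conjL a b S * conjL a b T : W →L[ℝ] W) : W →ₗ[ℝ] W) =
      e.conj ((S * T : V →L[ℝ] V) : V →ₗ[ℝ] V) := by
    rw [← conjL_mul hba]; rfl
  rw [qInner, qInner, h, LinearMap.trace_conj', e.finrank_eq]

lemma IsAdmissibleBasis.map_conjL (h : IsAdmissibleBasis Q J) (hba : Function.LeftInverse b a)
    (hab : Function.RightInverse b a) :
    IsAdmissibleBasis (Q.map (conjL a b)) fun i => conjL a b (J i) where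
  sq i := by
    rw [← conjL_mul hba, h.sq]
    ext w
    simp [conjL_apply, hab w]
  mul := by rw [← conjL_mul hba, h.mul]
  span := by
    rw [h.span, Submodule.map_span, ← Set.range_comp]; rfl

end Conjugation

section TwistorEquation

variable {E : Type*} [NormedAddCommGroup E] [NormedSpace ℝ E] [FiniteDimensional ℝ E]
  {H : Type*} [TopologicalSpace H] {I : ModelWithCorners ℝ E H}
  {M : Type*} [TopologicalSpace M] [ChartedSpace H M] [IsManifold I ∞ M]
  {Q : AlmostQuaternionicStructure I M} {D' D : Connection I M} {α : OneForm I M}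

namespace AlmostQuaternionicStructure

lemma IsShift.onEnd_eq (h : Q.IsShift D' D α) (A : EndField I M) (x : M) (X : TangentSpace I x) :
    D'.onEnd A x X = D.onEnd A x X + (Q.S x (α x) X * A x - A x * Q.S x (α x) X) := by
  ext Y
  have hY : MDiffAt (T% (FiberBundle.extend E Y)) x := FiberBundle.mdifferentiableAt_extend ..
  have honEnd (D : Connection I M) : D.onEnd A x X Y =
      D (fun y => A y (FiberBundle.extend E Y y)) x X - A x (D (FiberBundle.extend E Y) x X) :=
    TensorialAt.mkHom_apply_eq_extend ..
  rw [add_apply, honEnd, honEnd, h x _ (A.mdifferentiableAt_apply hY), h x _ hY]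
  simp only [FiberBundle.extend_apply_self, map_add, sub_apply, mul_apply_eq_comp]
  abel

lemma exists_onEnd_eq_of_penrose_eq_zero [Nontrivial E] (h : Q.IsShift D' D α)
    (hD' : Q.IsQuaternionicConnection D') {A : Q.Sections} {x : M} (hA : hD'.penrose A x = 0)
    {J : Fin 3 → TangentSpace I x →L[ℝ] TangentSpace I x} (hJ : IsAdmissibleBasis (Q.fiber x) J) :
    ∃ β : TangentSpace I x →L[ℝ] ℝ, ∀ X, D.onEnd A.1 x X =
      (2 * (α x X : ℝ)) • A.1 x + ∑ i, β (J i X) • J i := by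
  have : Nontrivial (TangentSpace I x) := inferInstanceAs (Nontrivial E)
  have : T2Space (TangentSpace I x) := inferInstanceAs (T2Space E)
  obtain ⟨β, hβ⟩ := (hJ.mem_partEH_iff _).1 ((Submodule.projectionOnto_apply_eq_zero_iff _).1 hA)
  refine ⟨β.toContinuousLinearMap + (2 : ℝ) • ((α x : TangentSpace I x →L[ℝ] ℝ) ∘L A.1 x),
    fun X => ?_⟩
  have hD'A : D'.onEnd A.1 x X = ∑ i, β (J i X) • J i :=
    (congrArg Subtype.val (LinearMap.congr_fun hβ X)).trans (hJ.coe_embed β X)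
  rw [h.onEnd_eq, Q.S_eq hJ, hJ.sTensor_commutator (A.2 x), ← sub_eq_add_neg,
    sub_eq_iff_eq_add'] at hD'A
  rw [hD'A, add_assoc, ← Finset.sum_add_distrib]
  congr 1
  refine Finset.sum_congr rfl fun i _ => ?_
  rw [← add_smul, add_comm]
  rfl

end AlmostQuaternionicStructure

end TwistorEquation

section ChartData

variable {E : Type*} [NormedAddCommGroup E] [NormedSpace ℝ E] [FiniteDimensional ℝ E]
  {H : Type*} [TopologicalSpace H] {I : ModelWithCorners ℝ E H} [I.Boundaryless]
  {M : Type*} [TopologicalSpace M] [ChartedSpace H M] [IsManifold I ∞ M] {p : M} {x : E}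

/-- The coordinate expression of an almost quaternionic structure in the chart at `p`. -/
def quatRep (p : M) (Q : AlmostQuaternionicStructure I M) (x : E) : Submodule ℝ (E →L[ℝ] E) :=
  (Q.fiber (chartPt I p x)).map (conjL (toCoord I p (chartPt I p x)) (ofCoord I p (chartPt I p x)))

omit [FiniteDimensional ℝ E] [I.Boundaryless] in
lemma endRep_eq_conjL (A : (y : M) → TangentSpace I y →L[ℝ] TangentSpace I y) :
    endRep p A x =
      conjL (toCoord I p (chartPt I p x)) (ofCoord I p (chartPt I p x)) (A (chartPt I p x)) := rfl

omit [FiniteDimensional ℝ E] [I.Boundaryless] in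
lemma qNormSq_endRep (hx : x ∈ (extChartAt I p).target)
    (A : (y : M) → TangentSpace I y →L[ℝ] TangentSpace I y) :
    qNormSq (endRep p A) x = qInner (A (chartPt I p x)) (A (chartPt I p x)) :=
  qInner_conjL (ofCoord_toCoord (chartPt_mem_source hx)) (toCoord_ofCoord (chartPt_mem_source hx))
    _ _

omit [FiniteDimensional ℝ E] [I.Boundaryless] in
lemma qInner_self_eq_qNormSq (A : (y : M) → TangentSpace I y →L[ℝ] TangentSpace I y) {y : M}
    (hy : y ∈ (extChartAt I p).source) :
    qInner (A y) (A y) = qNormSq (endRep p A) (extChartAt I p y) := by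
  rw [qNormSq_endRep ((extChartAt I p).map_source hy), chartPt, (extChartAt I p).left_inv hy]

lemma contDiffAt_qNormSq_endRep (hx : x ∈ (extChartAt I p).target) (A : EndField I M) :
    ContDiffAt ℝ ∞ (qNormSq (endRep p A)) x :=
  contDiffAt_qNormSq (contDiffAt_endRep hx A.contMDiff.contMDiffAt)

lemma continuous_qInner_self (A : EndField I M) : Continuous fun y => qInner (A y) (A y) := by
  refine continuous_iff_continuousAt.2 fun p => ?_
  have hcomp : ContinuousAt (fun y => qNormSq (endRep p A) (extChartAt I p y)) p :=
    (contDiffAt_qNormSq_endRep (mem_extChartAt_target p) A).continuousAt.comp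
      (continuousAt_extChartAt p)
  refine hcomp.congr ?_
  filter_upwards [extChartAt_source_mem_nhds (I := I) p] with y hy
  exact (qInner_self_eq_qNormSq A hy).symm

lemma covEnd_endRep (D : Connection I M) (hx : x ∈ (extChartAt I p).target)
    (A : EndField I M) (u : E) :
    covEnd (christoffel D p) (endRep p A) x u =
      conjL (toCoord I p (chartPt I p x)) (ofCoord I p (chartPt I p x))
        (D.onEnd A (chartPt I p x) (ofCoord I p _ u)) := by
  ext w
  rw [conjL_apply, toCoord_onEnd D hx, toCoord_ofCoord (chartPt_mem_source hx),
    toCoord_ofCoord (chartPt_mem_source hx), covEnd_apply]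

variable [T2Space M]

lemma covEnd_endRep_mem {Q : AlmostQuaternionicStructure I M} {D : Connection I M}
    (hD : Q.IsQuaternionicConnection D) (hx : x ∈ (extChartAt I p).target) {s : Set M}
    (hs : s ∈ 𝓝 (chartPt I p x)) {A : (y : M) → TangentSpace I y →L[ℝ] TangentSpace I y}
    (hA : ContMDiffOn I (I.prod 𝓘(ℝ, E →L[ℝ] E)) ∞
        (fun x => TotalSpace.mk' (E →L[ℝ] E)
          (E := fun x : M => TangentSpace I x →L[ℝ] TangentSpace I x) x (A x)) s)
    (hAQ : ∀ y ∈ s, A y ∈ Q.fiber y) (u : E) :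
    covEnd (christoffel D p) (endRep p A) x u ∈ quatRep p Q x := by
  -- The section is only local, so it is cut off before `D` is applied to it.
  obtain ⟨ψ, hψ, hψ_one, hψ_zero⟩ := exists_contMDiff_smul
    (V := fun x : M => TangentSpace I x →L[ℝ] TangentSpace I x) hs hA
  let S : EndField I M := ⟨ψ • A, hψ⟩
  have hS (y) : S y ∈ Q.fiber y := by
    change ψ y • A y ∈ _
    by_cases hy : y ∈ s
    · exact Submodule.smul_mem _ _ (hAQ y hy)
    · rw [hψ_zero y hy, zero_smul]; exact Submodule.zero_mem _
  have hAS : endRep p A =ᶠ[𝓝 x] endRep p S := by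
    filter_upwards [eventually_chartPt hx hψ_one] with z hz
    have hSA : S (chartPt I p z) = A (chartPt I p z) := by
      change ψ _ • A _ = _
      rw [hz, one_smul]
    rw [endRep_eq_conjL, endRep_eq_conjL, hSA]
  rw [covEnd_congr hAS, covEnd_endRep D hx]
  exact Submodule.mem_map_of_mem (hD.preserves ⟨S, hS⟩ _ _)

variable [RiemannianBundle (fun x : M => TangentSpace I x)]

omit [FiniteDimensional ℝ E] [T2Space M] [I.Boundaryless] in
lemma metricRep_skew (hx : x ∈ (extChartAt I p).target)
    {C : TangentSpace I (chartPt I p x) →L[ℝ] TangentSpace I (chartPt I p x)}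
    (hC : ∀ X Y, inner ℝ (C X) Y = -inner ℝ X (C Y)) (u v : E) :
    metricRep I p x (conjL (toCoord I p (chartPt I p x)) (ofCoord I p (chartPt I p x)) C u) v =
      -metricRep I p x u
        (conjL (toCoord I p (chartPt I p x)) (ofCoord I p (chartPt I p x)) C v) := by
  have hy := chartPt_mem_source hx
  obtain ⟨X, rfl⟩ : ∃ X, toCoord I p (chartPt I p x) X = u := ⟨_, toCoord_ofCoord hy u⟩
  obtain ⟨Y, rfl⟩ : ∃ X, toCoord I p (chartPt I p x) X = v := ⟨_, toCoord_ofCoord hy v⟩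
  rw [conjL_apply, conjL_apply, ofCoord_toCoord hy, ofCoord_toCoord hy,
    metricRep_toCoord hx, metricRep_toCoord hx, hC]

variable [IsContMDiffRiemannianBundle I ∞ E (fun x : M => TangentSpace I x)]

theorem exists_isQuaternionicKahlerOn {Q : AlmostQuaternionicStructure I M} {D : Connection I M}
    (hD : Q.IsQuaternionicKahler D) (p : M) :
    ∃ U, extChartAt I p p ∈ U ∧ U ⊆ (extChartAt I p).target ∧
      ∃ J : Fin 3 → (y : M) → (TangentSpace I y →L[ℝ] TangentSpace I y),
        (∀ x ∈ U, IsAdmissibleBasis (Q.fiber (chartPt I p x)) fun i => J i (chartPt I p x)) ∧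
        IsQuaternionicKahlerOn U (christoffel D p) (metricRep I p) (quatRep p Q)
          (fun i => endRep p (J i)) := by
  obtain ⟨s, hs, J, hJs, hJ⟩ := Q.exists_frame p
  have hc : ContinuousOn (chartPt I p) (extChartAt I p).target := continuousOn_extChartAt_symm p
  have hmem (x) (hx : x ∈ (extChartAt I p).target ∩ chartPt I p ⁻¹' interior s) :
      s ∈ 𝓝 (chartPt I p x) := mem_interior_iff_mem_nhds.1 hx.2
  refine ⟨(extChartAt I p).target ∩ chartPt I p ⁻¹' interior s, ⟨mem_extChartAt_target p, ?_⟩,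
    Set.inter_subset_left, J, fun x hx => hJ _ (interior_subset hx.2),
    { isOpen := hc.isOpen_inter_preimage (isOpen_extChartAt_target p) isOpen_interior
      christoffel_smooth := fun x hx => contDiffAt_christoffel hD.quaternionic.smooth hx.1
      metric_smooth := fun x hx => contDiffAt_metricRep hx.1
      frame_smooth := fun i x hx => contDiffAt_endRep hx.1 ((hJs i).contMDiffAt (hmem x hx))
      symm := fun x hx => christoffel_symm hD.quaternionic.torsionFree hx.1
      metric := fun x hx => fderiv_metricRep hD.leviCivita hx.1
      admissible := fun x hx => (hJ _ (interior_subset hx.2)).map_conjL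
        (ofCoord_toCoord (chartPt_mem_source hx.1)) (toCoord_ofCoord (chartPt_mem_source hx.1))
      covEnd_frame_mem := fun x hx i => covEnd_endRep_mem hD.quaternionic hx.1 (hmem x hx)
        (hJs i) fun y hy => (hJ y hy).mem i
      skew := ?_ }⟩
  · rw [Set.mem_preimage, chartPt, extChartAt_to_inv]
    exact mem_interior_iff_mem_nhds.2 hs
  · rintro x hx _ ⟨C, hC, rfl⟩ u v
    exact metricRep_skew hx.1 (hD.skew _ C hC) u v

omit [T2Space M] [IsContMDiffRiemannianBundle I ∞ E (fun x : M => TangentSpace I x)] in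
lemma exists_isTwistorOn_endRep [Nontrivial E] {Q : AlmostQuaternionicStructure I M}
    {D D' : Connection I M} {α : OneForm I M} (h : Q.IsShift D' D α)
    (hD' : Q.IsQuaternionicConnection D') (A : Q.Sections) (hA : ∀ x, hD'.penrose A x = 0)
    {p : M} {U : Set E} (hUt : U ⊆ (extChartAt I p).target)
    {J : Fin 3 → (y : M) → (TangentSpace I y →L[ℝ] TangentSpace I y)}
    (hJ : ∀ x ∈ U, IsAdmissibleBasis (Q.fiber (chartPt I p x)) fun i => J i (chartPt I p x))
    (hU : IsQuaternionicKahlerOn U (christoffel D p) (metricRep I p) (quatRep p Q)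
      (fun i => endRep p (J i))) :
    ∃ β, IsTwistorOn U (christoffel D p) (quatRep p Q) (fun i => endRep p (J i))
      (formRep p fun y => α y) (endRep p A.1) β := by
  refine exists_isTwistorOn hU (fun z hz => contDiffAt_formRep (hUt hz) α)
    (fun z hz => contDiffAt_endRep (hUt hz) A.1.contMDiff.contMDiffAt)
    (fun _ _ => Submodule.mem_map_of_mem (A.2 _)) fun z hz => ?_
  obtain ⟨β, hβ⟩ := AlmostQuaternionicStructure.exists_onEnd_eq_of_penrose_eq_zero h hD' (hA _)
    (hJ z hz)
  have hy := chartPt_mem_source (hUt hz)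
  refine ⟨β ∘L ofCoord I p (chartPt I p z), fun u => ?_⟩
  rw [covEnd_endRep D (hUt hz), hβ, map_add, map_smul, map_sum]
  congr 1
  refine Finset.sum_congr rfl fun i _ => ?_
  rw [map_smul, ContinuousLinearMap.comp_apply]
  congr 2
  exact (ofCoord_toCoord hy _).symm

end ChartData

section OrthonormalFrame

variable {E : Type*} [NormedAddCommGroup E] [NormedSpace ℝ E] [FiniteDimensional ℝ E]
  {H : Type*} [TopologicalSpace H] {I : ModelWithCorners ℝ E H}
  {M : Type*} [TopologicalSpace M] [ChartedSpace H M] [IsManifold I ∞ M] {p : M} {x : E}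

/-- The chart at `p` as a linear isomorphism of the tangent space at the point with coordinates `x`
onto the model space. -/
def coordEquiv (hx : x ∈ (extChartAt I p).target) : TangentSpace I (chartPt I p x) ≃ₗ[ℝ] E :=
  { (toCoord I p (chartPt I p x) : TangentSpace I (chartPt I p x) →ₗ[ℝ] E) with
    invFun := ofCoord I p (chartPt I p x)
    left_inv := ofCoord_toCoord (chartPt_mem_source hx)
    right_inv := toCoord_ofCoord (chartPt_mem_source hx) }

variable [RiemannianBundle (fun x : M => TangentSpace I x)]

/-- The coordinates of an orthonormal basis of the tangent space at the point with coordinates `x`.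
It is the standard orthonormal basis, with respect to which traces over tangent spaces are taken. -/
def coordBasis (hx : x ∈ (extChartAt I p).target) : Module.Basis (Fin (Module.finrank ℝ E)) ℝ E :=
  ((stdOrthonormalBasis ℝ (TangentSpace I (chartPt I p x))).toBasis.map (coordEquiv hx)).reindex
    (finCongr (coordEquiv hx).finrank_eq)

lemma coordBasis_apply (hx : x ∈ (extChartAt I p).target) (i : Fin (Module.finrank ℝ E)) :
    coordBasis hx i = toCoord I p (chartPt I p x)
      (stdOrthonormalBasis ℝ (TangentSpace I (chartPt I p x))
        ((finCongr (coordEquiv hx).finrank_eq).symm i)) := by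
  rw [coordBasis, Module.Basis.reindex_apply, Module.Basis.map_apply,
    OrthonormalBasis.coe_toBasis]
  rfl

lemma isOrthonormalBasis_coordBasis (hx : x ∈ (extChartAt I p).target) :
    IsOrthonormalBasis (metricRep I p x) (coordBasis hx) where
  symm u v := by rw [metricRep_apply, metricRep_apply, real_inner_comm]
  apply i j := by
    rw [coordBasis_apply, coordBasis_apply, metricRep_toCoord hx,
      (stdOrthonormalBasis ℝ (TangentSpace I (chartPt I p x))).inner_eq_ite]
    simp only [EmbeddingLike.apply_eq_iff_eq]

lemma sum_stdOrthonormalBasis {F : Type*} [AddCommMonoid F] (hx : x ∈ (extChartAt I p).target)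
    (φ : E → F) :
    ∑ k, φ (toCoord I p (chartPt I p x)
      (stdOrthonormalBasis ℝ (TangentSpace I (chartPt I p x)) k)) = ∑ i, φ (coordBasis hx i) := by
  rw [← (finCongr (coordEquiv hx).finrank_eq).symm.sum_comp]
  simp only [coordBasis_apply]

variable [I.Boundaryless]

lemma scal_eq_sum_ricciForm [T2Space M]
    [IsContMDiffRiemannianBundle I ∞ E (fun x : M => TangentSpace I x)] {D : Connection I M}
    (hD : CovariantDerivative.ContMDiffCovariantDerivative D ∞) (hD' : D.torsion = 0)
    (hx : x ∈ (extChartAt I p).target) :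
    D.scal (chartPt I p x) = ∑ k, ricciForm (metricRep I p x) (coordBasis hx)
      (coordCurvatureL (christoffel D p) x) (coordBasis hx k) (coordBasis hx k) := by
  rw [Connection.scal, ← sum_stdOrthonormalBasis hx fun v => ricciForm (metricRep I p x)
      (coordBasis hx) (coordCurvatureL (christoffel D p) x) v v]
  refine Finset.sum_congr rfl fun k _ => ?_
  rw [Connection.ricci, ricciForm_apply, ← sum_stdOrthonormalBasis hx fun v => metricRep I p x
      (coordCurvatureL (christoffel D p) x v _ _) v]
  refine Finset.sum_congr rfl fun i _ => ?_
  rw [coordCurvatureL_apply, ← toCoord_curvature hD hD' hx, metricRep_toCoord hx]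

lemma codifferential_eq_neg_sum_covForm (D : Connection I M) (α : OneForm I M)
    (hx : x ∈ (extChartAt I p).target) :
    D.codifferential α (chartPt I p x) =
      -∑ i, covForm (christoffel D p) (formRep p fun y => α y) x (coordBasis hx i)
        (coordBasis hx i) := by
  rw [Connection.codifferential, ← sum_stdOrthonormalBasis hx fun v => covForm (christoffel D p)
    (formRep p fun y => α y) x v v]
  simp only [onForm_eq_fderiv_formRep D hx, covForm_apply]

omit [FiniteDimensional ℝ E] in
lemma exists_pos_le_metricRep [IsContMDiffRiemannianBundle I ∞ E (fun x : M => TangentSpace I x)]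
    (p : M) :
    ∃ c > 0, ∀ᶠ x in 𝓝 (extChartAt I p p), ∀ v : E, c * ‖v‖ ^ 2 ≤ metricRep I p x v v := by
  have : IsContinuousRiemannianBundle E (fun x : M => TangentSpace I x) := by
    obtain ⟨g, hg, hg_inner⟩ :=
      IsContMDiffRiemannianBundle.exists_contMDiff (IB := I) (n := ∞) (F := E)
        (E := fun x : M => TangentSpace I x)
    exact ⟨g, hg.continuous, hg_inner⟩
  obtain ⟨C, hC, h⟩ := eventually_norm_trivializationAt_lt E (fun x : M => TangentSpace I x) p
  refine ⟨(C ^ 2)⁻¹, by positivity, ?_⟩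
  replace h : ∀ᶠ y in 𝓝 (chartPt I p (extChartAt I p p)), ‖toCoord I p y‖ < C := by
    rwa [chartPt, extChartAt_to_inv]
  have htarget := mem_extChartAt_target (I := I) p
  filter_upwards [eventually_chartPt htarget h, extChartAt_target_mem_nhds_of_mem htarget]
    with x hxC hx v
  have hv := toCoord_ofCoord (chartPt_mem_source hx) v
  set X := ofCoord I p (chartPt I p x) v
  rw [inv_mul_le_iff₀ (by positivity), ← hv, metricRep_toCoord hx, real_inner_self_eq_norm_sq,
    ← mul_pow]
  gcongr
  exact (toCoord I p (chartPt I p x)).le_of_opNorm_le hxC.le X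

end OrthonormalFrame

section Ellipticity

variable {E : Type*} [NormedAddCommGroup E] {ι : Type*} [Fintype ι]

/-- The first-order coefficient of the operator `f ↦ Δ f + 4 ⟨α, df⟩`, in a chart with Christoffel
symbols `Γ` and with respect to an orthonormal basis `b`. -/
def driftVector [NormedSpace ℝ E] (Γ : E →L[ℝ] E →L[ℝ] E) (α : E →L[ℝ] ℝ) (b : ι → E) : E :=
  (4 : ℝ) • ∑ i, α (b i) • b i - ∑ i, Γ (b i) (b i)

lemma secondOrderOp_driftVector [NormedSpace ℝ E] (Γ : E → E →L[ℝ] E →L[ℝ] E) (α : E → E →L[ℝ] ℝ)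
    (b : ι → E) (f : E → ℝ) (x : E) :
    secondOrderOp b (driftVector (Γ x) (α x) b) f x =
      ∑ i, covForm Γ (fderiv ℝ f) x (b i) (b i) + 4 * ∑ i, α x (b i) * fderiv ℝ f x (b i) := by
  simp only [secondOrderOp, driftVector, covForm_apply, map_sub, map_smul, map_sum, smul_eq_mul,
    Finset.sum_sub_distrib]
  ring

lemma norm_driftVector_le [NormedSpace ℝ E] {Γ : E →L[ℝ] E →L[ℝ] E} {α : E →L[ℝ] ℝ} {b : ι → E}
    {K : ℝ} (hΓ : ‖Γ‖ ≤ K) (hα : ‖α‖ ≤ K) (hb : ∀ i, ‖b i‖ ^ 2 ≤ K) :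
    ‖driftVector Γ α b‖ ≤ 5 * Fintype.card ι * K ^ 2 := by
  have hK : 0 ≤ K := (norm_nonneg _).trans hα
  have hΓb : ‖∑ i, Γ (b i) (b i)‖ ≤ Fintype.card ι * K ^ 2 := by
    refine (norm_sum_le_of_le (n := fun _ => K ^ 2) _ fun i _ => ?_).trans (by simp)
    calc ‖Γ (b i) (b i)‖ ≤ ‖Γ‖ * ‖b i‖ * ‖b i‖ := Γ.le_opNorm₂ _ _
      _ = ‖Γ‖ * ‖b i‖ ^ 2 := by ring
      _ ≤ K * K := by gcongr; exact hb i
      _ = K ^ 2 := (sq K).symm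
  have hαb : ‖∑ i, α (b i) • b i‖ ≤ Fintype.card ι * K ^ 2 := by
    refine (norm_sum_le_of_le (n := fun _ => K ^ 2) _ fun i _ => ?_).trans (by simp)
    calc ‖α (b i) • b i‖ ≤ ‖α‖ * ‖b i‖ * ‖b i‖ := by
          rw [norm_smul]; gcongr; exact α.le_opNorm _
      _ = ‖α‖ * ‖b i‖ ^ 2 := by ring
      _ ≤ K * K := by gcongr; exact hb i
      _ = K ^ 2 := (sq K).symm
  calc ‖driftVector Γ α b‖ ≤ 4 * ‖∑ i, α (b i) • b i‖ + ‖∑ i, Γ (b i) (b i)‖ := by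
        refine (norm_sub_le _ _).trans_eq ?_
        rw [norm_smul, Real.norm_ofNat]
    _ ≤ 5 * Fintype.card ι * K ^ 2 := by linarith

variable [InnerProductSpace ℝ E] [DecidableEq ι]

lemma IsOrthonormalBasis.norm_sq_le_mul_sum_sq {g : E →L[ℝ] E →L[ℝ] ℝ} {b : Module.Basis ι ℝ E}
    (h : IsOrthonormalBasis g b) {K : ℝ} (hg : ‖g‖ ≤ K) (v : E) :
    ‖v‖ ^ 2 ≤ K * ∑ i, inner ℝ v (b i) ^ 2 := by
  rcases eq_or_ne v 0 with rfl | hv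
  · simp
  have hsum_inner : ∑ i, inner ℝ v (b i) * g v (b i) = ‖v‖ ^ 2 :=
    (h.sum_apply_mul (innerSL ℝ v : E →ₗ[ℝ] ℝ) v).trans (real_inner_self_eq_norm_sq v)
  have hsum_sq : ∑ i, g v (b i) ^ 2 = g v v := by
    simp_rw [sq]
    exact h.sum_apply_mul (g v : E →ₗ[ℝ] ℝ) v
  have hgv : g v v ≤ K * ‖v‖ ^ 2 := by
    calc g v v ≤ ‖g v v‖ := le_abs_self _
      _ ≤ ‖g‖ * ‖v‖ * ‖v‖ := g.le_opNorm₂ v v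
      _ ≤ K * ‖v‖ * ‖v‖ := by gcongr
      _ = K * ‖v‖ ^ 2 := by ring
  refine le_of_mul_le_mul_right (a := ‖v‖ ^ 2) ?_ (by positivity)
  calc ‖v‖ ^ 2 * ‖v‖ ^ 2 ≤ (∑ i, inner ℝ v (b i) ^ 2) * g v v := by
        rw [← sq, ← hsum_inner, ← hsum_sq]
        exact Finset.sum_mul_sq_le_sq_mul_sq _ _ _
    _ ≤ (∑ i, inner ℝ v (b i) ^ 2) * (K * ‖v‖ ^ 2) := by gcongr
    _ = K * (∑ i, inner ℝ v (b i) ^ 2) * ‖v‖ ^ 2 := by ring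

lemma IsOrthonormalBasis.isEllipticWith {g : E →L[ℝ] E →L[ℝ] ℝ} {b : Module.Basis ι ℝ E}
    (h : IsOrthonormalBasis g b) {Γ : E →L[ℝ] E →L[ℝ] E} {α : E →L[ℝ] ℝ} {K : ℝ} (hK : 0 < K)
    (hg : ‖g‖ ≤ K) (hΓ : ‖Γ‖ ≤ K) (hα : ‖α‖ ≤ K) (hpos : ∀ v, K⁻¹ * ‖v‖ ^ 2 ≤ g v v) :
    IsEllipticWith K⁻¹ (K + 1 + 5 * Fintype.card ι * K ^ 2) b (driftVector Γ α b) := by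
  have hb (i) : ‖b i‖ ^ 2 ≤ K := by
    have hbi := hpos (b i)
    rwa [h.apply, if_pos rfl, inv_mul_le_iff₀ hK, mul_one] at hbi
  refine ⟨fun i => ?_, ?_, fun v => (inv_mul_le_iff₀ hK).2 (h.norm_sq_le_mul_sum_sq hg v)⟩
  · have : ‖b i‖ ≤ K + 1 := by nlinarith [hb i, sq_nonneg (‖b i‖ - 1)]
    exact this.trans (le_add_of_nonneg_right (by positivity))
  · exact (norm_driftVector_le hΓ hα hb).trans (le_add_of_nonneg_left (by positivity))

lemma eventually_norm_le_of_lt {X F : Type*} [TopologicalSpace X] [NormedAddCommGroup F] {φ : X → F}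
    {x : X} {K : ℝ} (hφ : ContinuousAt φ x) (h : ‖φ x‖ < K) : ∀ᶠ z in 𝓝 x, ‖φ z‖ ≤ K :=
  (hφ.norm.eventually (gt_mem_nhds h)).mono fun _ hz => hz.le

lemma exists_isEllipticWith {X : Type*} [TopologicalSpace X] {x : X}
    {g : X → E →L[ℝ] E →L[ℝ] ℝ} {Γ : X → E →L[ℝ] E →L[ℝ] E} {α : X → E →L[ℝ] ℝ}
    (hg : ContinuousAt g x) (hΓ : ContinuousAt Γ x) (hα : ContinuousAt α x) {c : ℝ} (hc : 0 < c)
    (hpos : ∀ᶠ z in 𝓝 x, ∀ v, c * ‖v‖ ^ 2 ≤ g z v v) :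
    ∃ k > 0, ∃ C ≥ 0, ∀ᶠ z in 𝓝 x, ∀ b : Module.Basis ι ℝ E, IsOrthonormalBasis (g z) b →
      IsEllipticWith k C b (driftVector (Γ z) (α z) b) := by
  let K := c⁻¹ + ‖g x‖ + ‖Γ x‖ + ‖α x‖
  have hc' : 0 < c⁻¹ := inv_pos.2 hc
  have hK : 0 < K := by positivity
  have hgK : ‖g x‖ < K := by linarith [norm_nonneg (Γ x), norm_nonneg (α x)]
  have hΓK : ‖Γ x‖ < K := by linarith [norm_nonneg (g x), norm_nonneg (α x)]
  have hαK : ‖α x‖ < K := by linarith [norm_nonneg (g x), norm_nonneg (Γ x)]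
  have hcK : K⁻¹ ≤ c := inv_le_of_inv_le₀ hc <| by
    linarith [norm_nonneg (g x), norm_nonneg (Γ x), norm_nonneg (α x)]
  refine ⟨K⁻¹, inv_pos.2 hK, K + 1 + 5 * Fintype.card ι * K ^ 2, by positivity, ?_⟩
  have hg' := eventually_norm_le_of_lt (F := E →L[ℝ] E →L[ℝ] ℝ) hg hgK
  have hΓ' := eventually_norm_le_of_lt (F := E →L[ℝ] E →L[ℝ] E) hΓ hΓK
  filter_upwards [hpos, hg', hΓ', eventually_norm_le_of_lt hα hαK] with z hz hgz hΓz hαz b hb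
  exact hb.isEllipticWith hK hgz hΓz hαz fun v => le_trans (by gcongr) (hz v)

end Ellipticity

section Vanishing

lemma fderiv_eventuallyEq_zero {E : Type*} [NormedAddCommGroup E] [NormedSpace ℝ E] {f : E → ℝ}
    {x : E} {m : ℝ} (h : ∀ᶠ z in 𝓝 x, f z = m) : fderiv ℝ f =ᶠ[𝓝 x] 0 := by
  filter_upwards [eventually_eventually_nhds.2 h] with z hz
  rw [Filter.EventuallyEq.fderiv_eq hz, fderiv_fun_const]

lemma secondOrderOp_eq_zero {E ι : Type*} [NormedAddCommGroup E] [NormedSpace ℝ E] [Fintype ι]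
    {f : E → ℝ} {x : E} (hderiv : fderiv ℝ f =ᶠ[𝓝 x] 0) (e : ι → E) (b : E) :
    secondOrderOp e b f x = 0 := by
  have hderiv₂ : fderiv ℝ (fderiv ℝ f) x = 0 := by
    rw [hderiv.fderiv_eq, fderiv_zero]
    rfl
  simp [secondOrderOp, hderiv₂, hderiv.eq_of_nhds]

variable {E : Type*} [NormedAddCommGroup E] [InnerProductSpace ℝ E] [FiniteDimensional ℝ E]
  {H : Type*} [TopologicalSpace H] {I : ModelWithCorners ℝ E H} [I.Boundaryless]
  {M : Type*} [TopologicalSpace M] [T2Space M] [ChartedSpace H M] [IsManifold I ∞ M]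
  [RiemannianBundle (fun x : M => TangentSpace I x)]
  [IsContMDiffRiemannianBundle I ∞ E (fun x : M => TangentSpace I x)]
  {Q : AlmostQuaternionicStructure I M} {D D' : Connection I M} {α : OneForm I M}

variable (hE : 4 < Module.finrank ℝ E) (hD : Q.IsQuaternionicKahler D)
  (hD' : Q.IsQuaternionicConnection D') (hshift : Q.IsShift D' D α)
  (hα : ∀ x, D.codifferential α x = 0) (A : Q.Sections) (hA : ∀ x, hD'.penrose A x = 0)

include hE hD hshift hα hA

lemma eventually_bochner (p : M) :
    ∀ᶠ x in 𝓝 (extChartAt I p p), ∃ b : Module.Basis (Fin (Module.finrank ℝ E)) ℝ E,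
      IsOrthonormalBasis (metricRep I p x) b ∧
      (Module.finrank ℝ E + 8) * (qNormSq (endRep p A.1) x * secondOrderOp b
            (driftVector (christoffel D p x) (formRep p (fun y => α y) x) b)
            (qNormSq (endRep p A.1)) x
          - 8 * (∑ i, formRep p (fun y => α y) x (b i) ^ 2) * qNormSq (endRep p A.1) x ^ 2
          - 3 / 2 * ∑ i, fderiv ℝ (qNormSq (endRep p A.1)) x (b i) ^ 2) =
        -4 * D.scal (chartPt I p x) * qNormSq (endRep p A.1) x ^ 2 := by
  have : Nontrivial E := Module.nontrivial_of_finrank_pos (R := ℝ) (by omega)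
  obtain ⟨U, hpU, hU, J, hJ, hQK⟩ := exists_isQuaternionicKahlerOn hD p
  obtain ⟨β, hβ⟩ := exists_isTwistorOn_endRep hshift hD' A hA hU hJ hQK
  filter_upwards [hQK.isOpen.mem_nhds hpU] with x hx
  have hb := isOrthonormalBasis_coordBasis (hU hx)
  refine ⟨coordBasis (hU hx), hb, ?_⟩
  have hdiv := hα (chartPt I p x)
  rw [codifferential_eq_neg_sum_covForm D α (hU hx), neg_eq_zero] at hdiv
  rw [secondOrderOp_driftVector, hβ.bochner hQK hx hb hE hdiv,
    scal_eq_sum_ricciForm hD.quaternionic.smooth hD.quaternionic.torsionFree (hU hx)]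

lemma eventually_secondOrderOp_nonneg (hscal : ∀ x, D.scal x ≤ 0) {p : M}
    (hp : 0 < qInner (A.1 p) (A.1 p)) :
    ∀ᶠ x in 𝓝 (extChartAt I p p), ∃ b : Module.Basis (Fin (Module.finrank ℝ E)) ℝ E,
      IsOrthonormalBasis (metricRep I p x) b ∧
      0 ≤ secondOrderOp b (driftVector (christoffel D p x) (formRep p (fun y => α y) x) b)
        (qNormSq (endRep p A.1)) x := by
  have hpos : ∀ᶠ x in 𝓝 (extChartAt I p p), 0 < qNormSq (endRep p A.1) x := by
    refine (contDiffAt_qNormSq_endRep (mem_extChartAt_target p) A.1).continuousAt.eventually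
      (lt_mem_nhds ?_)
    rwa [← qInner_self_eq_qNormSq A.1 (mem_extChartAt_source p)]
  filter_upwards [eventually_bochner hE hD hD' hshift hα A hA p, hpos] with x ⟨b, hb, hbochner⟩ hx
  refine ⟨b, hb, nonneg_of_mul_nonneg_right ?_ hx⟩
  have hrhs : 0 ≤ -4 * D.scal (chartPt I p x) * qNormSq (endRep p A.1) x ^ 2 :=
    mul_nonneg (by linarith [hscal (chartPt I p x)]) (sq_nonneg _)
  rw [← hbochner] at hrhs
  have hα_sq : 0 ≤ 8 * (∑ i, formRep p (fun y => α y) x (b i) ^ 2) *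
    qNormSq (endRep p A.1) x ^ 2 := by positivity
  have hderiv_sq : 0 ≤ ∑ i, fderiv ℝ (qNormSq (endRep p A.1)) x (b i) ^ 2 := by positivity
  linarith [nonneg_of_mul_nonneg_right hrhs (by positivity)]

lemma eventually_qInner_self_eq (hscal : ∀ x, D.scal x ≤ 0) {p : M}
    (hp : 0 < qInner (A.1 p) (A.1 p))
    (hmax : ∀ y, qInner (A.1 y) (A.1 y) ≤ qInner (A.1 p) (A.1 p)) :
    ∀ᶠ y in 𝓝 p, qInner (A.1 y) (A.1 y) = qInner (A.1 p) (A.1 p) := by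
  have hx₀ := mem_extChartAt_target (I := I) p
  have hfp := qInner_self_eq_qNormSq A.1 (mem_extChartAt_source (I := I) p)
  obtain ⟨c, hc, hcg⟩ := exists_pos_le_metricRep (I := I) p
  obtain ⟨k, hk, C, hC, hell⟩ := exists_isEllipticWith (ι := Fin (Module.finrank ℝ E))
    (contDiffAt_metricRep (I := I) hx₀).continuousAt
    (contDiffAt_christoffel hD.quaternionic.smooth hx₀).continuousAt
    (contDiffAt_formRep hx₀ α).continuousAt hc hcg
  have hlocal : ∀ᶠ x in 𝓝 (extChartAt I p p),
      qNormSq (endRep p A.1) x = qNormSq (endRep p A.1) (extChartAt I p p) := by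
    have htarget : ∀ᶠ x in 𝓝 (extChartAt I p p), x ∈ (extChartAt I p).target :=
      extChartAt_target_mem_nhds_of_mem hx₀
    refine eventually_eq_of_secondOrderOp_nonneg (ι := Fin (Module.finrank ℝ E)) (htarget.and
      (hell.and (eventually_secondOrderOp_nonneg hE hD hD' hshift hα A hA hscal hp))) hk hC
      (fun x hx => (contDiffAt_qNormSq_endRep hx.1 A.1).of_le (by simpa using ENat.LEInfty.out))
      (fun x hx => ?_) ?_
    · rw [qNormSq_endRep hx.1, ← hfp]
      exact hmax _
    · rintro x ⟨-, hell, b, hb, hnonneg⟩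
      exact ⟨b, _, hell b hb, hnonneg⟩
  filter_upwards [(continuousAt_extChartAt p).eventually hlocal,
    extChartAt_source_mem_nhds (I := I) p] with y hy hy_source
  rw [qInner_self_eq_qNormSq A.1 hy_source, hy, hfp]

lemma scal_eq_zero_and_eq_zero_of_eventually_qInner_self_eq {p : M} (hscal : D.scal p ≤ 0)
    (hp : 0 < qInner (A.1 p) (A.1 p))
    (hconst : ∀ᶠ y in 𝓝 p, qInner (A.1 y) (A.1 y) = qInner (A.1 p) (A.1 p)) :
    D.scal p = 0 ∧ α p = 0 := by
  have hx₀ := mem_extChartAt_target (I := I) p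
  have hpt : chartPt I p (extChartAt I p p) = p := extChartAt_to_inv p
  obtain ⟨b, -, hbochner⟩ := (eventually_bochner hE hD hD' hshift hα A hA p).self_of_nhds
  have hfp := qInner_self_eq_qNormSq A.1 (mem_extChartAt_source (I := I) p)
  have hlocal : ∀ᶠ x in 𝓝 (extChartAt I p p),
      qNormSq (endRep p A.1) x = qInner (A.1 p) (A.1 p) := by
    rw [← hpt] at hconst
    filter_upwards [eventually_chartPt hx₀ hconst, extChartAt_target_mem_nhds_of_mem hx₀]
      with x hx hx_target
    rw [qNormSq_endRep hx_target, hx, hpt]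
  have hderiv := fderiv_eventuallyEq_zero hlocal
  simp only [secondOrderOp_eq_zero hderiv, hderiv.eq_of_nhds, ← hfp, hpt, Pi.zero_apply, zero_apply,
    mul_zero, zero_sub, ne_eq, OfNat.ofNat_ne_zero, not_false_eq_true, zero_pow,
    Finset.sum_const_zero, sub_zero] at hbochner
  have hscal_eq : D.scal p = 2 * (Module.finrank ℝ E + 8) *
      ∑ i, formRep p (fun y => α y) (extChartAt I p p) (b i) ^ 2 :=
    mul_right_cancel₀ (pow_ne_zero 2 hp.ne') (by linear_combination (1 / 4) * hbochner)
  have hsum : ∑ i, formRep p (fun y => α y) (extChartAt I p p) (b i) ^ 2 = 0 :=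
    (nonpos_of_mul_nonpos_right (hscal_eq ▸ hscal) (by positivity)).antisymm (by positivity)
  refine ⟨by rw [hscal_eq, hsum, mul_zero], ?_⟩
  have hform : formRep p (fun y => α y) (extChartAt I p p) = 0 :=
    ContinuousLinearMap.coe_injective <| b.ext fun i => pow_eq_zero_iff two_ne_zero |>.1 <|
      (Finset.sum_eq_zero_iff_of_nonneg fun i _ => sq_nonneg _).1 hsum i (Finset.mem_univ i)
  exact hpt ▸ eq_zero_of_formRep_eq_zero hx₀ hform

end Vanishing

end QuatGeom

end

theorem theorem5p4_general {E : Type*} [NormedAddCommGroup E] [InnerProductSpace ℝ E]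
    [FiniteDimensional ℝ E] (hE : 4 < Module.finrank ℝ E)
    {H : Type*} [TopologicalSpace H] {I : ModelWithCorners ℝ E H} [I.Boundaryless]
    {M : Type*} [TopologicalSpace M] [T2Space M] [CompactSpace M] [ConnectedSpace M]
    [ChartedSpace H M] [IsManifold I ∞ M]
    [RiemannianBundle (fun x : M => TangentSpace I x)]
    [IsContMDiffRiemannianBundle I ∞ E (fun x : M => TangentSpace I x)]
    (Q : AlmostQuaternionicStructure I M)
    (Dg : Connection I M) (hg : Q.IsQuaternionicKahler Dg)
    (D : Connection I M) (hD : Q.IsQuaternionicConnection D)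
    (α : OneForm I M) (hDα : Q.IsShift D Dg α)
    (hα : ∀ x, Dg.codifferential α x = 0)
    (hscal : ∀ x, Dg.scal x ≤ 0) (hne : ∃ x, Dg.scal x < 0 ∨ α x ≠ 0)
    (A : Q.Sections) (hA : ∀ x, hD.penrose A x = 0) :
    ∀ x, A.1 x = 0 := by
  intro x
  have : Nontrivial E := Module.nontrivial_of_finrank_pos (R := ℝ) (by omega)
  have hnt (y : M) : Nontrivial (TangentSpace I y) := inferInstanceAs (Nontrivial E)
  obtain ⟨q, -, hq⟩ := isCompact_univ.exists_isMaxOn (Set.univ_nonempty (α := M))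
    (continuous_qInner_self A.1).continuousOn
  have hmax (y : M) : qInner (A.1 y) (A.1 y) ≤ qInner (A.1 q) (A.1 q) := hq (Set.mem_univ y)
  have hnonneg (y : M) : 0 ≤ qInner (A.1 y) (A.1 y) :=
    (Q.basisAt_spec y).qInner_self_nonneg (A.2 y)
  rcases (hnonneg q).eq_or_lt with hzero | hpos
  · exact (Q.basisAt_spec x).eq_zero_of_qInner_self (A.2 x)
      (le_antisymm ((hmax x).trans hzero.ge) (hnonneg x))
  exfalso
  have hclopen : IsClopen {y | qInner (A.1 y) (A.1 y) = qInner (A.1 q) (A.1 q)} := by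
    refine ⟨isClosed_eq (continuous_qInner_self A.1) continuous_const,
      isOpen_iff_mem_nhds.2 fun p (hp : qInner (A.1 p) (A.1 p) = qInner (A.1 q) (A.1 q)) => ?_⟩
    rw [← hp] at hpos hmax
    have := eventually_qInner_self_eq hE hg hD hDα hα A hA hscal hpos hmax
    rwa [hp] at this
  have hconst (y : M) : qInner (A.1 y) (A.1 y) = qInner (A.1 q) (A.1 q) :=
    Set.eq_univ_iff_forall.1 (hclopen.eq_univ ⟨q, rfl⟩) y
  obtain ⟨y, hy⟩ := hne
  obtain ⟨hscal_y, hα_y⟩ := scal_eq_zero_and_eq_zero_of_eventually_qInner_self_eq hE hg hD hDα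
    hα A hA (hscal y) (by rwa [hconst]) (.of_forall fun z => (hconst z).trans (hconst y).symm)
  exact hy.elim (fun h => h.ne hscal_y) fun h => h hα_y

theorem theorem5p4 {n : ℕ} (hn : 2 ≤ n)
    {M : Type*} [TopologicalSpace M] [T2Space M] [CompactSpace M] [ConnectedSpace M]
    [ChartedSpace (EuclideanSpace ℝ (Fin (4 * n))) M] [IsManifold (𝓡 (4 * n)) ∞ M]
    [RiemannianBundle (fun x : M => TangentSpace (𝓡 (4 * n)) x)]
    [IsContMDiffRiemannianBundle (𝓡 (4 * n)) ∞ (EuclideanSpace ℝ (Fin (4 * n)))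
      (fun x : M => TangentSpace (𝓡 (4 * n)) x)]
    (Q : AlmostQuaternionicStructure (𝓡 (4 * n)) M)
    (Dg : Connection (𝓡 (4 * n)) M) (hg : Q.IsQuaternionicKahler Dg)
    (D : Connection (𝓡 (4 * n)) M) (hD : Q.IsQuaternionicConnection D)
    (α : OneForm (𝓡 (4 * n)) M) (hDα : Q.IsShift D Dg α)
    (hα : ∀ x, Dg.codifferential α x = 0)
    (hscal : (∀ x, Dg.scal x < 0) ∨ ((∀ x, Dg.scal x = 0) ∧ Dense {x | α x ≠ 0}))
    (A : Q.Sections) (hA : ∀ x, hD.penrose A x = 0) :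
    ∀ x, A.1 x = 0 := by
  refine theorem5p4_general (by rw [finrank_euclideanSpace_fin]; omega) Q Dg hg D hD α hDα hα
    ?_ ?_ A hA
  · exact hscal.elim (fun h x => (h x).le) fun h x => (h.1 x).le
  · exact hscal.elim (fun h => ⟨Classical.arbitrary M, .inl (h _)⟩)
      fun h => h.2.nonempty.imp fun _ => .inr
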